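/- Identify $\mathbb R^4$ with the quaternions $\mathbb H$, write $\mathbb C=\mathrm{span}\{1,i\}\subset\mathbb H$, $S^2=\{n\in\operatorname{Im}\mathbb H\mid n^2=-1\}$, and $*\omega(X)=\omega(iX)$ for 1-forms on a Riemann surface. The left normal of a conformal immersion $f:M\to\mathbb R^4$ of a Riemann surface $M$ is the map $N:M\to S^2$ with $*df=N\,df$; for a branched conformal immersion (a smooth weakly conformal map whose differential has only isolated zeros, the branch points) it is a smooth map to $S^2$ with this property. A conformal immersion $f$ is *Hamiltonian stationary* if it is Lagrangian for the symplectic form $\omega(v,w)=\langle jv,w\rangle$ and a critical point of the area under all compactly supported variations $Z$ along $f$ for which $\omega(Z,df)=dh$ with $h$ a compactly supported smooth function on $M$. A conformal immersion into $\mathbb R^4$ is *constrained Willmore* if it is a critical point of the Willmore energy $\int|\mathcal H|^2dA$ ($\mathcal H$ the mean curvature vector) under all compactly supported infinitesimal conformal variations. Let $f:M\to\mathbb R^4$ be Hamiltonian stationary with left normal $N$, and let $H:M\to\mathbb H$ be given by $(dN)'=\frac12(dN-N*dN)=-df\,H$. For $\mu\in\mathbb C\setminus\{0\}$ put $a=\frac{\mu+\mu^{-1}}2$,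 $b=\frac{\mu^{-1}-\mu}2\,i$ and $$d^\mu\alpha=d\alpha+\tfrac12\,df\,H\bigl(N\alpha(a-1)+\alpha b\bigr)$$ for $\mathbb H$-valued functions $\alpha$. Let $L\subset M\times\mathbb H^2$ be the bundle of right quaternionic lines spanned by $(f,1)$, and identify $\mathbb H^2/L$ with $\mathbb H$ via the class of $(1,0)$. The *prolongation* of a $d^\mu$-parallel section $\alpha$ is the $\mathbb H^2$-valued lift $\hat\varphi$ of $\alpha$ for which $d\hat\varphi$ takes values in $L$. Let $U\subset M$ be open. A branched conformal immersion $\hat f:U\to\mathbb R^4=S^4\setminus\{\infty\}$ is a *(local) $\mu$-Darboux transform* of $f$ if it is given by the prolongation of $d^\mu$-parallel sections, that is, if every point of $U$ has a neighbourhood on which $\hat\varphi\mathbb H=(\hat f,1)\mathbb H$ for the prolongation $\hat\varphi$ of a $d^\mu$-parallel section. (This includes the maps given by one parallel section with multiplier on the universal cover of $U$; the case $U=M$ is the global one.) **Theorem.** Let $f:M\to\mathbb R^4$ be a Hamiltonian stationary immersion of an arbitrary Riemann surface $M$, and let $\hat f:U\to\mathbb R^4$ be a (local) $\mu$-Darboux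 transform of $f$, for some $\mu\in\mathbb C\setminus\{0\}$ and some open $U\subset M$. Then $\hat f$ has a left normal, and every left normal of $\hat f$ is a harmonic map $U\to S^2$. In particular, $\hat f$ is constrained Willmore (away from its branch points). More generally, for every open $U\subset M$, every conformal immersion $g:U\to\mathbb R^4$ with harmonic left normal is constrained Willmore. -/

import Mathlib

open Quaternion
open scoped Manifold ContDiff Topology

/-!
Euclidean 4-space is the algebra `ℍ` of real quaternions. A Riemann surface is a Hausdorff, second
countable space `M` with an atlas of complex charts. Objects on `M` are read in the coordinate
`z = x + i y` of the charts `chartAt ℂ c`, `c : M`; every notion below is independent of the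
coordinate.
-/

namespace MuDarboux

noncomputable section

/-! ### Coordinates -/

/-- `u : M → F` in the coordinate of the chart `chartAt ℂ c`. -/
def inChart {M : Type*} [TopologicalSpace M] [ChartedSpace ℂ M] {F : Type*}
    (u : M → F) (c : M) : ℂ → F :=
  u ∘ (chartAt ℂ c).symm

/-- The part of `U ⊆ M` seen in the chart `chartAt ℂ c`. -/
def chartDom {M : Type*} [TopologicalSpace M] [ChartedSpace ℂ M] (U : Set M) (c : M) : Set ℂ :=
  (chartAt ℂ c).target ∩ (chartAt ℂ c).symm ⁻¹' U

/-- `∂u/∂x`. -/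
def dx {F : Type*} [NormedAddCommGroup F] [NormedSpace ℝ F] (u : ℂ → F) (z : ℂ) : F :=
  fderiv ℝ u z 1

/-- `∂u/∂y`. -/
def dy {F : Type*} [NormedAddCommGroup F] [NormedSpace ℝ F] (u : ℂ → F) (z : ℂ) : F :=
  fderiv ℝ u z Complex.I

/-- Real smoothness of a map on a subset of the surface. -/
def SmoothOn {M : Type*} [TopologicalSpace M] [ChartedSpace ℂ M]
    {F : Type*} [NormedAddCommGroup F] [NormedSpace ℝ F] (u : M → F) (U : Set M) : Prop :=
  ContMDiffOn 𝓘(ℝ, ℂ) 𝓘(ℝ, F) ∞ u U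

/-! ### Conformal maps and their left normal -/

/-- The points where the differential of `f` does not vanish. -/
def regularSet {M : Type*} [TopologicalSpace M] [ChartedSpace ℂ M] (f : M → ℍ) : Set M :=
  {p | fderiv ℝ (inChart f p) (chartAt ℂ p p) ≠ 0}

/-- Smooth and weakly conformal: `|f_x| = |f_y|` and `⟨f_x, f_y⟩ = 0`. -/
def IsWeaklyConformalOn {M : Type*} [TopologicalSpace M] [ChartedSpace ℂ M]
    (f : M → ℍ) (U : Set M) : Prop :=
  SmoothOn f U ∧ ∀ c : M, ∀ z ∈ chartDom U c,
    ‖dx (inChart f c) z‖ = ‖dy (inChart f c) z‖ ∧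
    inner ℝ (dx (inChart f c) z) (dy (inChart f c) z) = 0

/-- Conformal immersions. -/
def IsConformalImmersionOn {M : Type*} [TopologicalSpace M] [ChartedSpace ℂ M]
    (f : M → ℍ) (U : Set M) : Prop :=
  IsWeaklyConformalOn f U ∧ U ⊆ regularSet f

/-- Branched conformal immersions: weakly conformal, the zeros of the differential (the branch
points) being isolated. -/
def IsBranchedConformalImmersionOn {M : Type*} [TopologicalSpace M] [ChartedSpace ℂ M]
    (f : M → ℍ) (U : Set M) : Prop :=
  IsWeaklyConformalOn f U ∧ ∀ p ∈ U, ∀ᶠ q in 𝓝[≠] p, q ∈ regularSet f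

/-- `N : U → S² = {n ∈ Im ℍ | n² = -1}` is smooth and `*df = N df`, where `*ω (X) = ω (i X)`;
as `N² = -1`, the latter is `f_y = N f_x`. At an immersed point this determines `N`; at a branch
point it says that the left normal extends smoothly. -/
def IsLeftNormalOn {M : Type*} [TopologicalSpace M] [ChartedSpace ℂ M]
    (f N : M → ℍ) (U : Set M) : Prop :=
  SmoothOn N U ∧ (∀ p ∈ U, N p * N p = -1) ∧
  ∀ c : M, ∀ z ∈ chartDom U c,
    dy (inChart f c) z = inChart N c z * dx (inChart f c) z

/-- `N : U → S²` is a harmonic map into the round 2-sphere: `ΔN + |dN|² N = 0`. -/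
def IsHarmonicSphereMapOn {M : Type*} [TopologicalSpace M] [ChartedSpace ℂ M]
    (N : M → ℍ) (U : Set M) : Prop :=
  SmoothOn N U ∧ (∀ p ∈ U, N p * N p = -1) ∧
  ∀ c : M, ∀ z ∈ chartDom U c,
    dx (dx (inChart N c)) z + dy (dy (inChart N c)) z
      + (‖dx (inChart N c) z‖ ^ 2 + ‖dy (inChart N c) z‖ ^ 2) • inChart N c z = 0

/-! ### Integration, area and Willmore energy -/

/-- A smooth partition of unity on the surface, indexed by the charts `chartAt ℂ c`. -/
abbrev ChartPartition (M : Type*) [TopologicalSpace M] [ChartedSpace ℂ M] :=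
  SmoothPartitionOfUnity M 𝓘(ℝ, ℂ) M Set.univ

/-- The function with index `c` is supported in the domain of the chart `chartAt ℂ c`. -/
def IsSubordinateToCharts {M : Type*} [TopologicalSpace M] [ChartedSpace ℂ M]
    (ρ : ChartPartition M) : Prop :=
  ρ.IsSubordinate fun c => (chartAt ℂ c).source

/-- The integral over the compact set `K` of the density which is `w c z dx dy` in the chart
`chartAt ℂ c`. -/
def surfaceIntegral {M : Type*} [TopologicalSpace M] [ChartedSpace ℂ M]
    (ρ : ChartPartition M) (K : Set M) (w : M → ℂ → ℝ) : ℝ :=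
  ∑ᶠ c : M, ∫ z in chartDom K c, ρ c ((chartAt ℂ c).symm z) * w c z

/-- `E = ⟨u_x, u_x⟩`. -/
def gE (u : ℂ → ℍ) (z : ℂ) : ℝ := inner ℝ (dx u z) (dx u z)

/-- `F = ⟨u_x, u_y⟩`. -/
def gF (u : ℂ → ℍ) (z : ℂ) : ℝ := inner ℝ (dx u z) (dy u z)

/-- `G = ⟨u_y, u_y⟩`. -/
def gG (u : ℂ → ℍ) (z : ℂ) : ℝ := inner ℝ (dy u z) (dy u z)

/-- The determinant `E G - F²` of the induced metric. -/
def gDet (u : ℂ → ℍ) (z : ℂ) : ℝ := gE u z * gG u z - gF u z ^ 2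

/-- The area density `√(E G - F²)`. -/
def areaDensity (u : ℂ → ℍ) (z : ℂ) : ℝ := √(gDet u z)

/-- The component of `v` normal to the surface `u`, that is `v` minus its orthogonal projection
to the span of `u_x, u_y`. -/
def normalPart (u : ℂ → ℍ) (z : ℂ) (v : ℍ) : ℍ :=
  v - (gDet u z)⁻¹ •
    ((gG u z * inner ℝ v (dx u z) - gF u z * inner ℝ v (dy u z)) • dx u z
      + (gE u z * inner ℝ v (dy u z) - gF u z * inner ℝ v (dx u z)) • dy u z)

/-- The mean curvature vector `½ ∑ g^{kl} (∂_k ∂_l u)^⊥` of a (not necessarily conformal)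
immersion. -/
def meanCurvatureVector (u : ℂ → ℍ) (z : ℂ) : ℍ :=
  normalPart u z ((2 * gDet u z)⁻¹ •
    (gG u z • dx (dx u) z - (2 * gF u z) • dx (dy u) z + gE u z • dy (dy u) z))

/-- The Willmore density `|𝓗|² dA`. -/
def willmoreDensity (u : ℂ → ℍ) (z : ℂ) : ℝ :=
  ‖meanCurvatureVector u z‖ ^ 2 * areaDensity u z

/-- The area of `f` over the compact set `K`. -/
def area {M : Type*} [TopologicalSpace M] [ChartedSpace ℂ M]
    (ρ : ChartPartition M) (K : Set M) (f : M → ℍ) : ℝ :=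
  surfaceIntegral ρ K fun c => areaDensity (inChart f c)

/-- The Willmore energy `∫ |𝓗|² dA` of `f` over the compact set `K`. -/
def willmoreEnergy {M : Type*} [TopologicalSpace M] [ChartedSpace ℂ M]
    (ρ : ChartPartition M) (K : Set M) (f : M → ℍ) : ℝ :=
  surfaceIntegral ρ K fun c => willmoreDensity (inChart f c)

/-! ### Hamiltonian stationary immersions -/

/-- The quaternion `j`. -/
def qj : ℍ := ⟨0, 0, 1, 0⟩

/-- The symplectic form of the complex structure on `ℍ` given by left multiplication by `j`. -/
def symplectic (v w : ℍ) : ℝ := inner ℝ (qj * v) w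

/-- Lagrangian maps: `f^* ω = 0`. -/
def IsLagrangian {M : Type*} [TopologicalSpace M] [ChartedSpace ℂ M] (f : M → ℍ) : Prop :=
  ∀ c : M, ∀ z ∈ (chartAt ℂ c).target,
    symplectic (dx (inChart f c) z) (dy (inChart f c) z) = 0

/-- A compactly supported vector field `Z` along `f` is Hamiltonian if the 1-form `ω(Z, df)` is the
differential of a compactly supported function. -/
def IsHamiltonianVariation {M : Type*} [TopologicalSpace M] [ChartedSpace ℂ M]
    (f Z : M → ℍ) : Prop :=
  SmoothOn Z Set.univ ∧ HasCompactSupport Z ∧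
  ∃ h : M → ℝ, SmoothOn h Set.univ ∧ HasCompactSupport h ∧
    ∀ c : M, ∀ z ∈ (chartAt ℂ c).target,
      symplectic (inChart Z c z) (dx (inChart f c) z) = dx (inChart h c) z ∧
      symplectic (inChart Z c z) (dy (inChart f c) z) = dy (inChart h c) z

/-- Hamiltonian stationary (conformal, Lagrangian) immersions: critical points of the area under all
Hamiltonian variations. The integrals do not depend on the partition of unity. -/
def IsHamiltonianStationary {M : Type*} [TopologicalSpace M] [ChartedSpace ℂ M]
    (f : M → ℍ) : Prop :=
  IsConformalImmersionOn f Set.univ ∧ IsLagrangian f ∧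
  ∀ Z : M → ℍ, IsHamiltonianVariation f Z →
    ∀ ρ : ChartPartition M, IsSubordinateToCharts ρ →
      HasDerivAt (fun t : ℝ => area ρ (tsupport Z) (fun p => f p + t • Z p)) 0 0

/-! ### Constrained Willmore immersions -/

/-- A compactly supported vector field `Y` along `g`, with support in `U`, is an infinitesimal
conformal variation: the induced metrics of `g + t Y` are conformal to first order at `t = 0`. -/
def IsConformalVariationOn {M : Type*} [TopologicalSpace M] [ChartedSpace ℂ M]
    (g Y : M → ℍ) (U : Set M) : Prop :=
  SmoothOn Y Set.univ ∧ HasCompactSupport Y ∧ tsupport Y ⊆ U ∧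
  ∀ c : M, ∀ z ∈ chartDom U c,
    inner ℝ (dx (inChart g c) z) (dx (inChart Y c) z)
      = inner ℝ (dy (inChart g c) z) (dy (inChart Y c) z) ∧
    inner ℝ (dx (inChart g c) z) (dy (inChart Y c) z)
      + inner ℝ (dy (inChart g c) z) (dx (inChart Y c) z) = 0

/-- Constrained Willmore immersions: conformal immersions which are critical points of the Willmore
energy under compactly supported infinitesimal conformal variations. -/
def IsConstrainedWillmoreOn {M : Type*} [TopologicalSpace M] [ChartedSpace ℂ M]
    (g : M → ℍ) (U : Set M) : Prop :=
  IsConformalImmersionOn g U ∧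
  ∀ Y : M → ℍ, IsConformalVariationOn g Y U →
    ∀ ρ : ChartPartition M, IsSubordinateToCharts ρ →
      HasDerivAt (fun t : ℝ => willmoreEnergy ρ (tsupport Y) (fun p => g p + t • Y p)) 0 0

/-! ### The connections `d^μ` and `μ`-Darboux transforms -/

/-- The complex number `a = (μ + μ⁻¹) / 2`. -/
def aCoeff (μ : ℂ) : ℂ := (μ + μ⁻¹) / 2

/-- The complex number `b = i (μ⁻¹ - μ) / 2`. -/
def bCoeff (μ : ℂ) : ℂ := (μ⁻¹ - μ) / 2 * Complex.I

/-- The function `H` with `(dN)' = ½ (dN - N *dN) = - df H`, evaluated on `∂/∂x`. -/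
def hCoeff (f N : ℂ → ℍ) (z : ℂ) : ℍ :=
  -((dx f z)⁻¹ * ((1 / 2 : ℝ) • (dx N z - N z * dy N z)))

/-- `H (N α (a - 1) + α b)`; complex numbers act on `ℍ` by right multiplication, via
`ℂ = span {1, i}`. -/
def connTerm (f N α : ℂ → ℍ) (μ : ℂ) (z : ℂ) : ℍ :=
  hCoeff f N z * (N z * α z * ((aCoeff μ - 1 : ℂ) : ℍ) + α z * ((bCoeff μ : ℂ) : ℍ))

/-- `α` is a `d^μ`-parallel section of the trivial `ℍ`-bundle over `V`, where
`d^μ α = dα + ½ df H (N α (a - 1) + α b)`. -/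
def IsParallelOn {M : Type*} [TopologicalSpace M] [ChartedSpace ℂ M]
    (f N : M → ℍ) (μ : ℂ) (α : M → ℍ) (V : Set M) : Prop :=
  SmoothOn α V ∧ ∀ c : M, ∀ z ∈ chartDom V c,
    dx (inChart α c) z + (1 / 2 : ℝ) •
      (dx (inChart f c) z * connTerm (inChart f c) (inChart N c) (inChart α c) μ z) = 0 ∧
    dy (inChart α c) z + (1 / 2 : ℝ) •
      (dy (inChart f c) z * connTerm (inChart f c) (inChart N c) (inChart α c) μ z) = 0

/-- The map `ℍ² → ℍ² / L ≅ ℍ`, where `L` is the quaternionic (right) line spanned by `(q, 1)` and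
`ℍ² / L` is identified with `ℍ` via the class of `(1, 0)`. -/
def quotMap (q v₁ v₂ : ℍ) : ℍ := v₁ - q * v₂

/-- `φ = (φ₁, φ₂) : V → ℍ²` is the prolongation of the section `α` of `ℍ² / L ≅ ℍ`, where `L` is
the line bundle spanned by `(f, 1)`: `φ` is a lift of `α` and the projection of `dφ` to `ℍ² / L`
is zero. -/
def IsProlongationOn {M : Type*} [TopologicalSpace M] [ChartedSpace ℂ M]
    (f α φ₁ φ₂ : M → ℍ) (V : Set M) : Prop :=
  SmoothOn φ₁ V ∧ SmoothOn φ₂ V ∧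
  (∀ p ∈ V, quotMap (f p) (φ₁ p) (φ₂ p) = α p) ∧
  ∀ c : M, ∀ z ∈ chartDom V c,
    quotMap (inChart f c z) (dx (inChart φ₁ c) z) (dx (inChart φ₂ c) z) = 0 ∧
    quotMap (inChart f c z) (dy (inChart φ₁ c) z) (dy (inChart φ₂ c) z) = 0

/-- `fh : U → ℝ⁴ = S⁴ \ {∞}` is a (local) `μ`-Darboux transform of `f`: a branched conformal
immersion which is given by the prolongation of `d^μ`-parallel sections, that is, which near each
point of `U` is the quaternionic line `φ ℍ = (fh, 1) ℍ` for the prolongation `φ` of some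
`d^μ`-parallel section. A transform which is given by a section with multiplier on the universal
cover of `U` is of this form, as that section restricts to sections over small open subsets
of `U`. -/
def IsMuDarbouxTransformOn {M : Type*} [TopologicalSpace M] [ChartedSpace ℂ M]
    (f : M → ℍ) (μ : ℂ) (fh : M → ℍ) (U : Set M) : Prop :=
  IsBranchedConformalImmersionOn fh U ∧
  ∃ N : M → ℍ, IsLeftNormalOn f N Set.univ ∧
    ∀ p ∈ U, ∃ V : Set M, IsOpen V ∧ p ∈ V ∧ V ⊆ U ∧
      ∃ α φ₁ φ₂ : M → ℍ, IsParallelOn f N μ α V ∧ IsProlongationOn f α φ₁ φ₂ V ∧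
        ∀ q ∈ V, φ₂ q ≠ 0 ∧ φ₁ q = fh q * φ₂ q

end

end MuDarboux

/-! Split dN = (dN)' + (dN)'', where (dN)' = ½(dN − N*dN) satisfies *ω = Nω and (dN)'' satisfies *ω
= −Nω. A map N into S² is harmonic exactly when (dN)' is closed (`closed_primeXY_iff`). The proof
has three parts.

The left normal of a Hamiltonian stationary f is harmonic (`IsHamiltonianStationary.harmonic`). The
Lagrangian condition says that N is orthogonal to j, so N runs in a great circle, and harmonicity
reduces to the scalar equation ⟨ΔN, jN⟩ = 0, the harmonicity of an angle. Integration by parts turns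
the first variation of the area in the Hamiltonian direction of h into −∫ h⟨ΔN, jN⟩
(`LocalLagrangian.integral_firstVariation`), and h is arbitrary.

Harmonicity passes to the Darboux transform. Put c₁ = a − 1, c₂ = b, T = Nαc₁α⁻¹ + αc₂α⁻¹ and m =
αc₂c₁⁻¹α⁻¹. Parallelism reads dα = ½(dN)'Tα. From a² + b² = 1 come the relation NT − Tm = 2 and the
Riccati equation dT = (dN)''αc₁α⁻¹ − ½T(dN)'T. Hence N̂ = −T⁻¹NT = −2T⁻¹ − m, and sorting dN̂ by
type gives (dN̂)' = (dN)' − 2d(T⁻¹) (`DarbouxData.primeXY_normal`). The two forms differ by an exact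
one, so N̂ is harmonic when N is. That N̂ is a left normal of f̂ follows from df ∧ dφ₂ = 0 and the
fact that (dN)' anticommutes with N (`LocalDarboux.leftNormal`). The formula for N̂ is smooth across
branch points, and left normals are unique because regular points are dense (`leftNormal_unique`),
so local normals glue.

A conformal immersion g with harmonic left normal is constrained Willmore
(`constrainedWillmore_of_harmonic`). Since Δg = (N_y + N N_x)g_x in a coordinate, the Willmore
density is ¼|N_y + N N_x|² = ¼|dN|² + ½⟨N_y, N N_x⟩, the energy density of N plus a multiple of the
pulled back area form of S². An infinitesimal conformal variation of g moves N by a field n tangent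
to S², and the derivative of the Willmore density is the first variation of this expression along n
(`LocalVariation.fderiv_jetWillmore`). For harmonic N that is a divergence (`energyDensity_eq_div`)
and integrates to zero. As g + tY is conformal only to first order, the densities are differentiated
as functions on 2-jets of arbitrary immersions. -/

namespace MuDarboux

noncomputable section

/-! ### Partial derivatives -/

section Calculus

variable {F : Type*} [NormedAddCommGroup F] [NormedSpace ℝ F]

/-- The derivative of `u` in the constant direction `e`. -/
def pd (e : ℂ) (u : ℂ → F) (z : ℂ) : F := fderiv ℝ u z e

lemma dx_eq_pd (u : ℂ → F) : dx u = pd 1 u := rfl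

lemma dy_eq_pd (u : ℂ → F) : dy u = pd Complex.I u := rfl

lemma pd_congr {e : ℂ} {u v : ℂ → F} {z : ℂ} (h : u =ᶠ[𝓝 z] v) : pd e u z = pd e v z := by
  simp only [pd, h.fderiv_eq]

lemma pd_eventuallyEq {e : ℂ} {u v : ℂ → F} {z : ℂ} (h : u =ᶠ[𝓝 z] v) :
    pd e u =ᶠ[𝓝 z] pd e v :=
  h.eventuallyEq_nhds.mono fun _ hw => pd_congr hw

lemma fderiv_apply_eq (u : ℂ → F) (z w : ℂ) :
    fderiv ℝ u z w = w.re • dx u z + w.im • dy u z := by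
  have : w = w.re • (1 : ℂ) + w.im • Complex.I := by
    apply Complex.ext <;> simp
  conv_lhs => rw [this]
  rw [map_add, map_smul, map_smul]
  rfl

lemma fderiv_eq_zero_iff (u : ℂ → F) (z : ℂ) :
    fderiv ℝ u z = 0 ↔ dx u z = 0 ∧ dy u z = 0 := by
  constructor
  · intro h
    simp [dx, dy, h]
  · rintro ⟨h1, h2⟩
    ext w
    simp [fderiv_apply_eq, h1, h2]

lemma pd_add {e : ℂ} {u v : ℂ → F} {z : ℂ} (hu : DifferentiableAt ℝ u z)
    (hv : DifferentiableAt ℝ v z) :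
    pd e (fun w => u w + v w) z = pd e u z + pd e v z := by
  simp only [pd, fderiv_fun_add hu hv]
  rfl

lemma pd_sub {e : ℂ} {u v : ℂ → F} {z : ℂ} (hu : DifferentiableAt ℝ u z)
    (hv : DifferentiableAt ℝ v z) :
    pd e (fun w => u w - v w) z = pd e u z - pd e v z := by
  simp only [pd, fderiv_fun_sub hu hv]
  rfl

lemma pd_neg {e : ℂ} {u : ℂ → F} {z : ℂ} :
    pd e (fun w => -u w) z = -pd e u z := by
  simp only [pd, fderiv_fun_neg]
  rfl

lemma pd_const_smul {e : ℂ} {u : ℂ → F} {z : ℂ} (r : ℝ) :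
    pd e (fun w => r • u w) z = r • pd e u z := by
  have : fderiv ℝ (fun w => r • u w) z = r • fderiv ℝ u z :=
    congrFun (fderiv_const_smul_field r) z
  simp only [pd, this]
  rfl

lemma pd_const {e : ℂ} {z : ℂ} (x : F) : pd e (fun _ => x) z = 0 := by
  simp [pd]

lemma pd_smul {e : ℂ} {r : ℂ → ℝ} {u : ℂ → F} {z : ℂ} (hr : DifferentiableAt ℝ r z)
    (hu : DifferentiableAt ℝ u z) :
    pd e (fun w => r w • u w) z = pd e r z • u z + r z • pd e u z := by
  simp only [pd, fderiv_fun_smul hr hu]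
  simp [add_comm]

lemma pd_mul {e : ℂ} {u v : ℂ → ℍ} {z : ℂ} (hu : DifferentiableAt ℝ u z)
    (hv : DifferentiableAt ℝ v z) :
    pd e (fun w => u w * v w) z = pd e u z * v z + u z * pd e v z := by
  simp only [pd, fderiv_fun_mul' hu hv]
  simp [add_comm]

lemma pd_mul_real {e : ℂ} {u v : ℂ → ℝ} {z : ℂ} (hu : DifferentiableAt ℝ u z)
    (hv : DifferentiableAt ℝ v z) :
    pd e (fun w => u w * v w) z = pd e u z * v z + u z * pd e v z :=
  pd_smul hu hv

lemma pd_inner {e : ℂ} {u v : ℂ → ℍ} {z : ℂ} (hu : DifferentiableAt ℝ u z)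
    (hv : DifferentiableAt ℝ v z) :
    pd e (fun w => (inner ℝ (u w) (v w) : ℝ)) z =
      inner ℝ (pd e u z) (v z) + inner ℝ (u z) (pd e v z) := by
  simp only [pd]
  rw [fderiv_inner_apply (𝕜 := ℝ) hu hv, add_comm]

lemma ContDiffAt.pd {e : ℂ} {u : ℂ → F} {z : ℂ} (hu : ContDiffAt ℝ ∞ u z) :
    ContDiffAt ℝ ∞ (pd e u) z :=
  (hu.fderiv_right (m := ∞) (by simp)).clm_apply contDiffAt_const

lemma ContDiffAt.dx {u : ℂ → F} {z : ℂ} (hu : ContDiffAt ℝ ∞ u z) :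
    ContDiffAt ℝ ∞ (dx u) z := ContDiffAt.pd hu

lemma ContDiffAt.dy {u : ℂ → F} {z : ℂ} (hu : ContDiffAt ℝ ∞ u z) :
    ContDiffAt ℝ ∞ (dy u) z := ContDiffAt.pd hu

lemma ContDiffAt.diff {E : Type*} [NormedAddCommGroup E] [NormedSpace ℝ E]
    {u : E → F} {z : E} (hu : ContDiffAt ℝ ∞ u z) :
    DifferentiableAt ℝ u z := hu.differentiableAt (by simp)

lemma pd_comm {e e' : ℂ} {u : ℂ → F} {z : ℂ} (hu : ContDiffAt ℝ ∞ u z) :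
    pd e (pd e' u) z = pd e' (pd e u) z := by
  have hs : IsSymmSndFDerivAt ℝ u z := hu.isSymmSndFDerivAt (by
    simpa using (WithTop.coe_le_coe.mpr le_top : ((2 : ℕ∞) : WithTop ℕ∞) ≤ ((⊤ : ℕ∞) : WithTop ℕ∞)))
  have hd : DifferentiableAt ℝ (fderiv ℝ u) z :=
    (hu.fderiv_right (m := ∞) (by simp)).differentiableAt (by simp)
  have key (a b : ℂ) : pd a (pd b u) z = fderiv ℝ (fderiv ℝ u) z a b := by
    change fderiv ℝ (fun w => fderiv ℝ u w b) z a = _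
    rw [fderiv_clm_apply hd (differentiableAt_const b)]
    simp
  rw [key, key, hs.eq]

lemma dx_dy_comm {u : ℂ → F} {z : ℂ} (hu : ContDiffAt ℝ ∞ u z) :
    dx (dy u) z = dy (dx u) z := pd_comm hu

lemma contDiffAt_quaternion_inv {u : ℂ → ℍ} {z : ℂ} (hu : ContDiffAt ℝ ∞ u z) (h0 : u z ≠ 0) :
    ContDiffAt ℝ ∞ (fun w => (u w)⁻¹) z := by
  have h := contDiffAt_ringInverse ℝ (n := ∞) (Units.mk0 (u z) h0)
  have h2 : ContDiffAt ℝ ∞ (fun w => Ring.inverse (u w)) z := ContDiffAt.comp z h hu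
  simpa [Ring.inverse_eq_inv'] using h2

lemma pd_inv {e : ℂ} {u : ℂ → ℍ} {z : ℂ} (hu : ContDiffAt ℝ ∞ u z) (h0 : u z ≠ 0) :
    pd e (fun w => (u w)⁻¹) z = -((u z)⁻¹ * pd e u z * (u z)⁻¹) := by
  have hi := contDiffAt_quaternion_inv hu h0
  have hne : ∀ᶠ w in 𝓝 z, u w ≠ 0 := hu.continuousAt.eventually_ne h0
  have h1 : pd e (fun w => u w * (u w)⁻¹) z = pd e (fun _ => (1 : ℍ)) z :=
    pd_congr (hne.mono fun w hw => mul_inv_cancel₀ hw)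
  rw [pd_mul (ContDiffAt.diff hu) (ContDiffAt.diff hi), pd_const] at h1
  have h2 : u z * pd e (fun w => (u w)⁻¹) z = -(pd e u z * (u z)⁻¹) :=
    eq_neg_of_add_eq_zero_right h1
  rw [mul_assoc, ← mul_neg, ← h2, ← mul_assoc, inv_mul_cancel₀ h0, one_mul]

end Calculus

/-! ### Quaternions -/

lemma inner_mul_left_self (a b c : ℍ) :
    (inner ℝ (a * b) (a * c) : ℝ) = ‖a‖ ^ 2 * inner ℝ b c := by
  rw [← real_inner_self_eq_norm_sq]
  simp only [Quaternion.inner_def, Quaternion.re_mul, Quaternion.imI_mul, Quaternion.imJ_mul,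
    Quaternion.imK_mul, Quaternion.re_star, Quaternion.imI_star, Quaternion.imJ_star,
    Quaternion.imK_star]
  ring

lemma inner_mul_right_self (a b c : ℍ) :
    (inner ℝ (b * a) (c * a) : ℝ) = ‖a‖ ^ 2 * inner ℝ b c := by
  rw [← real_inner_self_eq_norm_sq]
  simp only [Quaternion.inner_def, Quaternion.re_mul, Quaternion.imI_mul, Quaternion.imJ_mul,
    Quaternion.imK_mul, Quaternion.re_star, Quaternion.imI_star, Quaternion.imJ_star,
    Quaternion.imK_star]
  ring

lemma inner_eq_components (a b : ℍ) :
    (inner ℝ a b : ℝ) = a.re * b.re + a.imI * b.imI + a.imJ * b.imJ + a.imK * b.imK := by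
  simp only [Quaternion.inner_def, Quaternion.re_mul, Quaternion.re_star, Quaternion.imI_star,
    Quaternion.imJ_star, Quaternion.imK_star]
  ring

lemma norm_sq_eq_components (a : ℍ) :
    ‖a‖ ^ 2 = a.re ^ 2 + a.imI ^ 2 + a.imJ ^ 2 + a.imK ^ 2 := by
  rw [← real_inner_self_eq_norm_sq, inner_eq_components]
  ring

lemma sq_eq_neg_one_components {N : ℍ} (h : N * N = -1) :
    N.re = 0 ∧ N.imI ^ 2 + N.imJ ^ 2 + N.imK ^ 2 = 1 := by
  have h0 := congrArg QuaternionAlgebra.re h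
  have h1 := congrArg QuaternionAlgebra.imI h
  have h2 := congrArg QuaternionAlgebra.imJ h
  have h3 := congrArg QuaternionAlgebra.imK h
  simp only [Quaternion.re_mul, Quaternion.imI_mul, Quaternion.imJ_mul,
    Quaternion.imK_mul, Quaternion.re_neg, Quaternion.imI_neg, Quaternion.imJ_neg,
    Quaternion.imK_neg, Quaternion.re_one, Quaternion.imI_one, Quaternion.imJ_one,
    Quaternion.imK_one] at h0 h1 h2 h3
  have hre : N.re = 0 := by
    by_contra hne
    have e1 : N.imI = 0 := by
      have : N.re * N.imI = 0 := by linarith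
      exact (mul_eq_zero.mp this).resolve_left hne
    have e2 : N.imJ = 0 := by
      have : N.re * N.imJ = 0 := by linarith
      exact (mul_eq_zero.mp this).resolve_left hne
    have e3 : N.imK = 0 := by
      have : N.re * N.imK = 0 := by linarith
      exact (mul_eq_zero.mp this).resolve_left hne
    rw [e1, e2, e3] at h0
    nlinarith [sq_nonneg N.re]
  refine ⟨hre, ?_⟩
  rw [hre] at h0
  linarith

lemma norm_of_sq_eq_neg_one {N : ℍ} (h : N * N = -1) : ‖N‖ = 1 := by
  obtain ⟨h0, h1⟩ := sq_eq_neg_one_components h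
  have h2 : ‖N‖ ^ 2 = 1 := by
    rw [norm_sq_eq_components, h0]
    linarith
  nlinarith [norm_nonneg N]

lemma inner_mul_left_of_sq {N : ℍ} (h : N * N = -1) (a b : ℍ) :
    (inner ℝ (N * a) b : ℝ) = -inner ℝ a (N * b) := by
  obtain ⟨h0, -⟩ := sq_eq_neg_one_components h
  simp only [inner_eq_components, Quaternion.re_mul, Quaternion.imI_mul, Quaternion.imJ_mul,
    Quaternion.imK_mul, h0]
  ring

end

end MuDarboux

namespace MuDarboux

noncomputable section

/-! ### Maps into the 2-sphere -/

/-- The tangent plane of S² at N consists of the quaternions anticommuting with N: for imaginary X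
one has XN + NX = −2⟨X, N⟩, and the imaginary part of XN + NX is 2 Re(X)N. -/
lemma re_eq_zero_of_anticomm {N X : ℍ} (hN : N * N = -1) (h : X * N + N * X = 0) :
    X.re = 0 ∧ (inner ℝ X N : ℝ) = 0 := by
  obtain ⟨h0, hs⟩ := sq_eq_neg_one_components hN
  have e0 := congrArg QuaternionAlgebra.re h
  have e1 := congrArg QuaternionAlgebra.imI h
  have e2 := congrArg QuaternionAlgebra.imJ h
  have e3 := congrArg QuaternionAlgebra.imK h
  simp only [Quaternion.re_mul, Quaternion.imI_mul, Quaternion.imJ_mul, Quaternion.imK_mul,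
    Quaternion.re_add, Quaternion.imI_add, Quaternion.imJ_add, Quaternion.imK_add,
    Quaternion.re_zero, Quaternion.imI_zero, Quaternion.imJ_zero, Quaternion.imK_zero, h0]
    at e0 e1 e2 e3
  have hre : X.re = 0 := by
    linear_combination (N.imI / 2) * e1 + (N.imJ / 2) * e2 + (N.imK / 2) * e3 - X.re * hs
  refine ⟨hre, ?_⟩
  rw [inner_eq_components, h0, hre]
  linarith

lemma anticomm_of_inner_eq_zero {N X : ℍ} (hN : N * N = -1) (hre : X.re = 0)
    (h : (inner ℝ X N : ℝ) = 0) : X * N + N * X = 0 := by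
  obtain ⟨h0, -⟩ := sq_eq_neg_one_components hN
  rw [inner_eq_components, h0, hre] at h
  ext <;> simp [h0, hre] <;> linarith

lemma mul_self_of_re_eq_zero {X : ℍ} (h : X.re = 0) : X * X = -((‖X‖ ^ 2 : ℝ) : ℍ) := by
  generalize hc : ‖X‖ ^ 2 = c
  rw [norm_sq_eq_components, h] at hc
  ext <;> simp [h] <;> linarith [hc, h]

lemma pd_anticomm {e : ℂ} {N : ℂ → ℍ} {z : ℂ} (hN : ContDiffAt ℝ ∞ N z)
    (h2 : ∀ᶠ w in 𝓝 z, N w * N w = -1) : pd e N z * N z + N z * pd e N z = 0 := by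
  have h : pd e (fun w => N w * N w) z = pd e (fun _ => (-1 : ℍ)) z := pd_congr h2
  rwa [pd_mul (ContDiffAt.diff hN) (ContDiffAt.diff hN), pd_const] at h

/-- The `dx`-part of `(dN)' = ½ (dN - N *dN)`. -/
def primeX (N : ℂ → ℍ) (z : ℂ) : ℍ := (1 / 2 : ℝ) • (dx N z - N z * dy N z)

/-- The `dy`-part of `(dN)' = ½ (dN - N *dN)`. -/
def primeY (N : ℂ → ℍ) (z : ℂ) : ℍ := (1 / 2 : ℝ) • (dy N z + N z * dx N z)

/-- The derivatives dN/2 cancel in d(dN)', leaving −½ d(N*dN). Since N_x and N_y are imaginary, N_x²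
= −|N_x|² and N_y² = −|N_y|², so closedness reads N ΔN = |dN|². Multiplication by N turns this into
the harmonic map equation. -/
lemma closed_primeXY_iff {N : ℂ → ℍ} {z : ℂ} (hN : ContDiffAt ℝ ∞ N z)
    (h2 : ∀ᶠ w in 𝓝 z, N w * N w = -1) :
    dy (primeX N) z = dx (primeY N) z ↔
      dx (dx N) z + dy (dy N) z + (‖dx N z‖ ^ 2 + ‖dy N z‖ ^ 2) • N z = 0 := by
  have hx := ContDiffAt.dx hN
  have hy := ContDiffAt.dy hN
  have hd {u : ℂ → ℍ} (h : ContDiffAt ℝ ∞ u z) : DifferentiableAt ℝ u z := ContDiffAt.diff h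
  have e1 : dy (primeX N) z =
      (1 / 2 : ℝ) • (dx (dy N) z - (dy N z * dy N z + N z * dy (dy N) z)) := by
    rw [dx_dy_comm hN]
    change pd _ (fun w => (1 / 2 : ℝ) • (dx N w - N w * dy N w)) z = _
    rw [pd_const_smul, pd_sub (hd hx) (hd (hN.mul hy)), pd_mul (hd hN) (hd hy)]
    rfl
  have e2 : dx (primeY N) z =
      (1 / 2 : ℝ) • (dx (dy N) z + (dx N z * dx N z + N z * dx (dx N) z)) := by
    change pd _ (fun w => (1 / 2 : ℝ) • (dy N w + N w * dx N w)) z = _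
    rw [pd_const_smul, pd_add (hd hy) (hd (hN.mul hx)), pd_mul (hd hN) (hd hx)]
    rfl
  have hNz : N z * N z = -1 := h2.self_of_nhds
  have sx : dx N z * dx N z = -((‖dx N z‖ ^ 2 : ℝ) : ℍ) :=
    mul_self_of_re_eq_zero (re_eq_zero_of_anticomm hNz (pd_anticomm hN h2)).1
  have sy : dy N z * dy N z = -((‖dy N z‖ ^ 2 : ℝ) : ℍ) :=
    mul_self_of_re_eq_zero (re_eq_zero_of_anticomm hNz (pd_anticomm hN h2)).1
  rw [e1, e2, smul_right_inj (by norm_num : (1 / 2 : ℝ) ≠ 0), sx, sy]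
  set c := ‖dx N z‖ ^ 2
  set d := ‖dy N z‖ ^ 2
  set P := dx (dx N) z
  set Q := dy (dy N) z
  have hcd : (c + d) • N z = N z * ((c : ℝ) : ℍ) + N z * ((d : ℝ) : ℍ) := by
    rw [add_smul, Quaternion.mul_coe_eq_smul, Quaternion.mul_coe_eq_smul]
  constructor
  · intro h
    have h3 : N z * P + N z * Q = (c : ℍ) + (d : ℍ) := by
      rw [← sub_eq_zero] at h ⊢
      rw [← neg_eq_zero, ← h]
      abel
    have h4 : N z * N z * (P + Q) = N z * (c : ℍ) + N z * (d : ℍ) := by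
      rw [mul_assoc, mul_add, h3, mul_add]
    rw [hNz] at h4
    rw [hcd, ← h4]
    simp
  · intro h
    rw [hcd] at h
    have h3 : N z * (P + Q) = (c : ℍ) + (d : ℍ) := by
      have : N z * (P + Q + (N z * (c : ℍ) + N z * (d : ℍ))) = 0 := by rw [h, mul_zero]
      rw [mul_add, ← mul_add (N z) (c : ℍ), ← mul_assoc (N z) (N z), hNz, neg_one_mul] at this
      exact sub_eq_zero.mp (by rw [sub_eq_add_neg]; exact this)
    rw [← sub_eq_zero]
    rw [mul_add] at h3
    rw [← sub_eq_zero] at h3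
    rw [← neg_eq_zero, ← h3]
    abel

end

end MuDarboux

namespace MuDarboux

noncomputable section

/-! ### Algebra of the Darboux transformation -/

section DarbouxAlgebra

variable {N a m : ℍ}

/-- Here T = (N + m)a, and the hypothesis on `a` and `m` is (1 + m²)a = −2. In NT − Tm the mixed
terms cancel because `a` and `m` commute. The relation says that T conjugates N into m up to the
term 2T⁻¹. -/
lemma darboux_mul_sub (hN : N * N = -1) (hc : a * m = m * a) (h2 : a + m * m * a = -2) :
    N * ((N + m) * a) - (N + m) * a * m = 2 := by
  have : N * ((N + m) * a) - (N + m) * a * m =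
      (N * N + 1) * a - (a + m * m * a + 2) - (N + m) * (a * m - m * a) + 2 := by noncomm_ring
  rw [this, hN, h2, hc]
  simp

/-- With P = N + m this is NTP = TPN, that is (T⁻¹NT)P = PN. It determines the type of the term PAT
in the derivative of −T⁻¹NT. -/
lemma darboux_comm (hN : N * N = -1) (hc : a * m = m * a) (h2 : a + m * m * a = -2) :
    N * ((N + m) * a * (N + m)) = (N + m) * a * (N + m) * N := by
  rw [← sub_eq_zero]
  have : N * ((N + m) * a * (N + m)) - (N + m) * a * (N + m) * N =
      (N * N + 1) * a * N + (N * N + 1) * a * m - N * a * (N * N + 1) - m * a * (N * N + 1)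
      - N * (a * m - m * a) * N - (a * m - m * a)
      + N * (m * (a * m - m * a)) - m * (a * m - m * a) * N
      + N * (a + m * m * a + 2) - (a + m * m * a + 2) * N := by noncomm_ring
  rw [this, hN, h2, hc]
  simp

/-- The Riccati equation of T. When dα = ½ATα, the conjugates `a` and `m` change by half their
commutators with AT, so the left side is the product rule for (N + m)a. The relation NT − Tm = 2 and
AN = −NA remove every term in A except −½TAT. -/
lemma darboux_deriv {A B : ℍ} (hN : N * N = -1) (hA : A * N = -(N * A)) (hc : a * m = m * a)
    (h2 : a + m * m * a = -2) :
    (A + B + (1 / 2 : ℝ) • (A * ((N + m) * a) * m - m * (A * ((N + m) * a)))) * a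
      + (N + m) * ((1 / 2 : ℝ) • (A * ((N + m) * a) * a - a * (A * ((N + m) * a))))
      = B * a - (1 / 2 : ℝ) • ((N + m) * a * A * ((N + m) * a)) := by
  have h3 := darboux_mul_sub hN hc h2
  set T := (N + m) * a with hT
  have h4 : T * m = N * T - 2 := by rw [← h3]; abel
  have h5 : A * T * m = A * N * T - (2 : ℝ) • A := by
    rw [mul_assoc, h4, mul_sub, two_smul, mul_two, mul_assoc]
  have h6 : N * A * T = - (A * N * T) := by rw [hA]; simp
  have h7 : (N + m) * (A * T * a - a * (A * T)) =
      N * A * T * a + m * (A * T) * a - (N + m) * a * A * T := by noncomm_ring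
  rw [h5, mul_smul_comm, h7, h6, ← hT]
  simp only [smul_sub, smul_add, add_mul, sub_mul, smul_mul_assoc, mul_assoc, neg_mul, smul_neg,
    smul_smul]
  module

/-- This is the derivative of −2T⁻¹ − m, namely 2T⁻¹(dT)T⁻¹ − dm, with the Riccati equation inserted
for dT and half a commutator for dm. -/
lemma darboux_normal_deriv {A B : ℍ} (hN : N * N = -1) (hA : A * N = -(N * A))
    (hc : a * m = m * a) (h2 : a + m * m * a = -2) (hT : (N + m) * a ≠ 0) :
    (2 : ℝ) • (((N + m) * a)⁻¹ * (B * a - (1 / 2 : ℝ) • ((N + m) * a * A * ((N + m) * a)))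
        * ((N + m) * a)⁻¹)
      - (1 / 2 : ℝ) • (A * ((N + m) * a) * m - m * (A * ((N + m) * a)))
      = (2 : ℝ) • (((N + m) * a)⁻¹ * B * a * ((N + m) * a)⁻¹)
        + (1 / 2 : ℝ) • ((N + m) * A * ((N + m) * a)) := by
  have h3 := darboux_mul_sub hN hc h2
  set T := (N + m) * a with hT'
  have h4 : T * m = N * T - 2 := by rw [← h3]; abel
  have h5 : A * T * m = -(N * A * T) - (2 : ℝ) • A := by
    rw [mul_assoc, h4, mul_sub, two_smul, mul_two, ← mul_assoc, hA, neg_mul]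
  have h6 : T⁻¹ * (T * A * T) * T⁻¹ = A := by
    rw [mul_assoc T A T, ← mul_assoc T⁻¹ T, inv_mul_cancel₀ hT, one_mul, mul_assoc A T,
      mul_inv_cancel₀ hT, mul_one]
  rw [h5, mul_sub, sub_mul, mul_smul_comm, smul_mul_assoc, h6]
  simp only [smul_sub, smul_add, add_mul, mul_assoc, smul_neg, smul_smul]
  module

end DarbouxAlgebra

/-- If dα = Xα, then every αcα⁻¹ with constant c has derivative [X, αcα⁻¹]. The case needed is X =
½(dN)'T. -/
lemma pd_conj {e : ℂ} {α : ℂ → ℍ} {z : ℂ} (hα : ContDiffAt ℝ ∞ α z) (h0 : α z ≠ 0) (c X : ℍ)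
    (hX : pd e α z = X * α z) :
    pd e (fun w => α w * c * (α w)⁻¹) z =
      X * (α z * c * (α z)⁻¹) - α z * c * (α z)⁻¹ * X := by
  have hc : ContDiffAt ℝ ∞ (fun _ : ℂ => c) z := contDiffAt_const
  rw [pd_mul (ContDiffAt.diff (hα.mul hc)) (ContDiffAt.diff (contDiffAt_quaternion_inv hα h0)),
    pd_mul (ContDiffAt.diff hα) (ContDiffAt.diff hc), pd_const, pd_inv hα h0, hX, mul_zero, add_zero,
    ← mul_assoc (α z)⁻¹ X, mul_assoc _ (α z) (α z)⁻¹, mul_inv_cancel₀ h0, mul_one]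
  noncomm_ring

/-- The algebraic data of the Darboux transformation near a point. -/
structure DarbouxData (N α : ℂ → ℍ) (c₁ c₂ : ℍ) (W : Set ℂ) : Prop where
  isOpen : IsOpen W
  smoothN : ∀ z ∈ W, ContDiffAt ℝ ∞ N z
  smoothα : ∀ z ∈ W, ContDiffAt ℝ ∞ α z
  sq : ∀ z ∈ W, N z * N z = -1
  harmonic : ∀ z ∈ W, dy (primeX N) z = dx (primeY N) z
  comm : c₁ * c₂ = c₂ * c₁
  quad : c₁ * c₁ + c₂ * c₂ = -2 * c₁
  ne : c₁ ≠ 0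
  α_ne : ∀ z ∈ W, α z ≠ 0
  T_ne : ∀ z ∈ W, N z * α z * c₁ + α z * c₂ ≠ 0
  parX : ∀ z ∈ W, dx α z = (1 / 2 : ℝ) • (primeX N z * (N z * α z * c₁ + α z * c₂))
  parY : ∀ z ∈ W, dy α z = (1 / 2 : ℝ) • (primeY N z * (N z * α z * c₁ + α z * c₂))

/-- The operator `T = N α c₁ α⁻¹ + α c₂ α⁻¹`. -/
def darbouxT (N α : ℂ → ℍ) (c₁ c₂ : ℍ) (w : ℂ) : ℍ :=
  (N w * α w * c₁ + α w * c₂) * (α w)⁻¹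

/-- The left normal `-T⁻¹ N T` of the Darboux transform. -/
def darbouxNormal (N α : ℂ → ℍ) (c₁ c₂ : ℍ) (w : ℂ) : ℍ :=
  -((darbouxT N α c₁ c₂ w)⁻¹ * N w * darbouxT N α c₁ c₂ w)

lemma darbouxNormal_sq {N α : ℂ → ℍ} {c₁ c₂ : ℍ} {w : ℂ} (h2 : N w * N w = -1)
    (hT : darbouxT N α c₁ c₂ w ≠ 0) :
    darbouxNormal N α c₁ c₂ w * darbouxNormal N α c₁ c₂ w = -1 := by
  unfold darbouxNormal
  set T := darbouxT N α c₁ c₂ w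
  calc -(T⁻¹ * N w * T) * -(T⁻¹ * N w * T) = T⁻¹ * N w * (T * T⁻¹) * N w * T := by noncomm_ring
    _ = T⁻¹ * (N w * N w) * T := by rw [mul_inv_cancel₀ hT]; noncomm_ring
    _ = -1 := by rw [h2]; simp [hT]

lemma primeX_anticomm {N : ℂ → ℍ} {z : ℂ} (hN : ContDiffAt ℝ ∞ N z)
    (h2 : ∀ᶠ w in 𝓝 z, N w * N w = -1) : primeX N z * N z = -(N z * primeX N z) := by
  have hx := eq_neg_of_add_eq_zero_left (pd_anticomm (e := 1) hN h2)
  have hy := eq_neg_of_add_eq_zero_left (pd_anticomm (e := Complex.I) hN h2)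
  rw [← dx_eq_pd] at hx
  rw [← dy_eq_pd] at hy
  unfold primeX
  rw [smul_mul_assoc, mul_smul_comm, ← smul_neg, sub_mul, hx, mul_assoc (N z), hy]
  congr 1
  noncomm_ring

/-- The type *ω = Nω of ω = (dN)', evaluated on ∂/∂x. -/
lemma primeY_eq {N : ℂ → ℍ} {z : ℂ} (h2 : N z * N z = -1) : primeY N z = N z * primeX N z := by
  unfold primeX primeY
  rw [mul_smul_comm, mul_sub, ← mul_assoc, h2]
  congr 1
  noncomm_ring

/-! ### Harmonicity of the transformed normal −T⁻¹NT -/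

namespace DarbouxData

variable {N α : ℂ → ℍ} {c₁ c₂ : ℍ} {W : Set ℂ}

lemma sq_nhds (h : DarbouxData N α c₁ c₂ W) {z : ℂ} (hz : z ∈ W) :
    ∀ᶠ w in 𝓝 z, N w * N w = -1 :=
  (h.isOpen.eventually_mem hz).mono h.sq

lemma darbouxT_ne (h : DarbouxData N α c₁ c₂ W) {z : ℂ} (hz : z ∈ W) :
    darbouxT N α c₁ c₂ z ≠ 0 :=
  mul_ne_zero (h.T_ne z hz) (inv_ne_zero (h.α_ne z hz))

lemma smooth_conj (h : DarbouxData N α c₁ c₂ W) {z : ℂ} (hz : z ∈ W) (c : ℍ) :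
    ContDiffAt ℝ ∞ (fun w => α w * c * (α w)⁻¹) z :=
  ((h.smoothα z hz).mul contDiffAt_const).mul
    (contDiffAt_quaternion_inv (h.smoothα z hz) (h.α_ne z hz))

lemma smooth_T (h : DarbouxData N α c₁ c₂ W) {z : ℂ} (hz : z ∈ W) :
    ContDiffAt ℝ ∞ (darbouxT N α c₁ c₂) z :=
  ((((h.smoothN z hz).mul (h.smoothα z hz)).mul contDiffAt_const).add
    ((h.smoothα z hz).mul contDiffAt_const)).mul
    (contDiffAt_quaternion_inv (h.smoothα z hz) (h.α_ne z hz))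

lemma smooth_normal (h : DarbouxData N α c₁ c₂ W) {z : ℂ} (hz : z ∈ W) :
    ContDiffAt ℝ ∞ (darbouxNormal N α c₁ c₂) z :=
  (((contDiffAt_quaternion_inv (h.smooth_T hz) (h.darbouxT_ne hz)).mul
    (h.smoothN z hz)).mul (h.smooth_T hz)).neg

lemma conj_comm (h : DarbouxData N α c₁ c₂ W) {z : ℂ} (hz : z ∈ W) :
    α z * c₁ * (α z)⁻¹ * (α z * (c₂ * c₁⁻¹) * (α z)⁻¹) =
      α z * (c₂ * c₁⁻¹) * (α z)⁻¹ * (α z * c₁ * (α z)⁻¹) := by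
  have h0 := h.α_ne z hz
  have e (x y : ℍ) : α z * x * (α z)⁻¹ * (α z * y * (α z)⁻¹) = α z * (x * y) * (α z)⁻¹ := by
    calc _ = α z * x * ((α z)⁻¹ * α z) * y * (α z)⁻¹ := by noncomm_ring
      _ = _ := by rw [inv_mul_cancel₀ h0]; noncomm_ring
  rw [e, e]
  congr 2
  rw [← mul_assoc, h.comm, mul_assoc, mul_assoc, mul_inv_cancel₀ h.ne, inv_mul_cancel₀ h.ne]

/-- The quadratic relation between c₁ and c₂, divided by c₁ and conjugated by α: it is (1 + m²)a =
−2 for a = αc₁α⁻¹ and m = αc₂c₁⁻¹α⁻¹. -/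
lemma conj_quad (h : DarbouxData N α c₁ c₂ W) {z : ℂ} (hz : z ∈ W) :
    α z * c₁ * (α z)⁻¹ + α z * (c₂ * c₁⁻¹) * (α z)⁻¹ * (α z * (c₂ * c₁⁻¹) * (α z)⁻¹) *
      (α z * c₁ * (α z)⁻¹) = -2 := by
  have h0 := h.α_ne z hz
  have e (x y : ℍ) : α z * x * (α z)⁻¹ * (α z * y * (α z)⁻¹) = α z * (x * y) * (α z)⁻¹ := by
    calc _ = α z * x * ((α z)⁻¹ * α z) * y * (α z)⁻¹ := by noncomm_ring
      _ = _ := by rw [inv_mul_cancel₀ h0]; noncomm_ring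
  have hc : c₁⁻¹ * c₂ = c₂ * c₁⁻¹ := by
    calc c₁⁻¹ * c₂ = c₁⁻¹ * (c₂ * c₁) * c₁⁻¹ := by
          rw [mul_assoc, mul_assoc, mul_inv_cancel₀ h.ne, mul_one]
      _ = c₂ * c₁⁻¹ := by rw [← h.comm, ← mul_assoc, inv_mul_cancel₀ h.ne, one_mul]
  have h1 : c₁ + c₂ * c₁⁻¹ * (c₂ * c₁⁻¹) * c₁ = -2 := by
    have : c₂ * c₁⁻¹ * (c₂ * c₁⁻¹) * c₁ = c₂ * c₂ * c₁⁻¹ := by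
      rw [mul_assoc (c₂ * c₁⁻¹), mul_assoc c₂ c₁⁻¹ c₁, inv_mul_cancel₀ h.ne, mul_one, mul_assoc,
        hc, mul_assoc]
    rw [this]
    calc c₁ + c₂ * c₂ * c₁⁻¹ = (c₁ * c₁ + c₂ * c₂) * c₁⁻¹ := by
          rw [add_mul, mul_assoc c₁, mul_inv_cancel₀ h.ne, mul_one]
      _ = -2 := by rw [h.quad, mul_assoc, mul_inv_cancel₀ h.ne, mul_one]
  rw [e, e, ← add_mul, ← mul_add, h1]
  rw [mul_neg, neg_mul, mul_two, add_mul, mul_inv_cancel₀ h0]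
  norm_num

lemma T_eq (h : DarbouxData N α c₁ c₂ W) {z : ℂ} (hz : z ∈ W) :
    darbouxT N α c₁ c₂ z =
      (N z + α z * (c₂ * c₁⁻¹) * (α z)⁻¹) * (α z * c₁ * (α z)⁻¹) := by
  have h0 := h.α_ne z hz
  calc _ = N z * (α z * c₁ * (α z)⁻¹) + α z * c₂ * 1 * 1 * (α z)⁻¹ := by
        unfold darbouxT; noncomm_ring
    _ = N z * (α z * c₁ * (α z)⁻¹) + α z * c₂ * (c₁⁻¹ * ((α z)⁻¹ * α z) * c₁) * 1 * (α z)⁻¹ := by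
        rw [inv_mul_cancel₀ h0, mul_one c₁⁻¹, inv_mul_cancel₀ h.ne]
    _ = _ := by noncomm_ring

/-- Solve NT = Tm + 2 for T⁻¹NT. In this form T enters only through T⁻¹, which is why an exact form
−2d(T⁻¹) appears in the derivative. -/
lemma normal_eq (h : DarbouxData N α c₁ c₂ W) {z : ℂ} (hz : z ∈ W) :
    darbouxNormal N α c₁ c₂ z =
      -((2 : ℝ) • (darbouxT N α c₁ c₂ z)⁻¹) - α z * (c₂ * c₁⁻¹) * (α z)⁻¹ := by
  have hT := h.darbouxT_ne hz
  have h3 := darboux_mul_sub (h.sq z hz) (h.conj_comm hz) (h.conj_quad hz)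
  rw [← h.T_eq hz] at h3
  unfold darbouxNormal
  set T := darbouxT N α c₁ c₂ z
  set m := α z * (c₂ * c₁⁻¹) * (α z)⁻¹
  have h4 : N z * T = T * m + 2 := by rw [← h3]; abel
  rw [mul_assoc, h4, mul_add, ← mul_assoc, inv_mul_cancel₀ hT, one_mul, mul_two, two_smul]
  abel

/-- The derivative of `T` in a direction in which `dN = A + B`, `A` being the part `(dN)'`. -/
lemma pd_T_and_normal (h : DarbouxData N α c₁ c₂ W) {z : ℂ} (hz : z ∈ W) (e : ℂ) (A B : ℍ)
    (hN : pd e N z = A + B) (hA : A * N z = -(N z * A))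
    (hα : pd e α z = (1 / 2 : ℝ) • (A * (N z * α z * c₁ + α z * c₂))) :
    pd e (darbouxNormal N α c₁ c₂) z =
        (2 : ℝ) • ((darbouxT N α c₁ c₂ z)⁻¹ * B * (α z * c₁ * (α z)⁻¹) *
          (darbouxT N α c₁ c₂ z)⁻¹)
        + (1 / 2 : ℝ) • ((N z + α z * (c₂ * c₁⁻¹) * (α z)⁻¹) * A * darbouxT N α c₁ c₂ z) ∧
    (2 : ℝ) • ((darbouxT N α c₁ c₂ z)⁻¹ * B * (α z * c₁ * (α z)⁻¹) *
          (darbouxT N α c₁ c₂ z)⁻¹) =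
      A - (2 : ℝ) • pd e (fun w => (darbouxT N α c₁ c₂ w)⁻¹) z := by
  have h0 := h.α_ne z hz
  have hT := h.darbouxT_ne hz
  have hX : pd e α z = (1 / 2 : ℝ) • (A * darbouxT N α c₁ c₂ z) * α z := by
    rw [hα, darbouxT, smul_mul_assoc, ← mul_assoc, mul_assoc _ (α z)⁻¹, inv_mul_cancel₀ h0, mul_one]
  have ha := pd_conj (h.smoothα z hz) h0 c₁ _ hX
  have hm := pd_conj (h.smoothα z hz) h0 (c₂ * c₁⁻¹) _ hX
  have hTT : darbouxT N α c₁ c₂ =ᶠ[𝓝 z] fun w =>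
      (N w + α w * (c₂ * c₁⁻¹) * (α w)⁻¹) * (α w * c₁ * (α w)⁻¹) :=
    (h.isOpen.eventually_mem hz).mono fun w hw => h.T_eq hw
  have hNN : darbouxNormal N α c₁ c₂ =ᶠ[𝓝 z] fun w =>
      -((2 : ℝ) • (darbouxT N α c₁ c₂ w)⁻¹) - α w * (c₂ * c₁⁻¹) * (α w)⁻¹ :=
    (h.isOpen.eventually_mem hz).mono fun w hw => h.normal_eq hw
  have hTi := contDiffAt_quaternion_inv (h.smooth_T hz) hT
  -- The Riccati equation dT = Ba − ½TAT, with a = αc₁α⁻¹.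
  have hpT : pd e (darbouxT N α c₁ c₂) z = B * (α z * c₁ * (α z)⁻¹) -
      (1 / 2 : ℝ) • (darbouxT N α c₁ c₂ z * A * darbouxT N α c₁ c₂ z) := by
    rw [pd_congr hTT, pd_mul (ContDiffAt.diff ((h.smoothN z hz).add (h.smooth_conj hz _)))
      (ContDiffAt.diff (h.smooth_conj hz _)), pd_add (ContDiffAt.diff (h.smoothN z hz))
      (ContDiffAt.diff (h.smooth_conj hz _)), ha, hm, hN]
    have := darboux_deriv (A := A) (B := B) (h.sq z hz) hA (h.conj_comm hz) (h.conj_quad hz)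
    rw [← h.T_eq hz] at this
    rw [← this]
    simp only [smul_mul_assoc, mul_smul_comm, ← smul_sub]
  constructor
  · rw [pd_congr hNN, pd_sub (ContDiffAt.diff (hTi.const_smul (2 : ℝ)).neg)
      (ContDiffAt.diff (h.smooth_conj hz _)), pd_neg, pd_const_smul, pd_inv (h.smooth_T hz) hT,
      hpT, hm]
    have := darboux_normal_deriv (A := A) (B := B) (h.sq z hz) hA (h.conj_comm hz) (h.conj_quad hz)
      (by rw [← h.T_eq hz]; exact hT)
    rw [← h.T_eq hz] at this
    rw [← this]
    simp only [smul_mul_assoc, mul_smul_comm, ← smul_sub, smul_neg, neg_neg]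
  · rw [pd_inv (h.smooth_T hz) hT, hpT]
    set T := darbouxT N α c₁ c₂ z
    have h6 : T⁻¹ * (T * A * T) * T⁻¹ = A := by
      rw [mul_assoc T A T, ← mul_assoc T⁻¹ T, inv_mul_cancel₀ hT, one_mul, mul_assoc A T,
        mul_inv_cancel₀ hT, mul_one]
    rw [mul_sub, sub_mul, mul_smul_comm, smul_mul_assoc, h6, mul_assoc T⁻¹ B]
    module

/-- By `pd_T_and_normal`, dN̂ is the sum of 2T⁻¹(dN)''aT⁻¹ and ½P(dN)'T. The first term has type *ω
= N̂ω and the second type *ω = −N̂ω, so the first is (dN̂)'. The Riccati equation identifies it with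
(dN)' − 2d(T⁻¹). -/
lemma primeXY_normal (h : DarbouxData N α c₁ c₂ W) {z : ℂ} (hz : z ∈ W) :
    primeX (darbouxNormal N α c₁ c₂) z =
      primeX N z - (2 : ℝ) • dx (fun w => (darbouxT N α c₁ c₂ w)⁻¹) z ∧
    primeY (darbouxNormal N α c₁ c₂) z =
      primeY N z - (2 : ℝ) • dy (fun w => (darbouxT N α c₁ c₂ w)⁻¹) z := by
  have hT := h.darbouxT_ne hz
  have hsq := h.sq z hz
  have hA := primeX_anticomm (h.smoothN z hz) (h.sq_nhds hz)
  have hYX : primeY N z = N z * primeX N z := primeY_eq hsq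
  have hAy : primeY N z * N z = -(N z * primeY N z) := by
    rw [hYX, mul_assoc, hA, mul_neg]
  obtain ⟨hx1, hx2⟩ := h.pd_T_and_normal hz 1 (primeX N z)
    ((1 / 2 : ℝ) • (dx N z + N z * dy N z))
    (by rw [← dx_eq_pd, primeX]; module) hA (h.parX z hz)
  obtain ⟨hy1, hy2⟩ := h.pd_T_and_normal hz Complex.I (primeY N z)
    ((1 / 2 : ℝ) • (dy N z - N z * dx N z))
    (by rw [← dy_eq_pd, primeY]; module) hAy (h.parY z hz)
  -- The type *ω = −Nω of (dN)''.
  have hB : (1 / 2 : ℝ) • (dy N z - N z * dx N z) =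
      -(N z * ((1 / 2 : ℝ) • (dx N z + N z * dy N z))) := by
    rw [mul_smul_comm, ← smul_neg, mul_add, ← mul_assoc, hsq]
    congr 1
    noncomm_ring
  rw [← dx_eq_pd] at hx1 hx2
  rw [← dy_eq_pd] at hy1 hy2
  rw [← hx2, ← hy2]
  have hcomm := darboux_comm hsq (h.conj_comm hz) (h.conj_quad hz)
  rw [← h.T_eq hz] at hcomm
  unfold primeX primeY
  rw [hx1, hy1]
  rw [hB, hYX]
  have hn : darbouxNormal N α c₁ c₂ z =
    -((darbouxT N α c₁ c₂ z)⁻¹ * N z * darbouxT N α c₁ c₂ z) := rfl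
  rw [hn]
  set T := darbouxT N α c₁ c₂ z
  set P := N z + α z * (c₂ * c₁⁻¹) * (α z)⁻¹
  set A := primeX N z
  set a := α z * c₁ * (α z)⁻¹
  set B := (1 / 2 : ℝ) • (dx N z + N z * dy N z)
  have i1 (X : ℍ) : T * (T⁻¹ * X) = X := by rw [← mul_assoc, mul_inv_cancel₀ hT, one_mul]
  -- The commutation NTP = TPN, in the shape that sorts the term P(dN)'T by type.
  have i2 (X : ℍ) : T⁻¹ * (N z * (T * (P * X))) = P * (N z * X) := by
    calc _ = T⁻¹ * (N z * (T * P)) * X := by noncomm_ring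
      _ = (T⁻¹ * T) * P * N z * X := by rw [hcomm]; noncomm_ring
      _ = _ := by rw [inv_mul_cancel₀ hT]; noncomm_ring
  have i3 (X : ℍ) : N z * (N z * X) = -X := by rw [← mul_assoc, hsq, neg_one_mul]
  constructor <;>
  · simp only [mul_add, mul_smul_comm, neg_mul, mul_neg, mul_assoc, i1, i2, i3, neg_neg, smul_neg]
    module

/-- (dN̂)' and (dN)' differ by the exact form 2d(T⁻¹), so closedness is inherited. -/
lemma harmonic_normal (h : DarbouxData N α c₁ c₂ W) {z : ℂ} (hz : z ∈ W) :
    dx (dx (darbouxNormal N α c₁ c₂)) z + dy (dy (darbouxNormal N α c₁ c₂)) z +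
      (‖dx (darbouxNormal N α c₁ c₂) z‖ ^ 2 + ‖dy (darbouxNormal N α c₁ c₂) z‖ ^ 2) •
        darbouxNormal N α c₁ c₂ z = 0 := by
  have hW := h.isOpen.eventually_mem hz
  rw [← closed_primeXY_iff (h.smooth_normal hz)
    (hW.mono fun w hw => darbouxNormal_sq (h.sq w hw) (h.darbouxT_ne hw))]
  have hTi := contDiffAt_quaternion_inv (h.smooth_T hz) (h.darbouxT_ne hz)
  have hN := h.smoothN z hz
  have hX : ContDiffAt ℝ ∞ (primeX N) z :=
    ((ContDiffAt.dx hN).sub (hN.mul (ContDiffAt.dy hN))).const_smul (1 / 2 : ℝ)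
  have hY : ContDiffAt ℝ ∞ (primeY N) z :=
    ((ContDiffAt.dy hN).add (hN.mul (ContDiffAt.dx hN))).const_smul (1 / 2 : ℝ)
  have e1 : primeX (darbouxNormal N α c₁ c₂) =ᶠ[𝓝 z] fun w =>
    primeX N w - (2 : ℝ) • dx (fun w => (darbouxT N α c₁ c₂ w)⁻¹) w :=
    hW.mono fun w hw => (h.primeXY_normal hw).1
  have e2 : primeY (darbouxNormal N α c₁ c₂) =ᶠ[𝓝 z] fun w =>
    primeY N w - (2 : ℝ) • dy (fun w => (darbouxT N α c₁ c₂ w)⁻¹) w :=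
    hW.mono fun w hw => (h.primeXY_normal hw).2
  have c1 := ContDiffAt.diff ((ContDiffAt.dx hTi).const_smul (2 : ℝ))
  have c2 := ContDiffAt.diff ((ContDiffAt.dy hTi).const_smul (2 : ℝ))
  rw [dy_eq_pd, dx_eq_pd, pd_congr e1, pd_congr e2]
  rw [pd_sub (ContDiffAt.diff hX) c1, pd_sub (ContDiffAt.diff hY) c2, pd_const_smul, pd_const_smul,
    ← dy_eq_pd, ← dx_eq_pd, h.harmonic z hz]
  congr 2
  exact (dx_dy_comm hTi).symm

end DarbouxData

end

end MuDarboux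

namespace MuDarboux

noncomputable section

/-! ### The Darboux transform in a coordinate -/

/-- A rewriting of a² + b² = 1. -/
lemma coeff_quad {μ : ℂ} (hμ : μ ≠ 0) :
    (aCoeff μ - 1) * (aCoeff μ - 1) + bCoeff μ * bCoeff μ = -2 * (aCoeff μ - 1) := by
  unfold aCoeff bCoeff
  have hI : Complex.I * Complex.I = -1 := Complex.I_mul_I
  have h1 : μ * μ⁻¹ = 1 := mul_inv_cancel₀ hμ
  linear_combination ((μ⁻¹ - μ) / 2) ^ 2 * hI + h1

/-- If a = 1, then b² = 0 by the quadratic relation. Thus c₁ = 0 only when d^μ is the trivial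
connection. -/
lemma aCoeff_sub_one_ne_zero {μ : ℂ} (hμ : μ ≠ 0) (h : aCoeff μ - 1 ≠ 0 ∨ bCoeff μ ≠ 0) :
    aCoeff μ - 1 ≠ 0 := by
  intro h0
  have h1 := coeff_quad hμ
  rw [h0] at h1
  simp only [mul_zero, zero_add, mul_self_eq_zero] at h1
  simp [h0, h1] at h

/-- A `d^μ`-parallel section `α` over the coordinate domain `W`, its prolongation `(φ₁, φ₂)` and
the Darboux transform `fh`. -/
structure LocalDarboux (f N α φ₁ φ₂ fh : ℂ → ℍ) (μ : ℂ) (W : Set ℂ) : Prop where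
  isOpen : IsOpen W
  ne : μ ≠ 0
  smoothf : ∀ z ∈ W, ContDiffAt ℝ ∞ f z
  smoothN : ∀ z ∈ W, ContDiffAt ℝ ∞ N z
  smoothα : ∀ z ∈ W, ContDiffAt ℝ ∞ α z
  smoothφ₁ : ∀ z ∈ W, ContDiffAt ℝ ∞ φ₁ z
  smoothφ₂ : ∀ z ∈ W, ContDiffAt ℝ ∞ φ₂ z
  smoothfh : ∀ z ∈ W, ContDiffAt ℝ ∞ fh z
  sq : ∀ z ∈ W, N z * N z = -1
  conformal : ∀ z ∈ W, dy f z = N z * dx f z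
  immersed : ∀ z ∈ W, dx f z ≠ 0
  harmonic : ∀ z ∈ W,
    dx (dx N) z + dy (dy N) z + (‖dx N z‖ ^ 2 + ‖dy N z‖ ^ 2) • N z = 0
  parX : ∀ z ∈ W, dx α z + (1 / 2 : ℝ) • (dx f z * connTerm f N α μ z) = 0
  parY : ∀ z ∈ W, dy α z + (1 / 2 : ℝ) • (dy f z * connTerm f N α μ z) = 0
  lift : ∀ z ∈ W, quotMap (f z) (φ₁ z) (φ₂ z) = α z
  liftX : ∀ z ∈ W, quotMap (f z) (dx φ₁ z) (dx φ₂ z) = 0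
  liftY : ∀ z ∈ W, quotMap (f z) (dy φ₁ z) (dy φ₂ z) = 0
  φ₂_ne : ∀ z ∈ W, φ₂ z ≠ 0
  transform : ∀ z ∈ W, φ₁ z = fh z * φ₂ z

namespace LocalDarboux

variable {f N α φ₁ φ₂ fh : ℂ → ℍ} {μ : ℂ} {W : Set ℂ}

lemma parX' (h : LocalDarboux f N α φ₁ φ₂ fh μ W) {z : ℂ} (hz : z ∈ W) :
    dx α z = (1 / 2 : ℝ) • (primeX N z *
      (N z * α z * ((aCoeff μ - 1 : ℂ) : ℍ) + α z * ((bCoeff μ : ℂ) : ℍ))) := by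
  have := eq_neg_of_add_eq_zero_left (h.parX z hz)
  rw [this, connTerm, hCoeff, ← primeX, ← smul_neg]
  congr 1
  rw [neg_mul, mul_neg, neg_neg, mul_assoc, ← mul_assoc (dx f z), mul_inv_cancel₀ (h.immersed z hz),
    one_mul]

lemma parY' (h : LocalDarboux f N α φ₁ φ₂ fh μ W) {z : ℂ} (hz : z ∈ W) :
    dy α z = (1 / 2 : ℝ) • (primeY N z *
      (N z * α z * ((aCoeff μ - 1 : ℂ) : ℍ) + α z * ((bCoeff μ : ℂ) : ℍ))) := by
  have := eq_neg_of_add_eq_zero_left (h.parY z hz)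
  rw [this, connTerm, hCoeff, ← primeX, ← smul_neg, h.conformal z hz, primeY_eq (h.sq z hz)]
  congr 1
  rw [neg_mul, mul_neg, neg_neg, mul_assoc, mul_assoc (dx f z)⁻¹, ← mul_assoc (dx f z),
    mul_inv_cancel₀ (h.immersed z hz), one_mul, ← mul_assoc (N z) (primeX N z)]

/-- In dα = dφ₁ − df φ₂ − f dφ₂ the first and third terms cancel, because dφ lies in L. -/
lemma pd_section (h : LocalDarboux f N α φ₁ φ₂ fh μ W) {z : ℂ} (hz : z ∈ W) (e : ℂ)
    (he : quotMap (f z) (pd e φ₁ z) (pd e φ₂ z) = 0) :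
    pd e α z = -(pd e f z * φ₂ z) := by
  have h1 : α =ᶠ[𝓝 z] fun w => φ₁ w - f w * φ₂ w :=
    (h.isOpen.eventually_mem hz).mono fun w hw => (h.lift w hw).symm
  unfold quotMap at he
  rw [pd_congr h1, pd_sub (ContDiffAt.diff (h.smoothφ₁ z hz))
    (ContDiffAt.diff ((h.smoothf z hz).mul (h.smoothφ₂ z hz))),
    pd_mul (ContDiffAt.diff (h.smoothf z hz)) (ContDiffAt.diff (h.smoothφ₂ z hz)), sub_eq_zero.mp he]
  abel

/-- Parallelism makes dα a multiple of Nα(a − 1) + αb, while dα = −df φ₂ does not vanish: f is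
immersed and φ₂ ≠ 0. This one fact yields α ≠ 0, T ≠ 0 and the nontriviality of d^μ. -/
lemma section_factor_ne (h : LocalDarboux f N α φ₁ φ₂ fh μ W) {z : ℂ} (hz : z ∈ W) :
    N z * α z * ((aCoeff μ - 1 : ℂ) : ℍ) + α z * ((bCoeff μ : ℂ) : ℍ) ≠ 0 := by
  intro h0
  have h1 := h.parX' hz
  rw [h0, mul_zero, smul_zero, dx_eq_pd, h.pd_section hz 1 (h.liftX z hz), neg_eq_zero] at h1
  exact mul_ne_zero (h.immersed z hz) (h.φ₂_ne z hz) h1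

lemma sq_nhds (h : LocalDarboux f N α φ₁ φ₂ fh μ W) {z : ℂ} (hz : z ∈ W) :
    ∀ᶠ w in 𝓝 z, N w * N w = -1 :=
  (h.isOpen.eventually_mem hz).mono h.sq

lemma darbouxData (h : LocalDarboux f N α φ₁ φ₂ fh μ W) (hW : W.Nonempty) :
    DarbouxData N α ((aCoeff μ - 1 : ℂ) : ℍ) ((bCoeff μ : ℂ) : ℍ) W where
  isOpen := h.isOpen
  smoothN := h.smoothN
  smoothα := h.smoothα
  sq := h.sq
  harmonic z hz := (closed_primeXY_iff (h.smoothN z hz) (h.sq_nhds hz)).mpr (h.harmonic z hz)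
  comm := by rw [← Quaternion.coeComplex_mul, ← Quaternion.coeComplex_mul, mul_comm]
  quad := by
    have := congrArg (fun c : ℂ => (c : ℍ)) (coeff_quad h.ne)
    have h2 : ((2 : ℂ) : ℍ) = 2 := by
      rw [← one_add_one_eq_two, Quaternion.coeComplex_add, Quaternion.coeComplex_one,
        one_add_one_eq_two]
    have h3 (c : ℂ) : ((-c : ℂ) : ℍ) = -(c : ℍ) := by ext <;> simp
    simpa only [Quaternion.coeComplex_add, Quaternion.coeComplex_mul, h2, h3] using this
  ne := by
    obtain ⟨z, hz⟩ := hW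
    have h1 := h.section_factor_ne hz
    have h2 : aCoeff μ - 1 ≠ 0 ∨ bCoeff μ ≠ 0 := by
      by_contra hc
      push Not at hc
      rw [hc.1, hc.2] at h1
      simp at h1
    have h3 := aCoeff_sub_one_ne_zero h.ne h2
    intro h0
    apply h3
    have hr := congrArg QuaternionAlgebra.re h0
    have hi := congrArg QuaternionAlgebra.imI h0
    exact Complex.ext (by simpa using hr) (by simpa using hi)
  α_ne z hz h0 := by
    apply h.section_factor_ne hz
    simp [h0]
  T_ne z hz := h.section_factor_ne hz
  parX z hz := h.parX' hz
  parY z hz := h.parY' hz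

/-- Differentiate φ₁ = f̂φ₂ and use dφ₁ = f dφ₂ and f̂ − f = αφ₂⁻¹. The derivative of f̂ then
contains only that of φ₂. -/
lemma pd_transform (h : LocalDarboux f N α φ₁ φ₂ fh μ W) {z : ℂ} (hz : z ∈ W) (e : ℂ)
    (he : quotMap (f z) (pd e φ₁ z) (pd e φ₂ z) = 0) :
    pd e fh z = -(α z * (φ₂ z)⁻¹ * pd e φ₂ z * (φ₂ z)⁻¹) := by
  have h2 := h.φ₂_ne z hz
  have h1 : pd e φ₁ z = pd e fh z * φ₂ z + fh z * pd e φ₂ z := by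
    have : φ₁ =ᶠ[𝓝 z] fun w => fh w * φ₂ w := (h.isOpen.eventually_mem hz).mono h.transform
    rw [pd_congr this, pd_mul (ContDiffAt.diff (h.smoothfh z hz))
      (ContDiffAt.diff (h.smoothφ₂ z hz))]
  unfold quotMap at he
  have h3 : α z * (φ₂ z)⁻¹ = fh z - f z := by
    rw [← h.lift z hz, quotMap, h.transform z hz, ← sub_mul, mul_assoc, mul_inv_cancel₀ h2, mul_one]
  have h4 : pd e fh z * φ₂ z = -(fh z - f z) * pd e φ₂ z := by
    rw [sub_eq_zero.mp he] at h1
    rw [neg_mul, sub_mul, h1]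
    abel
  rw [h3, ← neg_mul, ← neg_mul, ← h4, mul_assoc, mul_inv_cancel₀ h2, mul_one]

/-- Put S = f_x φ₂ α⁻¹, which is invertible. Then S f̂_x = −f_x(φ₂)_x φ₂⁻¹ and likewise for y, so df
∧ dφ₂ = 0 gives S f̂_y = NS f̂_x. Moreover NS = SN̂, so S cancels. -/
lemma leftNormal (h : LocalDarboux f N α φ₁ φ₂ fh μ W) {z : ℂ} (hz : z ∈ W) :
    dy fh z = darbouxNormal N α ((aCoeff μ - 1 : ℂ) : ℍ) ((bCoeff μ : ℂ) : ℍ) z * dx fh z := by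
  have hd := h.darbouxData ⟨z, hz⟩
  have hT := hd.darbouxT_ne hz
  have hα := hd.α_ne z hz
  have h2 := h.φ₂_ne z hz
  have hf := h.immersed z hz
  have hsf := h.smoothf z hz
  have hsφ := h.smoothφ₂ z hz
  have hW := h.isOpen.eventually_mem hz
  -- This is d(dα) = 0 for dα = −df φ₂, with f_y = N f_x.
  have hφy : dx f z * dy φ₂ z = N z * dx f z * dx φ₂ z := by
    have ex : dx α =ᶠ[𝓝 z] fun w => -(dx f w * φ₂ w) :=
      hW.mono fun w hw => h.pd_section hw 1 (h.liftX w hw)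
    have ey : dy α =ᶠ[𝓝 z] fun w => -(dy f w * φ₂ w) :=
      hW.mono fun w hw => h.pd_section hw Complex.I (h.liftY w hw)
    have hc := dx_dy_comm (h.smoothα z hz)
    change pd 1 (dy α) z = pd Complex.I (dx α) z at hc
    rw [pd_congr ey, pd_congr ex, pd_neg, pd_neg,
      pd_mul (ContDiffAt.diff (ContDiffAt.dy hsf)) (ContDiffAt.diff hsφ),
      pd_mul (ContDiffAt.diff (ContDiffAt.dx hsf)) (ContDiffAt.diff hsφ), ← dx_eq_pd, ← dy_eq_pd,
      dx_dy_comm hsf, neg_inj, add_right_inj, h.conformal z hz] at hc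
    exact hc.symm
  have hS : dx f z * φ₂ z * (α z)⁻¹ = -((1 / 2 : ℝ) • (primeX N z *
      darbouxT N α ((aCoeff μ - 1 : ℂ) : ℍ) ((bCoeff μ : ℂ) : ℍ) z)) := by
    have h1 := h.parX' hz
    rw [dx_eq_pd, h.pd_section hz 1 (h.liftX z hz), ← dx_eq_pd] at h1
    rw [neg_eq_iff_eq_neg.mp h1, darbouxT, neg_mul, smul_mul_assoc, mul_assoc (primeX N z)]
  have hA := primeX_anticomm (h.smoothN z hz) (h.sq_nhds hz)
  -- Parallelism gives S = −½(dN)'T on ∂/∂x. Since (dN)' anticommutes with N and N̂ = −T⁻¹NT, the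
  -- two signs cancel.
  have hSN : dx f z * φ₂ z * (α z)⁻¹ *
      darbouxNormal N α ((aCoeff μ - 1 : ℂ) : ℍ) ((bCoeff μ : ℂ) : ℍ) z =
      N z * (dx f z * φ₂ z * (α z)⁻¹) := by
    rw [hS, darbouxNormal]
    set T := darbouxT N α ((aCoeff μ - 1 : ℂ) : ℍ) ((bCoeff μ : ℂ) : ℍ) z
    rw [neg_mul_neg, smul_mul_assoc, mul_neg, mul_smul_comm, ← smul_neg]
    congr 1
    calc primeX N z * T * (T⁻¹ * N z * T) = primeX N z * (T * T⁻¹) * N z * T := by noncomm_ring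
      _ = -(N z * (primeX N z * T)) := by
        rw [mul_inv_cancel₀ hT, mul_one, hA]; noncomm_ring
  have hx : dx fh z = -(α z * (φ₂ z)⁻¹ * dx φ₂ z * (φ₂ z)⁻¹) := h.pd_transform hz 1 (h.liftX z hz)
  have hy : dy fh z = -(α z * (φ₂ z)⁻¹ * dy φ₂ z * (φ₂ z)⁻¹) :=
    h.pd_transform hz Complex.I (h.liftY z hz)
  have hS0 : dx f z * φ₂ z * (α z)⁻¹ ≠ 0 := mul_ne_zero (mul_ne_zero hf h2) (inv_ne_zero hα)
  apply mul_left_cancel₀ hS0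
  rw [← mul_assoc, hSN, hx, hy]
  have key (X : ℍ) : dx f z * φ₂ z * (α z)⁻¹ * -(α z * (φ₂ z)⁻¹ * X * (φ₂ z)⁻¹) =
      -(dx f z * X * (φ₂ z)⁻¹) := by
    calc _ = -(dx f z * φ₂ z * ((α z)⁻¹ * α z) * (φ₂ z)⁻¹ * X * (φ₂ z)⁻¹) := by noncomm_ring
      _ = -(dx f z * (φ₂ z * (φ₂ z)⁻¹) * X * (φ₂ z)⁻¹) := by
        rw [inv_mul_cancel₀ hα]; noncomm_ring
      _ = _ := by rw [mul_inv_cancel₀ h2, mul_one]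
  rw [key, mul_assoc (N z), key, hφy]
  noncomm_ring

end LocalDarboux

end

end MuDarboux

namespace MuDarboux

noncomputable section

/-! ### Smoothness in charts and changes of coordinates -/

section Charts

variable {M : Type*} [TopologicalSpace M] [ChartedSpace ℂ M]

lemma mem_chartDom_iff {U : Set M} {c : M} {z : ℂ} :
    z ∈ chartDom U c ↔ z ∈ (chartAt ℂ c).target ∧ (chartAt ℂ c).symm z ∈ U := Iff.rfl

lemma isOpen_chartDom {U : Set M} (hU : IsOpen U) (c : M) : IsOpen (chartDom U c) :=
  (chartAt ℂ c).isOpen_inter_preimage_symm hU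

lemma chart_mem_chartDom {U : Set M} {c p : M} (hp : p ∈ U) (hc : p ∈ (chartAt ℂ c).source) :
    chartAt ℂ c p ∈ chartDom U c :=
  ⟨(chartAt ℂ c).map_source hc, by
    rw [Set.mem_preimage, (chartAt ℂ c).left_inv hc]; exact hp⟩

/-- The change of coordinates from the chart `chartAt ℂ c` to the chart `chartAt ℂ c'`. -/
def coordChange (c c' : M) (z : ℂ) : ℂ := chartAt ℂ c' ((chartAt ℂ c).symm z)

/-- Complex differentiable functions on open sets are analytic. This is how a C¹ complex atlas
yields the real smooth structure used for all smoothness statements. -/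
lemma coordChange_differentiableOn [IsManifold 𝓘(ℂ, ℂ) 1 M] {e e' : OpenPartialHomeomorph M ℂ}
    (he : e ∈ atlas ℂ M) (he' : e' ∈ atlas ℂ M) :
    ContDiffOn ℂ ω (e' ∘ e.symm) (e.symm.trans e').source := by
  have h1 : ContMDiffOn 𝓘(ℂ, ℂ) 𝓘(ℂ, ℂ) 1 e' e'.source :=
    contMDiffOn_of_mem_maximalAtlas (IsManifold.subset_maximalAtlas he')
  have h2 : ContMDiffOn 𝓘(ℂ, ℂ) 𝓘(ℂ, ℂ) 1 e.symm e.target :=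
    contMDiffOn_symm_of_mem_maximalAtlas (IsManifold.subset_maximalAtlas he)
  have h3 : ContMDiffOn 𝓘(ℂ, ℂ) 𝓘(ℂ, ℂ) 1 (e' ∘ e.symm) (e.symm.trans e').source := by
    refine h1.comp (h2.mono fun z hz => ?_) fun z hz => ?_
    · exact (OpenPartialHomeomorph.trans_source e.symm e' ▸ hz).1
    · exact (OpenPartialHomeomorph.trans_source e.symm e' ▸ hz).2
  exact (h3.contDiffOn.differentiableOn (by simp)).contDiffOn (e.symm.trans e').open_source

lemma isManifold_real [IsManifold 𝓘(ℂ, ℂ) 1 M] : IsManifold 𝓘(ℝ, ℂ) ∞ M := by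
  apply isManifold_of_contDiffOn
  intro e e' he he'
  have h := (coordChange_differentiableOn he he').restrict_scalars ℝ
  simpa using! h.of_le (by simp)

lemma coordChange_hasDerivAt [IsManifold 𝓘(ℂ, ℂ) 1 M] {c c' : M} {z : ℂ}
    (hz : z ∈ chartDom (chartAt ℂ c').source c) :
    HasDerivAt (coordChange c c') (deriv (coordChange c c') z) z := by
  have h := coordChange_differentiableOn (chart_mem_atlas ℂ c) (chart_mem_atlas ℂ c')
  have hz' : z ∈ ((chartAt ℂ c).symm.trans (chartAt ℂ c')).source := by
    rw [OpenPartialHomeomorph.trans_source]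
    exact hz
  exact ((h.differentiableOn (by simp)).differentiableAt
    (((chartAt ℂ c).symm.trans (chartAt ℂ c')).open_source.mem_nhds hz')).hasDerivAt

lemma coordChange_hasFDerivAt [IsManifold 𝓘(ℂ, ℂ) 1 M] {c c' : M} {z : ℂ}
    (hz : z ∈ chartDom (chartAt ℂ c').source c) :
    HasFDerivAt (coordChange c c')
      ((ContinuousLinearMap.toSpanSingleton ℂ (deriv (coordChange c c') z)).restrictScalars ℝ) z :=
  (coordChange_hasDerivAt hz).hasFDerivAt.restrictScalars ℝ

lemma inChart_chart {F : Type*} (u : M → F) {c p : M} (hc : p ∈ (chartAt ℂ c).source) :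
    inChart u c (chartAt ℂ c p) = u p := by
  simp only [inChart, Function.comp_apply]
  rw [(chartAt ℂ c).left_inv hc]

lemma inChart_eq_comp_coordChange {F : Type*} (u : M → F) {c c' : M} {z : ℂ}
    (hz : z ∈ chartDom (chartAt ℂ c').source c) :
    inChart u c =ᶠ[𝓝 z] inChart u c' ∘ coordChange c c' := by
  filter_upwards [(isOpen_chartDom (chartAt ℂ c').open_source c).mem_nhds hz] with w hw
  simp only [inChart, coordChange, Function.comp_apply]
  rw [(chartAt ℂ c').left_inv hw.2]

variable {F : Type*} [NormedAddCommGroup F] [NormedSpace ℝ F]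

lemma dx_coordChange [IsManifold 𝓘(ℂ, ℂ) 1 M] {u : M → F} {c c' : M} {z : ℂ}
    (hz : z ∈ chartDom (chartAt ℂ c').source c)
    (hu : DifferentiableAt ℝ (inChart u c') (coordChange c c' z)) :
    dx (inChart u c) z =
      (deriv (coordChange c c') z).re • dx (inChart u c') (coordChange c c' z) +
      (deriv (coordChange c c') z).im • dy (inChart u c') (coordChange c c' z) := by
  rw [dx, (inChart_eq_comp_coordChange u hz).fderiv_eq,
    (hu.hasFDerivAt.comp z (coordChange_hasFDerivAt hz)).fderiv]
  simp [fderiv_apply_eq]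

lemma dy_coordChange [IsManifold 𝓘(ℂ, ℂ) 1 M] {u : M → F} {c c' : M} {z : ℂ}
    (hz : z ∈ chartDom (chartAt ℂ c').source c)
    (hu : DifferentiableAt ℝ (inChart u c') (coordChange c c' z)) :
    dy (inChart u c) z =
      -((deriv (coordChange c c') z).im • dx (inChart u c') (coordChange c c' z)) +
      (deriv (coordChange c c') z).re • dy (inChart u c') (coordChange c c' z) := by
  rw [dy, (inChart_eq_comp_coordChange u hz).fderiv_eq,
    (hu.hasFDerivAt.comp z (coordChange_hasFDerivAt hz)).fderiv]
  simp [fderiv_apply_eq]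

lemma smoothOn_iff [IsManifold 𝓘(ℂ, ℂ) 1 M] {u : M → F} {U : Set M} (hU : IsOpen U) :
    SmoothOn u U ↔ ∀ c : M, ∀ z ∈ chartDom U c, ContDiffAt ℝ ∞ (inChart u c) z := by
  have : IsManifold 𝓘(ℝ, ℂ) ∞ M := isManifold_real
  constructor
  · intro h c z hz
    have h1 : ContMDiffAt 𝓘(ℝ, ℂ) 𝓘(ℝ, F) ∞ u ((chartAt ℂ c).symm z) :=
      h.contMDiffAt (hU.mem_nhds hz.2)
    have h2 : ContMDiffAt 𝓘(ℝ, ℂ) 𝓘(ℝ, ℂ) ∞ (chartAt ℂ c).symm z :=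
      contMDiffOn_chart_symm.contMDiffAt ((chartAt ℂ c).open_target.mem_nhds hz.1)
    exact (ContMDiffAt.comp z h1 h2).contDiffAt
  · intro h p hp
    have h1 := (h p _ (chart_mem_chartDom hp (mem_chart_source ℂ p)))
    have h2 : ContMDiffAt 𝓘(ℝ, ℂ) 𝓘(ℝ, ℂ) ∞ (chartAt ℂ p) p :=
      contMDiffOn_chart.contMDiffAt ((chartAt ℂ p).open_source.mem_nhds (mem_chart_source ℂ p))
    have h3 : ContMDiffAt 𝓘(ℝ, ℂ) 𝓘(ℝ, F) ∞ (inChart u p ∘ chartAt ℂ p) p :=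
      ContMDiffAt.comp p h1.contMDiffAt h2
    refine (h3.congr_of_eventuallyEq ?_).contMDiffWithinAt
    filter_upwards [(chartAt ℂ p).open_source.mem_nhds (mem_chart_source ℂ p)] with q hq
    simp only [inChart, Function.comp_apply]
    rw [(chartAt ℂ p).left_inv hq]

lemma SmoothOn.inChart [IsManifold 𝓘(ℂ, ℂ) 1 M] {u : M → F} {U : Set M} (h : SmoothOn u U)
    (hU : IsOpen U) {c : M} {z : ℂ} (hz : z ∈ chartDom U c) : ContDiffAt ℝ ∞ (inChart u c) z :=
  (smoothOn_iff hU).mp h c z hz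

lemma SmoothOn.mono' {u : M → F} {U V : Set M} (h : SmoothOn u U) (hV : V ⊆ U) : SmoothOn u V :=
  ContMDiffOn.mono h hV

lemma chartDom_mono {U V : Set M} (h : V ⊆ U) (c : M) : chartDom V c ⊆ chartDom U c :=
  fun _ hz => ⟨hz.1, h hz.2⟩

lemma coordChange_mem {U : Set M} {c c' : M} {z : ℂ}
    (hz : z ∈ chartDom (chartAt ℂ c').source c) (hU : (chartAt ℂ c).symm z ∈ U) :
    coordChange c c' z ∈ chartDom U c' :=
  chart_mem_chartDom hU hz.2

lemma fderiv_inChart_eq_zero [IsManifold 𝓘(ℂ, ℂ) 1 M] {u : M → F} {c c' : M} {z : ℂ}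
    (hz : z ∈ chartDom (chartAt ℂ c').source c)
    (hu : DifferentiableAt ℝ (inChart u c') (coordChange c c' z))
    (h0 : fderiv ℝ (inChart u c') (coordChange c c' z) = 0) :
    fderiv ℝ (inChart u c) z = 0 := by
  rw [fderiv_eq_zero_iff] at h0 ⊢
  rw [dx_coordChange hz hu, dy_coordChange hz hu, h0.1, h0.2]
  simp

/-- The differential of `f` may be tested in any chart. -/
lemma mem_regularSet_iff [IsManifold 𝓘(ℂ, ℂ) 1 M] {f : M → ℍ} {U : Set M} (hU : IsOpen U)
    (hf : SmoothOn f U) {c : M} {z : ℂ} (hz : z ∈ chartDom U c) :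
    (chartAt ℂ c).symm z ∈ regularSet f ↔ fderiv ℝ (inChart f c) z ≠ 0 := by
  set p := (chartAt ℂ c).symm z with hp
  have hps : p ∈ (chartAt ℂ c).source := (chartAt ℂ c).map_target hz.1
  have hz1 : z ∈ chartDom (chartAt ℂ p).source c := ⟨hz.1, mem_chart_source ℂ p⟩
  have hzp : chartAt ℂ p p ∈ chartDom (chartAt ℂ c).source p :=
    chart_mem_chartDom hps (mem_chart_source ℂ p)
  have e1 : coordChange c p z = chartAt ℂ p p := rfl
  have e2 : coordChange p c (chartAt ℂ p p) = z := by
    rw [coordChange, (chartAt ℂ p).left_inv (mem_chart_source ℂ p), hp,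
      (chartAt ℂ c).right_inv hz.1]
  have hd1 : DifferentiableAt ℝ (inChart f p) (coordChange c p z) :=
    ContDiffAt.diff (hf.inChart hU (coordChange_mem hz1 hz.2))
  have hd2 : DifferentiableAt ℝ (inChart f c) (coordChange p c (chartAt ℂ p p)) := by
    rw [e2]; exact ContDiffAt.diff (hf.inChart hU hz)
  rw [regularSet, Set.mem_ofPred_eq, not_iff_not]
  constructor
  · intro h0
    exact fderiv_inChart_eq_zero hz1 hd1 h0
  · intro h0
    exact fderiv_inChart_eq_zero hzp hd2 (by rw [e2]; exact h0)

lemma isOpen_inter_regularSet [IsManifold 𝓘(ℂ, ℂ) 1 M] {f : M → ℍ} {U : Set M} (hU : IsOpen U)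
    (hf : SmoothOn f U) : IsOpen (U ∩ regularSet f) := by
  rw [isOpen_iff_mem_nhds]
  rintro p ⟨hpU, hp⟩
  have hz := chart_mem_chartDom hpU (mem_chart_source ℂ p)
  have hc : ContinuousAt (fderiv ℝ (inChart f p)) (chartAt ℂ p p) :=
    ((hf.inChart hU hz).fderiv_right (m := ∞) (by simp)).continuousAt
  have h1 : ∀ᶠ w in 𝓝 (chartAt ℂ p p), fderiv ℝ (inChart f p) w ≠ 0 := hc.eventually_ne hp
  have h2 := ((chartAt ℂ p).continuousAt (mem_chart_source ℂ p)).eventually h1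
  filter_upwards [h2, hU.mem_nhds hpU,
    (chartAt ℂ p).open_source.mem_nhds (mem_chart_source ℂ p)] with q hq hqU hqs
  refine ⟨hqU, ?_⟩
  have := (mem_regularSet_iff hU hf (chart_mem_chartDom hqU hqs)).mpr hq
  rwa [(chartAt ℂ p).left_inv hqs] at this

lemma dx_ne_zero [IsManifold 𝓘(ℂ, ℂ) 1 M] {f : M → ℍ} {U : Set M} (hU : IsOpen U)
    (hf : IsWeaklyConformalOn f U) {c : M} {z : ℂ} (hz : z ∈ chartDom U c)
    (hr : (chartAt ℂ c).symm z ∈ regularSet f) : dx (inChart f c) z ≠ 0 := by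
  intro h0
  have h1 := (mem_regularSet_iff hU hf.1 hz).mp hr
  apply h1
  rw [fderiv_eq_zero_iff]
  refine ⟨h0, ?_⟩
  have := (hf.2 c z hz).1
  rw [h0, norm_zero] at this
  exact norm_eq_zero.mp this.symm

/-- Charts are onto open subsets of ℂ, so there are no isolated points. Together with isolated
branch points this makes the regular points dense. -/
lemma neBot_punctured (p : M) : (𝓝[≠] p).NeBot := by
  rw [Filter.neBot_iff, Ne, ← isOpen_singleton_iff_punctured_nhds]
  intro h
  have h1 := (chartAt ℂ p).isOpen_image_of_subset_source h
    (Set.singleton_subset_iff.mpr (mem_chart_source ℂ p))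
  rw [Set.image_singleton, isOpen_singleton_iff_punctured_nhds] at h1
  exact (NormedField.nhdsNE_neBot (chartAt ℂ p p)).ne h1

/-! ### Left normals -/

lemma IsLeftNormalOn.mono {f N : M → ℍ} {U V : Set M} (h : IsLeftNormalOn f N U) (hV : V ⊆ U) :
    IsLeftNormalOn f N V :=
  ⟨h.1.mono' hV, fun p hp => h.2.1 p (hV hp), fun c z hz => h.2.2 c z (chartDom_mono hV c hz)⟩

/-- The left normal of a branched conformal immersion is unique. -/
lemma leftNormal_unique [IsManifold 𝓘(ℂ, ℂ) 1 M] {f N₁ N₂ : M → ℍ} {U V : Set M} (hU : IsOpen U)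
    (hV : IsOpen V) (hVU : V ⊆ U)
    (hf : IsBranchedConformalImmersionOn f U) (h1 : IsLeftNormalOn f N₁ V)
    (h2 : IsLeftNormalOn f N₂ V) {p : M} (hp : p ∈ V) : N₁ p = N₂ p := by
  by_contra hne
  have c1 : ContinuousAt N₁ p := (h1.1.contMDiffAt (hV.mem_nhds hp)).continuousAt
  have c2 : ContinuousAt N₂ p := (h2.1.contMDiffAt (hV.mem_nhds hp)).continuousAt
  have e1 : ∀ᶠ q in 𝓝[≠] p, N₁ q ≠ N₂ q :=
    (((c1.sub c2).eventually_ne (sub_ne_zero.mpr hne)).mono fun q hq =>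
      sub_ne_zero.mp hq).filter_mono inf_le_left
  have e2 : ∀ᶠ q in 𝓝[≠] p, q ∈ V := mem_nhdsWithin_of_mem_nhds (hV.mem_nhds hp)
  have := neBot_punctured p
  obtain ⟨q, hq1, hq2, hq3⟩ := (e1.and (e2.and (hf.2 p (hVU hp)))).exists
  have hz := chart_mem_chartDom hq2 (mem_chart_source ℂ q)
  have hq4 : (chartAt ℂ q).symm (chartAt ℂ q q) ∈ regularSet f := by
    rw [(chartAt ℂ q).left_inv (mem_chart_source ℂ q)]
    exact hq3
  have h0 := dx_ne_zero hU hf.1 (chartDom_mono hVU q hz) hq4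
  have a1 := h1.2.2 q _ hz
  have a2 := h2.2.2 q _ hz
  rw [inChart_chart _ (mem_chart_source ℂ q)] at a1 a2
  exact hq1 (mul_right_cancel₀ h0 (a1.symm.trans a2))

lemma harmonic_of_locally {N : M → ℍ} {U : Set M} (hN : SmoothOn N U)
    (h2 : ∀ p ∈ U, N p * N p = -1)
    (h : ∀ p ∈ U, ∃ V : Set M, IsOpen V ∧ p ∈ V ∧ ∃ N' : M → ℍ, (∀ q ∈ V, N q = N' q) ∧
      IsHarmonicSphereMapOn N' V) : IsHarmonicSphereMapOn N U := by
  refine ⟨hN, h2, fun c z hz => ?_⟩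
  obtain ⟨V, hV, hpV, N', heq, hN'⟩ := h _ hz.2
  have hzV : z ∈ chartDom V c := ⟨hz.1, hpV⟩
  have e : inChart N c =ᶠ[𝓝 z] inChart N' c := by
    filter_upwards [(isOpen_chartDom hV c).mem_nhds hzV] with w hw
    exact heq _ hw.2
  have := hN'.2.2 c z hzV
  have ex : dx (inChart N c) =ᶠ[𝓝 z] dx (inChart N' c) := pd_eventuallyEq e
  have ey : dy (inChart N c) =ᶠ[𝓝 z] dy (inChart N' c) := pd_eventuallyEq e
  have exx : dx (dx (inChart N c)) z = dx (dx (inChart N' c)) z := pd_congr ex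
  have eyy : dy (dy (inChart N c)) z = dy (dy (inChart N' c)) z := pd_congr ey
  rw [exx, eyy, ex.self_of_nhds, ey.self_of_nhds, e.self_of_nhds]
  exact this

/-! ### `μ`-Darboux transforms of immersions with harmonic left normal -/

/-- The left normal of the Darboux transform on the surface. -/
def darbouxNormalOn (N α : M → ℍ) (μ : ℂ) (p : M) : ℍ :=
  -(((N p * α p * ((aCoeff μ - 1 : ℂ) : ℍ) + α p * ((bCoeff μ : ℂ) : ℍ)) * (α p)⁻¹)⁻¹ * N p *
    ((N p * α p * ((aCoeff μ - 1 : ℂ) : ℍ) + α p * ((bCoeff μ : ℂ) : ℍ)) * (α p)⁻¹))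

lemma inChart_darbouxNormalOn (N α : M → ℍ) (μ : ℂ) (c : M) :
    inChart (darbouxNormalOn N α μ) c = darbouxNormal (inChart N c) (inChart α c)
      ((aCoeff μ - 1 : ℂ) : ℍ) ((bCoeff μ : ℂ) : ℍ) := rfl

/-- Only the harmonicity of the left normal of f is used here, not that f is Hamiltonian stationary.
-/
lemma darboux_locally [IsManifold 𝓘(ℂ, ℂ) 1 M] {f N fh α φ₁ φ₂ : M → ℍ} {μ : ℂ} (hμ : μ ≠ 0)
    {V : Set M} (hV : IsOpen V) (hf : IsConformalImmersionOn f Set.univ)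
    (hN : IsLeftNormalOn f N Set.univ) (hNh : IsHarmonicSphereMapOn N Set.univ)
    (hfh : SmoothOn fh V) (hα : IsParallelOn f N μ α V) (hφ : IsProlongationOn f α φ₁ φ₂ V)
    (h : ∀ q ∈ V, φ₂ q ≠ 0 ∧ φ₁ q = fh q * φ₂ q) :
    IsLeftNormalOn fh (darbouxNormalOn N α μ) V ∧
      IsHarmonicSphereMapOn (darbouxNormalOn N α μ) V := by
  have hc (c : M) : LocalDarboux (inChart f c) (inChart N c) (inChart α c) (inChart φ₁ c)
      (inChart φ₂ c) (inChart fh c) μ (chartDom V c) := by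
    have hu {z : ℂ} (hz : z ∈ chartDom V c) : z ∈ chartDom Set.univ c := ⟨hz.1, trivial⟩
    exact
    { isOpen := isOpen_chartDom hV c
      ne := hμ
      smoothf := fun z hz => hf.1.1.inChart isOpen_univ (hu hz)
      smoothN := fun z hz => hN.1.inChart isOpen_univ (hu hz)
      smoothα := fun z hz => hα.1.inChart hV hz
      smoothφ₁ := fun z hz => hφ.1.inChart hV hz
      smoothφ₂ := fun z hz => hφ.2.1.inChart hV hz
      smoothfh := fun z hz => hfh.inChart hV hz
      sq := fun z hz => hN.2.1 _ trivial
      conformal := fun z hz => hN.2.2 c z (hu hz)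
      immersed := fun z hz => dx_ne_zero isOpen_univ hf.1 (hu hz) (hf.2 trivial)
      harmonic := fun z hz => hNh.2.2 c z (hu hz)
      parX := fun z hz => (hα.2 c z hz).1
      parY := fun z hz => (hα.2 c z hz).2
      lift := fun z hz => hφ.2.2.1 _ hz.2
      liftX := fun z hz => (hφ.2.2.2 c z hz).1
      liftY := fun z hz => (hφ.2.2.2 c z hz).2
      φ₂_ne := fun z hz => (h _ hz.2).1
      transform := fun z hz => (h _ hz.2).2 }
  have hs : SmoothOn (darbouxNormalOn N α μ) V := by
    rw [smoothOn_iff hV]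
    intro c z hz
    exact ((hc c).darbouxData ⟨z, hz⟩).smooth_normal hz
  have hsq : ∀ p ∈ V, darbouxNormalOn N α μ p * darbouxNormalOn N α μ p = -1 := by
    intro p hp
    have hz := chart_mem_chartDom hp (mem_chart_source ℂ p)
    have := darbouxNormal_sq (((hc p).sq) _ hz) (((hc p).darbouxData ⟨_, hz⟩).darbouxT_ne hz)
    rwa [← inChart_darbouxNormalOn, inChart_chart _ (mem_chart_source ℂ p)] at this
  exact ⟨⟨hs, hsq, fun c z hz => (hc c).leftNormal hz⟩, hs, hsq,
    fun c z hz => ((hc c).darbouxData ⟨z, hz⟩).harmonic_normal hz⟩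

lemma darboux_leftNormal [IsManifold 𝓘(ℂ, ℂ) 1 M] {f fh : M → ℍ} {μ : ℂ} (hμ : μ ≠ 0)
    {U : Set M} (hU : IsOpen U) (hf : IsConformalImmersionOn f Set.univ)
    (hNh : ∀ N, IsLeftNormalOn f N Set.univ → IsHarmonicSphereMapOn N Set.univ)
    (h : IsMuDarbouxTransformOn f μ fh U) :
    (∃ Nh : M → ℍ, IsLeftNormalOn fh Nh U) ∧
      ∀ Nh : M → ℍ, IsLeftNormalOn fh Nh U → IsHarmonicSphereMapOn Nh U := by
  obtain ⟨hfh, N, hN, hloc⟩ := h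
  have hloc' : ∀ p ∈ U, ∃ V : Set M, IsOpen V ∧ p ∈ V ∧ V ⊆ U ∧ ∃ N' : M → ℍ,
      IsLeftNormalOn fh N' V ∧ IsHarmonicSphereMapOn N' V := by
    intro p hp
    obtain ⟨V, hV, hpV, hVU, α, φ₁, φ₂, hα, hφ, hq⟩ := hloc p hp
    exact ⟨V, hV, hpV, hVU, _, darboux_locally hμ hV hf hN (hNh N hN) (hfh.1.1.mono' hVU) hα hφ hq⟩
  constructor
  · choose! V hV hpV hVU N' hN' hN'h using hloc'
    have heq : ∀ p ∈ U, ∀ q ∈ V p, N' q q = N' p q := by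
      intro p hp q hq
      have hqU := hVU p hp hq
      exact leftNormal_unique hU ((hV p hp).inter (hV q hqU))
        (Set.inter_subset_left.trans (hVU p hp)) hfh
        ((hN' q hqU).mono Set.inter_subset_right) ((hN' p hp).mono Set.inter_subset_left)
        ⟨hq, hpV q hqU⟩
    -- The local normals agree on overlaps by uniqueness, so the diagonal choice coincides with `N'
    -- p` on all of `V p`; smoothness and the equation for f̂ follow.
    refine ⟨fun p => N' p p, ?_, fun p hp => (hN' p hp).2.1 p (hpV p hp), ?_⟩
    · intro p hp
      have h1 := (hN' p hp).1.contMDiffAt ((hV p hp).mem_nhds (hpV p hp))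
      refine (h1.congr_of_eventuallyEq ?_).contMDiffWithinAt
      filter_upwards [(hV p hp).mem_nhds (hpV p hp)] with q hq
      exact heq p hp q hq
    · intro c z hz
      have hzV : z ∈ chartDom (V ((chartAt ℂ c).symm z)) c := ⟨hz.1, hpV _ hz.2⟩
      exact (hN' _ hz.2).2.2 c z hzV
  · intro Nh hNh'
    refine harmonic_of_locally hNh'.1 hNh'.2.1 fun p hp => ?_
    obtain ⟨V, hV, hpV, hVU, N', hN', hh⟩ := hloc' p hp
    exact ⟨V, hV, hpV, N', fun q hq =>
      leftNormal_unique hU hV hVU hfh (hNh'.mono hVU) hN' hq, hh⟩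

end Charts

end

end MuDarboux

namespace MuDarboux

noncomputable section

open MeasureTheory

/-! ### Integrals over coordinate domains -/

lemma contDiffAt_indicator {F : Type*} [NormedAddCommGroup F] [NormedSpace ℝ F] {W S : Set ℂ}
    (hW : IsOpen W) (hS : IsCompact S) (hSW : S ⊆ W) {A : ℂ → F}
    (hA : ∀ z ∈ W, ContDiffAt ℝ ∞ A z) (h0 : ∀ z ∈ W, z ∉ S → A z = 0) (z : ℂ) :
    ContDiffAt ℝ ∞ (W.indicator A) z := by
  by_cases hz : z ∈ W
  · refine (hA z hz).congr_of_eventuallyEq ?_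
    filter_upwards [hW.mem_nhds hz] with w hw
    exact Set.indicator_of_mem hw A
  · refine (contDiffAt_const (c := (0 : F))).congr_of_eventuallyEq ?_
    filter_upwards [hS.isClosed.isOpen_compl.mem_nhds fun h => hz (hSW h)] with w hw
    by_cases hwW : w ∈ W
    · rw [Set.indicator_of_mem hwW, h0 w hwW hw]
    · exact Set.indicator_of_notMem hwW A

lemma integral_pd_eq_zero {W S : Set ℂ} (hW : IsOpen W) (hS : IsCompact S) (hSW : S ⊆ W)
    {A : ℂ → ℝ} (hA : ∀ z ∈ W, ContDiffAt ℝ ∞ A z) (h0 : ∀ z ∈ W, z ∉ S → A z = 0) (e : ℂ) :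
    ∫ z in W, pd e A z = 0 := by
  set B := W.indicator A with hB
  have hBs := contDiffAt_indicator hW hS hSW hA h0
  have hBc : ContDiff ℝ ∞ B := contDiff_iff_contDiffAt.mpr hBs
  have hB0 : ∀ z ∉ S, B z = 0 := fun z hz => by
    by_cases hzW : z ∈ W
    · rw [hB, Set.indicator_of_mem hzW, h0 z hzW hz]
    · exact Set.indicator_of_notMem hzW A
  have hBcs : HasCompactSupport B := HasCompactSupport.intro hS hB0
  have e1 : W.indicator (pd e A) = pd e B := by
    funext z
    by_cases hz : z ∈ W
    · rw [Set.indicator_of_mem hz]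
      apply pd_congr
      filter_upwards [hW.mem_nhds hz] with w hw
      exact (Set.indicator_of_mem hw A).symm
    · rw [Set.indicator_of_notMem hz]
      have : B =ᶠ[𝓝 z] fun _ => 0 := by
        filter_upwards [hS.isClosed.isOpen_compl.mem_nhds fun h => hz (hSW h)] with w hw
        exact hB0 w hw
      rw [pd_congr this, pd_const]
  rw [← integral_indicator hW.measurableSet, e1]
  have hd : Continuous (pd e B) :=
    (hBc.continuous_fderiv (by simp)).clm_apply continuous_const
  have hdc : HasCompactSupport (pd e B) := hBcs.fderiv_apply ℝ e
  -- Integration by parts against the constant function 1.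
  have := integral_mul_fderiv_eq_neg_fderiv_mul_of_integrable (μ := (volume : Measure ℂ)) (v := e)
    (f := fun _ : ℂ => (1 : ℝ)) (g := B) (by simp)
    (by simpa using! hd.integrable_of_hasCompactSupport hdc)
    (by simpa using hBc.continuous.integrable_of_hasCompactSupport hBcs)
    (fun _ _ => differentiableAt_const _) (fun z _ => ContDiffAt.diff (hBs z))
  simpa using! this

/-- Differentiation under the integral sign over a compact set. -/
lemma hasDerivAt_setIntegral {E : Type*} [NormedAddCommGroup E] [NormedSpace ℝ E]
    {Φ : E → ℝ} {O : Set E} (hO : IsOpen O) (hΦ : ContDiffOn ℝ 1 Φ O)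
    {S : Set ℂ} (hS : IsCompact S) {j k : ℂ → E} (hj : ContinuousOn j S) (hk : ContinuousOn k S)
    (hjO : ∀ z ∈ S, j z ∈ O) {χ : ℂ → ℝ} (hχ : ContinuousOn χ S) :
    HasDerivAt (fun t : ℝ => ∫ z in S, χ z * Φ (j z + t • k z))
      (∫ z in S, χ z * fderiv ℝ Φ (j z) (k z)) 0 := by
  -- The pairs (j, k) fill a compact set, so one ε > 0 keeps all segments j + tk with |t| ≤ ε/2
  -- inside O, and the t-derivative is bounded uniformly there.
  set K : Set (E × E) := (fun z => (j z, k z)) '' S with hK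
  have hKc : IsCompact K := hS.image_of_continuousOn (hj.prodMk hk)
  have hev : ∀ᶠ t : ℝ in 𝓝 0, ∀ y ∈ K, y.1 + t • y.2 ∈ O := by
    apply hKc.eventually_forall_of_forall_eventually
    rintro y ⟨z, hz, rfl⟩
    have hc : ContinuousAt (fun x : ℝ × (E × E) => x.2.1 + x.1 • x.2.2) (0, (j z, k z)) := by
      fun_prop
    exact hc.eventually (hO.mem_nhds (by simpa using hjO z hz))
  obtain ⟨ε, hε, hball⟩ := Metric.eventually_nhds_iff.mp hev
  set I : Set ℝ := Set.Icc (-(ε / 2)) (ε / 2) with hI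
  have hseg : ∀ t ∈ I, ∀ y ∈ K, y.1 + t • y.2 ∈ O := by
    intro t ht y hy
    refine hball ?_ y hy
    rw [dist_zero_right, Real.norm_eq_abs]
    exact lt_of_le_of_lt (abs_le.mpr ht) (by linarith)
  have hInhds : I ∈ 𝓝 (0 : ℝ) := Icc_mem_nhds (by linarith) (by linarith)
  have h0I : (0 : ℝ) ∈ I := mem_of_mem_nhds hInhds
  have hfc : ContinuousOn (fderiv ℝ Φ) O := hΦ.continuousOn_fderiv_of_isOpen hO le_rfl
  have hG : ContinuousOn (fun x : ℝ × (E × E) => fderiv ℝ Φ (x.2.1 + x.1 • x.2.2) x.2.2)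
      (I ×ˢ K) := by
    apply ContinuousOn.clm_apply
    · exact hfc.comp (by fun_prop) fun x hx => hseg _ hx.1 _ hx.2
    · fun_prop
  obtain ⟨C, hC⟩ := (isCompact_Icc.prod hKc).exists_bound_of_continuousOn hG
  obtain ⟨C', hC'⟩ := hS.exists_bound_of_continuousOn hχ
  have hmap (t : ℝ) : ContinuousOn (fun z => j z + t • k z) S := hj.add (hk.const_smul t)
  have hcont (t : ℝ) (ht : t ∈ I) : ContinuousOn (fun z => χ z * Φ (j z + t • k z)) S :=
    hχ.mul (hΦ.continuousOn.comp (hmap t) fun z hz => hseg t ht _ ⟨z, hz, rfl⟩)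
  have hfin : IsFiniteMeasure (volume.restrict S) :=
    ⟨by rw [Measure.restrict_apply_univ]; exact hS.measure_lt_top⟩
  have key := hasDerivAt_integral_of_dominated_loc_of_deriv_le (μ := volume.restrict S)
    (F := fun (t : ℝ) z => χ z * Φ (j z + t • k z))
    (F' := fun (t : ℝ) z => χ z * fderiv ℝ Φ (j z + t • k z) (k z))
    (x₀ := (0 : ℝ)) (s := I) (bound := fun _ => C' * C) hInhds
    (by
      filter_upwards [hInhds] with t ht
      exact (hcont t ht).aestronglyMeasurable hS.measurableSet)
    ((hcont 0 h0I).integrableOn_compact hS)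
    (by
      refine ContinuousOn.aestronglyMeasurable (hχ.mul ?_) hS.measurableSet
      exact (hfc.comp (hmap 0) fun z hz => hseg 0 h0I _ ⟨z, hz, rfl⟩).clm_apply hk)
    (by
      filter_upwards [ae_restrict_mem hS.measurableSet] with z hz t ht
      rw [norm_mul]
      exact mul_le_mul (hC' z hz) (hC (t, (j z, k z)) ⟨ht, ⟨z, hz, rfl⟩⟩) (norm_nonneg _)
        ((norm_nonneg _).trans (hC' z hz)))
    (integrable_const _)
    (by
      filter_upwards [ae_restrict_mem hS.measurableSet] with z hz t ht
      have hd : HasFDerivAt Φ (fderiv ℝ Φ (j z + t • k z)) (j z + t • k z) :=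
        ((hΦ.contDiffAt (hO.mem_nhds (hseg t ht _ ⟨z, hz, rfl⟩))).differentiableAt
          (by simp)).hasFDerivAt
      have hl : HasDerivAt (fun t : ℝ => j z + t • k z) (k z) t := by
        simpa using ((hasDerivAt_id t).smul_const (k z)).const_add (j z)
      exact (hd.comp_hasDerivAt t hl).const_mul (χ z))
  simpa using key.2

/-! ### Densities under changes of coordinates -/

section Charts

variable {M : Type*} [TopologicalSpace M] [ChartedSpace ℂ M]

lemma measurableSet_chartDom_of_isClosed {K : Set M} (hK : IsClosed K) (c : M) :
    MeasurableSet (chartDom K c) := by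
  have : chartDom K c = (chartAt ℂ c).target \ chartDom Kᶜ c := by
    ext z
    simp only [mem_chartDom_iff, Set.mem_sdiff, Set.mem_compl_iff]
    tauto
  rw [this]
  exact (chartAt ℂ c).open_target.measurableSet.diff
    (isOpen_chartDom hK.isOpen_compl c).measurableSet

lemma chartDom_inter (U V : Set M) (c : M) : chartDom (U ∩ V) c = chartDom U c ∩ chartDom V c := by
  ext z
  simp only [mem_chartDom_iff, Set.mem_inter_iff]
  tauto

lemma isCompact_chartDom {K : Set M} (hK : IsCompact K) {c : M}
    (hc : K ⊆ (chartAt ℂ c).source) : IsCompact (chartDom K c) := by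
  have : chartDom K c = chartAt ℂ c '' K := by
    ext z
    constructor
    · rintro ⟨h1, h2⟩
      exact ⟨_, h2, (chartAt ℂ c).right_inv h1⟩
    · rintro ⟨p, hp, rfl⟩
      exact chart_mem_chartDom hp (hc hp)
  rw [this]
  exact hK.image_of_continuousOn ((chartAt ℂ c).continuousOn.mono hc)

lemma det_toSpanSingleton_restrictScalars (w : ℂ) :
    ((ContinuousLinearMap.toSpanSingleton ℂ w).restrictScalars ℝ : ℂ →L[ℝ] ℂ).det =
      w.re ^ 2 + w.im ^ 2 := by
  have h : (((ContinuousLinearMap.toSpanSingleton ℂ w).restrictScalars ℝ : ℂ →L[ℝ] ℂ) :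
      ℂ →ₗ[ℝ] ℂ) = Algebra.lmul ℝ ℂ w := by
    ext z
    simp [mul_comm]
  rw [ContinuousLinearMap.det, h, ← Algebra.norm_apply, Algebra.norm_complex_apply,
    Complex.normSq_apply]
  ring

lemma image_coordChange {X : Set M} {c c' : M} (hX : X ⊆ (chartAt ℂ c).source)
    (hX' : X ⊆ (chartAt ℂ c').source) :
    coordChange c c' '' chartDom X c = chartDom X c' := by
  ext w
  constructor
  · rintro ⟨z, hz, rfl⟩
    exact coordChange_mem ⟨hz.1, hX' hz.2⟩ hz.2
  · intro hw
    refine ⟨coordChange c' c w, coordChange_mem ⟨hw.1, hX hw.2⟩ hw.2, ?_⟩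
    simp only [coordChange]
    rw [(chartAt ℂ c).left_inv (hX hw.2), (chartAt ℂ c').right_inv hw.1]

lemma injOn_coordChange {X : Set M} {c c' : M} (hX' : X ⊆ (chartAt ℂ c').source) :
    Set.InjOn (coordChange c c') (chartDom X c) := by
  intro z hz w hw h
  have h1 := (chartAt ℂ c').injOn (hX' hz.2) (hX' hw.2) h
  exact (chartAt ℂ c).symm.injOn hz.1 hw.1 h1

/-- Densities have a well-defined integral. -/
lemma integral_chartDom_eq [IsManifold 𝓘(ℂ, ℂ) 1 M] {X : Set M} {c c' : M}
    (hX : X ⊆ (chartAt ℂ c).source) (hX' : X ⊆ (chartAt ℂ c').source)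
    (hm : MeasurableSet (chartDom X c)) {w w' : ℂ → ℝ}
    (h : ∀ z ∈ chartDom X c, w z = ((deriv (coordChange c c') z).re ^ 2 +
      (deriv (coordChange c c') z).im ^ 2) * w' (coordChange c c' z)) :
    ∫ z in chartDom X c', w' z = ∫ z in chartDom X c, w z := by
  rw [← image_coordChange hX hX', integral_image_eq_integral_abs_det_fderiv_smul volume hm
    (fun z hz => (coordChange_hasFDerivAt ⟨hz.1, hX' hz.2⟩).hasFDerivWithinAt)
    (injOn_coordChange hX')]
  refine setIntegral_congr_fun hm fun z hz => ?_
  simp only [det_toSpanSingleton_restrictScalars, smul_eq_mul, h z hz]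
  rw [abs_of_nonneg (by positivity)]

end Charts

end

end MuDarboux

namespace MuDarboux

noncomputable section

/-! ### The area and Willmore densities as functions of the 2-jet -/

/-- `E G - F²` for a surface with first derivatives `p`, `q`. -/
def jetDet (p q : ℍ) : ℝ := inner ℝ p p * inner ℝ q q - inner ℝ p q ^ 2

/-- The area density of a surface with first derivatives `x.1`, `x.2`. -/
def jetArea (x : ℍ × ℍ) : ℝ := √(jetDet x.1 x.2)

/-- The tangential part of `v`, multiplied by `E G - F²`. -/
def jetTangent (p q v : ℍ) : ℍ :=
  ((inner ℝ q q : ℝ) * inner ℝ v p - (inner ℝ p q : ℝ) * inner ℝ v q) • p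
    + ((inner ℝ p p : ℝ) * inner ℝ v q - (inner ℝ p q : ℝ) * inner ℝ v p) • q

/-- The normal part of `v` for a surface with first derivatives `p`, `q`. -/
def jetNormal (p q v : ℍ) : ℍ := v - (jetDet p q)⁻¹ • jetTangent p q v

/-- The trace of the second derivatives `r`, `s`, `w` with respect to the metric, divided by 2. -/
def jetTrace (p q r s w : ℍ) : ℍ :=
  (2 * jetDet p q)⁻¹ • ((inner ℝ q q : ℝ) • r - (2 * (inner ℝ p q : ℝ)) • s + (inner ℝ p p : ℝ) • w)

/-- The Willmore density of a surface with the given 2-jet. -/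
def jetWillmore (x : ℍ × ℍ × ℍ × ℍ × ℍ) : ℝ :=
  ‖jetNormal x.1 x.2.1 (jetTrace x.1 x.2.1 x.2.2.1 x.2.2.2.1 x.2.2.2.2)‖ ^ 2 *
    √(jetDet x.1 x.2.1)

lemma areaDensity_eq_jet (u : ℂ → ℍ) (z : ℂ) :
    areaDensity u z = jetArea (dx u z, dy u z) := rfl

lemma willmoreDensity_eq_jet (u : ℂ → ℍ) (z : ℂ) :
    willmoreDensity u z =
      jetWillmore (dx u z, dy u z, dx (dx u) z, dx (dy u) z, dy (dy u) z) := rfl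

@[fun_prop]
lemma contDiff_quaternion_inner {E : Type*} [NormedAddCommGroup E] [NormedSpace ℝ E]
    {n : WithTop ℕ∞} {f g : E → ℍ} (hf : ContDiff ℝ n f) (hg : ContDiff ℝ n g) :
    ContDiff ℝ n (fun x => (inner ℝ (f x) (g x) : ℝ)) := hf.inner ℝ hg

lemma contDiff_jetDet : ContDiff ℝ 1 (fun x : ℍ × ℍ => jetDet x.1 x.2) := by
  unfold jetDet
  fun_prop

lemma isOpen_jetArea : IsOpen {x : ℍ × ℍ | 0 < jetDet x.1 x.2} :=
  isOpen_lt continuous_const contDiff_jetDet.continuous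

lemma contDiffOn_jetArea : ContDiffOn ℝ 1 jetArea {x : ℍ × ℍ | 0 < jetDet x.1 x.2} :=
  contDiff_jetDet.contDiffOn.sqrt fun _ hx => ne_of_gt hx

lemma contDiff_jetDet' : ContDiff ℝ 1 (fun x : ℍ × ℍ × ℍ × ℍ × ℍ => jetDet x.1 x.2.1) := by
  unfold jetDet
  fun_prop

lemma isOpen_jetWillmore : IsOpen {x : ℍ × ℍ × ℍ × ℍ × ℍ | 0 < jetDet x.1 x.2.1} :=
  isOpen_lt continuous_const contDiff_jetDet'.continuous

lemma contDiffOn_jetWillmore :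
    ContDiffOn ℝ 1 jetWillmore {x : ℍ × ℍ × ℍ × ℍ × ℍ | 0 < jetDet x.1 x.2.1} := by
  set O := {x : ℍ × ℍ × ℍ × ℍ × ℍ | 0 < jetDet x.1 x.2.1}
  have hD : ContDiffOn ℝ 1 (fun x : ℍ × ℍ × ℍ × ℍ × ℍ => jetDet x.1 x.2.1) O :=
    contDiff_jetDet'.contDiffOn
  have hD0 : ∀ x ∈ O, jetDet x.1 x.2.1 ≠ 0 := fun x hx => ne_of_gt hx
  have hi : ContDiffOn ℝ 1 (fun x : ℍ × ℍ × ℍ × ℍ × ℍ => (jetDet x.1 x.2.1)⁻¹) O := hD.inv hD0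
  have hi2 : ContDiffOn ℝ 1 (fun x : ℍ × ℍ × ℍ × ℍ × ℍ => (2 * jetDet x.1 x.2.1)⁻¹) O :=
    (contDiffOn_const.mul hD).inv fun x hx => mul_ne_zero two_ne_zero (hD0 x hx)
  have hT : ContDiffOn ℝ 1 (fun x : ℍ × ℍ × ℍ × ℍ × ℍ =>
      jetTrace x.1 x.2.1 x.2.2.1 x.2.2.2.1 x.2.2.2.2) O := by
    unfold jetTrace
    refine hi2.smul (ContDiff.contDiffOn ?_)
    fun_prop
  have hn : ContDiffOn ℝ 1 (fun x : ℍ × ℍ × ℍ × ℍ × ℍ =>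
      jetNormal x.1 x.2.1 (jetTrace x.1 x.2.1 x.2.2.1 x.2.2.2.1 x.2.2.2.2)) O := by
    have h1 : ContDiff ℝ 1 (fun y : ℍ × ℍ × ℍ => jetTangent y.1 y.2.1 y.2.2) := by
      unfold jetTangent
      fun_prop
    have hf : ContDiffOn ℝ 1 (fun x : ℍ × ℍ × ℍ × ℍ × ℍ => x.1) O := by fun_prop
    have hs : ContDiffOn ℝ 1 (fun x : ℍ × ℍ × ℍ × ℍ × ℍ => x.2.1) O := by fun_prop
    have h2 := h1.comp_contDiffOn (hf.prodMk (hs.prodMk hT))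
    exact hT.sub (hi.smul h2)
  exact (hn.norm_sq ℝ).mul (hD.sqrt hD0)

lemma hasDerivAt_line {E : Type*} [NormedAddCommGroup E] [NormedSpace ℝ E] (p p' : E) (t : ℝ) :
    HasDerivAt (fun t : ℝ => p + t • p') p' t := by
  simpa using ((hasDerivAt_id t).smul_const p').const_add p

lemma hasDerivAt_inner_line (p p' q q' : ℍ) :
    HasDerivAt (fun t : ℝ => (inner ℝ (p + t • p') (q + t • q') : ℝ))
      (inner ℝ p q' + inner ℝ p' q) 0 := by
  simpa using (hasDerivAt_line p p' 0).inner ℝ (hasDerivAt_line q q' 0)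

lemma hasDerivAt_jetDet {p q p' q' : ℍ} (hG : (inner ℝ q q : ℝ) = inner ℝ p p)
    (hF : (inner ℝ p q : ℝ) = 0) :
    HasDerivAt (fun t : ℝ => jetDet (p + t • p') (q + t • q'))
      (2 * (inner ℝ p p : ℝ) * (inner ℝ p p' + inner ℝ q q')) 0 := by
  have h := ((hasDerivAt_inner_line p p' p p').mul (hasDerivAt_inner_line q q' q q')).sub
    ((hasDerivAt_inner_line p p' q q').pow 2)
  refine (h.congr_deriv ?_)
  simp only [zero_smul, add_zero, hF, hG, real_inner_comm p p', real_inner_comm q q']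
  ring

lemma hasDerivAt_jetArea {p q p' q' : ℍ} (hp : p ≠ 0) (hG : (inner ℝ q q : ℝ) = inner ℝ p p)
    (hF : (inner ℝ p q : ℝ) = 0) :
    HasDerivAt (fun t : ℝ => jetArea ((p, q) + t • (p', q')))
      (inner ℝ p p' + inner ℝ q q') 0 := by
  have hl : (0 : ℝ) < inner ℝ p p := by
    rw [real_inner_self_eq_norm_sq]; positivity
  have h0 : jetDet (p + (0 : ℝ) • p') (q + (0 : ℝ) • q') = (inner ℝ p p : ℝ) ^ 2 := by
    simp only [zero_smul, add_zero, jetDet, hF, hG]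
    ring
  have h := (hasDerivAt_jetDet (p' := p') (q' := q') hG hF).sqrt (by rw [h0]; positivity)
  refine h.congr_deriv ?_
  rw [h0, Real.sqrt_sq hl.le]
  field_simp

/-- At a conformal jet, moved conformally to first order, F and its derivative vanish, so the mixed
second derivative `s` drops out; E and G stay equal to first order. Only r + w and r' + w' remain.
-/
lemma hasDerivAt_jetTrace {p q r s w p' q' r' s' w' : ℍ} (hp : p ≠ 0)
    (hG : (inner ℝ q q : ℝ) = inner ℝ p p) (hF : (inner ℝ p q : ℝ) = 0)
    (hG' : (inner ℝ q q' : ℝ) = inner ℝ p p')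
    (hF' : (inner ℝ p q' : ℝ) + inner ℝ q p' = 0) :
    HasDerivAt (fun t : ℝ => jetTrace (p + t • p') (q + t • q') (r + t • r') (s + t • s')
        (w + t • w'))
      ((2 * (inner ℝ p p : ℝ))⁻¹ • (r' + w') -
        ((inner ℝ p p' : ℝ) * ((inner ℝ p p : ℝ) ^ 2)⁻¹) • (r + w)) 0 := by
  have hl : (0 : ℝ) < inner ℝ p p := by
    rw [real_inner_self_eq_norm_sq]; positivity
  have h0 : jetDet (p + (0 : ℝ) • p') (q + (0 : ℝ) • q') = (inner ℝ p p : ℝ) ^ 2 := by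
    simp only [zero_smul, add_zero, jetDet, hF, hG]
    ring
  have hD := ((hasDerivAt_jetDet (p' := p') (q' := q') hG hF).const_mul 2).inv
    (by rw [h0]; positivity)
  have hF'' : (inner ℝ p q' : ℝ) + inner ℝ p' q = 0 := by rw [← hF', real_inner_comm q p']
  have h := hD.smul ((((hasDerivAt_inner_line q q' q q').smul (hasDerivAt_line r r' 0)).sub
    (((hasDerivAt_inner_line p p' q q').const_mul 2).smul (hasDerivAt_line s s' 0))).add
    ((hasDerivAt_inner_line p p' p p').smul (hasDerivAt_line w w' 0)))
  refine h.congr_deriv ?_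
  have h0' : jetDet p q = (inner ℝ p p : ℝ) ^ 2 := by simpa using h0
  simp only [Pi.add_apply, Pi.sub_apply, Pi.smul_apply', Pi.inv_apply, zero_smul, add_zero, h0',
    hF'', hF, hG, hG', real_inner_comm p p', real_inner_comm q q', mul_zero, sub_zero]
  generalize (inner ℝ p p : ℝ) = l at *
  generalize (inner ℝ p p' : ℝ) = e at *
  match_scalars <;> field_simp <;> ring

/-- The Laplacian r + w is normal at t = 0, and the last two hypotheses say that it stays normal to
first order. Projection to the normal space therefore contributes nothing, and the density behaves
to first order like |Δu|²/(4|u_x|²). -/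
lemma hasDerivAt_jetWillmore {p q r s w p' q' r' s' w' : ℍ} (hp : p ≠ 0)
    (hG : (inner ℝ q q : ℝ) = inner ℝ p p) (hF : (inner ℝ p q : ℝ) = 0)
    (hG' : (inner ℝ q q' : ℝ) = inner ℝ p p')
    (hF' : (inner ℝ p q' : ℝ) + inner ℝ q p' = 0)
    (hLp : (inner ℝ (r + w) p : ℝ) = 0) (hLq : (inner ℝ (r + w) q : ℝ) = 0)
    (hLp' : (inner ℝ (r' + w') p : ℝ) + inner ℝ (r + w) p' = 0)
    (hLq' : (inner ℝ (r' + w') q : ℝ) + inner ℝ (r + w) q' = 0) :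
    HasDerivAt (fun t : ℝ => jetWillmore ((p, q, r, s, w) + t • (p', q', r', s', w')))
      ((inner ℝ (r + w) (r' + w') : ℝ) / (2 * inner ℝ p p) -
        (inner ℝ p p' : ℝ) * ‖r + w‖ ^ 2 / (2 * (inner ℝ p p : ℝ) ^ 2)) 0 := by
  have hl : (0 : ℝ) < inner ℝ p p := by
    rw [real_inner_self_eq_norm_sq]; positivity
  have h0 : jetDet (p + (0 : ℝ) • p') (q + (0 : ℝ) • q') = (inner ℝ p p : ℝ) ^ 2 := by
    simp only [zero_smul, add_zero, jetDet, hF, hG]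
    ring
  have hV := hasDerivAt_jetTrace (r := r) (s := s) (w := w) (r' := r') (s' := s') (w' := w')
    hp hG hF hG' hF'
  have hV0 : jetTrace (p + (0 : ℝ) • p') (q + (0 : ℝ) • q') (r + (0 : ℝ) • r') (s + (0 : ℝ) • s')
      (w + (0 : ℝ) • w') = (2 * (inner ℝ p p : ℝ))⁻¹ • (r + w) := by
    rw [jetTrace, h0]
    simp only [zero_smul, add_zero, hF, hG]
    generalize (inner ℝ p p : ℝ) = l at *
    match_scalars <;> field_simp <;> simp
  set V : ℝ → ℍ := fun t : ℝ => jetTrace (p + t • p') (q + t • q') (r + t • r') (s + t • s')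
        (w + t • w') with hVdef
  set V' := (2 * (inner ℝ p p : ℝ))⁻¹ • (r' + w') -
        ((inner ℝ p p' : ℝ) * ((inner ℝ p p : ℝ) ^ 2)⁻¹) • (r + w) with hV'
  have hV00 : V 0 = (2 * (inner ℝ p p : ℝ))⁻¹ • (r + w) := hV0
  have hVp := hV.inner ℝ (hasDerivAt_line p p' 0)
  have hVq := hV.inner ℝ (hasDerivAt_line q q' 0)
  have eVp : (inner ℝ (V 0) p' : ℝ) + inner ℝ V' p = 0 := by
    rw [hV00, hV', inner_sub_left, real_inner_smul_left, real_inner_smul_left,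
      real_inner_smul_left, hLp]
    linear_combination (2 * (inner ℝ p p : ℝ))⁻¹ * hLp'
  have eVq : (inner ℝ (V 0) q' : ℝ) + inner ℝ V' q = 0 := by
    rw [hV00, hV', inner_sub_left, real_inner_smul_left, real_inner_smul_left,
      real_inner_smul_left, hLq]
    linear_combination (2 * (inner ℝ p p : ℝ))⁻¹ * hLq'
  have zVp : (inner ℝ (V 0) p : ℝ) = 0 := by rw [hV00, real_inner_smul_left, hLp, mul_zero]
  have zVq : (inner ℝ (V 0) q : ℝ) = 0 := by rw [hV00, real_inner_smul_left, hLq, mul_zero]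
  have hEE := hasDerivAt_inner_line p p' p p'
  have hFF := hasDerivAt_inner_line p p' q q'
  have hGG := hasDerivAt_inner_line q q' q q'
  have hD := hasDerivAt_jetDet (p' := p') (q' := q') hG hF
  have hDi := hD.inv (by rw [h0]; positivity)
  -- The tangential part is built from ⟨V, p⟩ and ⟨V, q⟩, which vanish to first order at t = 0.
  have hn : HasDerivAt (fun t : ℝ => jetNormal (p + t • p') (q + t • q') (V t)) V' 0 := by
    have h := hV.sub (hDi.smul
      ((((hGG.mul hVp).sub (hFF.mul hVq)).smul (hasDerivAt_line p p' 0)).add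
      (((hEE.mul hVq).sub (hFF.mul hVp)).smul (hasDerivAt_line q q' 0))))
    refine h.congr_deriv ?_
    simp only [Pi.add_apply, Pi.sub_apply, Pi.mul_apply, Pi.smul_apply', zero_smul, add_zero, zVp,
      zVq, hF, eVp, eVq, mul_zero, sub_zero, smul_zero]
  have hn0 : jetNormal (p + (0 : ℝ) • p') (q + (0 : ℝ) • q') (V 0) = V 0 := by
    simp only [jetNormal, jetTangent, zero_smul, add_zero, zVp, zVq, mul_zero, sub_zero, smul_zero]
  have h := hn.norm_sq.mul (hD.sqrt (by rw [h0]; positivity))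
  refine h.congr_deriv ?_
  rw [h0, Real.sqrt_sq hl.le, hn0, hV00, hV', inner_sub_right, real_inner_smul_left,
    real_inner_smul_left, real_inner_smul_right, real_inner_smul_right, norm_smul, hG',
    real_inner_self_eq_norm_sq (r + w), mul_pow, Real.norm_eq_abs, sq_abs]
  generalize (inner ℝ p p : ℝ) = l at *
  field_simp
  ring

end

end MuDarboux

namespace MuDarboux

noncomputable section

open MeasureTheory

/-! ### Surface integrals -/

section SurfaceIntegral

variable {M : Type*} [TopologicalSpace M] [ChartedSpace ℂ M]

lemma exists_finset_partition (ρ : ChartPartition M) {K : Set M} (hK : IsCompact K) :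
    ∃ I : Finset M, ∀ c ∉ I, ∀ p ∈ K, ρ c p = 0 := by
  have h := ρ.locallyFinite.finite_nonempty_inter_compact hK
  refine ⟨h.toFinset, fun c hc p hp => ?_⟩
  by_contra h0
  exact hc (h.mem_toFinset.mpr ⟨p, h0, hp⟩)

lemma surfaceIntegral_eq_sum {ρ : ChartPartition M} {K : Set M} {I : Finset M}
    (hI : ∀ c ∉ I, ∀ p ∈ K, ρ c p = 0) (w : M → ℂ → ℝ) :
    surfaceIntegral ρ K w =
      ∑ c ∈ I, ∫ z in chartDom K c, ρ c ((chartAt ℂ c).symm z) * w c z := by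
  apply finsum_eq_sum_of_support_subset
  intro c hc
  by_contra hcI
  apply hc
  refine setIntegral_eq_zero_of_forall_eq_zero fun z hz => ?_
  rw [hI c hcI _ hz.2, zero_mul]

lemma surfaceIntegral_congr (ρ : ChartPartition M) {K : Set M} (hK : IsClosed K)
    {w w' : M → ℂ → ℝ} (h : ∀ c, ∀ z ∈ chartDom K c, w c z = w' c z) :
    surfaceIntegral ρ K w = surfaceIntegral ρ K w' := by
  unfold surfaceIntegral
  refine finsum_congr fun c => ?_
  refine setIntegral_congr_fun (measurableSet_chartDom_of_isClosed hK c) fun z hz => ?_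
  simp only [h c z hz]

lemma sum_partition_eq_one {ρ : ChartPartition M} {K : Set M} {I : Finset M}
    (hI : ∀ c ∉ I, ∀ p ∈ K, ρ c p = 0) {p : M} (hp : p ∈ K) : ∑ c ∈ I, ρ c p = 1 := by
  rw [← ρ.sum_eq_one (Set.mem_univ p)]
  refine (finsum_eq_sum_of_support_subset _ fun c hc => ?_).symm
  by_contra hcI
  exact hc (hI c hcI p hp)

lemma partition_eq_zero {ρ : ChartPartition M} {c p : M} (hp : p ∉ tsupport (ρ c)) : ρ c p = 0 :=
  image_eq_zero_of_notMem_tsupport hp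

/-- The coordinate image of K need not be compact, but for a subordinate partition and compact K
that of K ∩ supp ρ_c is; differentiation under the integral needs this. -/
lemma setIntegral_partition (ρ : ChartPartition M) {K : Set M} (hK : IsClosed K) (c : M)
    (w : ℂ → ℝ) :
    ∫ z in chartDom K c, ρ c ((chartAt ℂ c).symm z) * w z =
      ∫ z in chartDom (K ∩ tsupport (ρ c)) c, ρ c ((chartAt ℂ c).symm z) * w z := by
  refine setIntegral_eq_of_subset_of_forall_sdiff_eq_zero
    (measurableSet_chartDom_of_isClosed hK c) (chartDom_mono Set.inter_subset_left c)
    fun z hz => ?_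
  have : (chartAt ℂ c).symm z ∉ tsupport (ρ c) := fun h => hz.2 ⟨hz.1.1, hz.1.2, h⟩
  rw [partition_eq_zero this, zero_mul]

lemma continuousOn_partition (ρ : ChartPartition M) (c c' : M) :
    ContinuousOn (fun z => ρ c ((chartAt ℂ c').symm z)) (chartAt ℂ c').target := by
  have h : Continuous (ρ c) := map_continuous (ρ c)
  exact h.comp_continuousOn (chartAt ℂ c').continuousOn_symm

/-- Differentiation of surface integrals of densities which depend on a jet. -/
lemma hasDerivAt_surfaceIntegral {E : Type*} [NormedAddCommGroup E] [NormedSpace ℝ E]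
    {Φ : E → ℝ} {O : Set E} (hO : IsOpen O) (hΦ : ContDiffOn ℝ 1 Φ O)
    {ρ : ChartPartition M} (hρ : IsSubordinateToCharts ρ) {K : Set M} (hK : IsCompact K)
    (hKc : IsClosed K)
    {w : ℝ → M → ℂ → ℝ} {j k : M → ℂ → E} (hj : ∀ c, ContinuousOn (j c) (chartDom K c))
    (hk : ∀ c, ContinuousOn (k c) (chartDom K c)) (hjO : ∀ c, ∀ z ∈ chartDom K c, j c z ∈ O)
    (hw : ∀ t c, ∀ z ∈ chartDom K c, w t c z = Φ (j c z + t • k c z)) :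
    HasDerivAt (fun t => surfaceIntegral ρ K (w t))
      (surfaceIntegral ρ K fun c z => fderiv ℝ Φ (j c z) (k c z)) 0 := by
  obtain ⟨I, hI⟩ := exists_finset_partition ρ hK
  have e1 : (fun t => surfaceIntegral ρ K (w t)) = fun t => ∑ c ∈ I,
      ∫ z in chartDom (K ∩ tsupport (ρ c)) c,
        ρ c ((chartAt ℂ c).symm z) * Φ (j c z + t • k c z) := by
    funext t
    rw [surfaceIntegral_congr ρ hKc (hw t), surfaceIntegral_eq_sum hI]
    exact Finset.sum_congr rfl fun c _ => setIntegral_partition ρ hKc c _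
  rw [e1, surfaceIntegral_eq_sum hI]
  simp only [setIntegral_partition ρ hKc]
  refine HasDerivAt.fun_sum fun c _ => ?_
  have hsub : chartDom (K ∩ tsupport (ρ c)) c ⊆ chartDom K c :=
    chartDom_mono Set.inter_subset_left c
  exact hasDerivAt_setIntegral hO hΦ
    (isCompact_chartDom (hK.inter_right (isClosed_tsupport _))
      (Set.inter_subset_right.trans (hρ c)))
    ((hj c).mono hsub) ((hk c).mono hsub) (fun z hz => hjO c z (hsub hz))
    ((continuousOn_partition ρ c c).mono fun z hz => hz.1)

lemma integrableOn_of_zero_off_compact {W S : Set ℂ} (hW : MeasurableSet W) (hS : IsCompact S)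
    {g : ℂ → ℝ} (hg : ContinuousOn g S) (h0 : ∀ z ∈ W, z ∉ S → g z = 0) : IntegrableOn g W :=
  (hg.integrableOn_compact hS).of_forall_sdiff_eq_zero hW fun z hz => h0 z hz.1 hz.2

end SurfaceIntegral

lemma fderiv_eq_of_line {E : Type*} [NormedAddCommGroup E] [NormedSpace ℝ E] {Φ : E → ℝ} {j k : E}
    {v : ℝ} (hΦ : DifferentiableAt ℝ Φ j) (h : HasDerivAt (fun t : ℝ => Φ (j + t • k)) v 0) :
    fderiv ℝ Φ j k = v := by
  have h1 : HasFDerivAt Φ (fderiv ℝ Φ j) (j + (0 : ℝ) • k) := by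
    simpa using hΦ.hasFDerivAt
  exact (h1.comp_hasDerivAt 0 (hasDerivAt_line j k 0)).unique h

/-! ### The first variation of the energy of a map into the 2-sphere -/

/-- The density of the first variation, in the direction of `m`, of the energy of `N` plus its
degree. -/
def energyDensity (N m : ℂ → ℍ) (z : ℂ) : ℝ :=
  (1 / 2) * ((inner ℝ (dx N z) (dx m z) : ℝ) + inner ℝ (dy N z) (dy m z) +
    inner ℝ (dy N z) (N z * dx m z) + inner ℝ (N z * dx N z) (dy m z))

lemma energyDensity_eq_zero {N m : ℂ → ℍ} {z : ℂ} (h : m =ᶠ[𝓝 z] fun _ => 0) :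
    energyDensity N m z = 0 := by
  have h1 : dx m z = 0 := (pd_congr h).trans (pd_const 0)
  have h2 : dy m z = 0 := (pd_congr h).trans (pd_const 0)
  simp [energyDensity, h1, h2]

lemma energyDensity_sum {ι : Type*} (I : Finset ι) {N : ℂ → ℍ} {m : ι → ℂ → ℍ} {z : ℂ}
    (h : ∀ i ∈ I, ContDiffAt ℝ ∞ (m i) z) :
    energyDensity N (fun w => ∑ i ∈ I, m i w) z = ∑ i ∈ I, energyDensity N (m i) z := by
  have hs (e : ℂ) : pd e (fun w => ∑ i ∈ I, m i w) z = ∑ i ∈ I, pd e (m i) z := by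
    simp only [pd]
    rw [fderiv_fun_sum fun i hi => ContDiffAt.diff (h i hi)]
    simp
  simp only [energyDensity, dx_eq_pd, dy_eq_pd, hs, inner_sum, Finset.mul_sum,
    ← Finset.sum_add_distrib]

/-- For imaginary quaternions ⟨ab, c⟩ is the determinant of a, b, c, which vanishes for three
vectors in the tangent plane at N. -/
lemma inner_mul_eq_zero {N a b c : ℍ} (hN : N * N = -1) (ha : a.re = 0) (hb : b.re = 0)
    (hc : c.re = 0) (haN : (inner ℝ a N : ℝ) = 0) (hbN : (inner ℝ b N : ℝ) = 0)
    (hcN : (inner ℝ c N : ℝ) = 0) : (inner ℝ (a * b) c : ℝ) = 0 := by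
  obtain ⟨h0, h1⟩ := sq_eq_neg_one_components hN
  simp only [inner_eq_components, Quaternion.re_mul, Quaternion.imI_mul, Quaternion.imJ_mul,
    Quaternion.imK_mul, h0, ha, hb, hc, mul_zero, zero_mul, zero_add, add_zero, zero_sub]
    at haN hbN hcN ⊢
  -- Cramer's rule: det(a, b, c)N = ⟨a, N⟩ b×c + ⟨b, N⟩ c×a + ⟨c, N⟩ a×b, paired with N; |N| = 1
  -- supplies the first coefficient.
  linear_combination (-((a.imJ * b.imK - a.imK * b.imJ) * c.imI +
      (-(a.imI * b.imK) + a.imK * b.imI) * c.imJ + (a.imI * b.imJ - a.imJ * b.imI) * c.imK)) * h1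
    + (N.imI * (b.imJ * c.imK - b.imK * c.imJ) + N.imJ * (b.imK * c.imI - b.imI * c.imK) +
      N.imK * (b.imI * c.imJ - b.imJ * c.imI)) * haN
    + (N.imI * (c.imJ * a.imK - c.imK * a.imJ) + N.imJ * (c.imK * a.imI - c.imI * a.imK) +
      N.imK * (c.imI * a.imJ - c.imJ * a.imI)) * hbN
    + (N.imI * (a.imJ * b.imK - a.imK * b.imJ) + N.imJ * (a.imK * b.imI - a.imI * b.imK) +
      N.imK * (a.imI * b.imJ - a.imJ * b.imI)) * hcN

/-- In the product rule for the divergence, ΔN is paired with m and gives 0, since harmonicity makes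
ΔN parallel to N and m is tangent. The mixed derivatives of N cancel, and the products of N_x and
N_y paired with m are triple products of tangent vectors, hence 0. -/
lemma energyDensity_eq_div {N m : ℂ → ℍ} {z : ℂ} (hN : ContDiffAt ℝ ∞ N z)
    (h2 : ∀ᶠ w in 𝓝 z, N w * N w = -1)
    (hh : dx (dx N) z + dy (dy N) z + (‖dx N z‖ ^ 2 + ‖dy N z‖ ^ 2) • N z = 0)
    (hm : ContDiffAt ℝ ∞ m z) (hre : (m z).re = 0) (hmN : (inner ℝ (m z) (N z) : ℝ) = 0) :
    energyDensity N m z =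
      pd 1 (fun w => (1 / 2) * (inner ℝ (dx N w - N w * dy N w) (m w) : ℝ)) z +
      pd Complex.I (fun w => (1 / 2) * (inner ℝ (dy N w + N w * dx N w) (m w) : ℝ)) z := by
  have hx := ContDiffAt.dx hN
  have hy := ContDiffAt.dy hN
  have dN := ContDiffAt.diff hN
  have dX := ContDiffAt.diff hx
  have dY := ContDiffAt.diff hy
  have dm := ContDiffAt.diff hm
  have hNz : N z * N z = -1 := h2.self_of_nhds
  obtain ⟨rx, ox⟩ := re_eq_zero_of_anticomm hNz (pd_anticomm (e := 1) hN h2)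
  obtain ⟨ry, oy⟩ := re_eq_zero_of_anticomm hNz (pd_anticomm (e := Complex.I) hN h2)
  rw [← dx_eq_pd] at rx ox
  rw [← dy_eq_pd] at ry oy
  have t1 := inner_mul_eq_zero hNz rx ry hre ox oy hmN
  have t2 := inner_mul_eq_zero hNz ry rx hre oy ox hmN
  have d3 : DifferentiableAt ℝ (fun w => N w * dy N w) z := dN.mul dY
  have d4 : DifferentiableAt ℝ (fun w => N w * dx N w) z := dN.mul dX
  have d1 : DifferentiableAt ℝ (fun w => dx N w - N w * dy N w) z := dX.sub (dN.mul dY)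
  have d2 : DifferentiableAt ℝ (fun w => dy N w + N w * dx N w) z := dY.add (dN.mul dX)
  have e1 : pd 1 (fun w => (1 / 2) * (inner ℝ (dx N w - N w * dy N w) (m w) : ℝ)) z =
      (1 / 2) * ((inner ℝ (dx (dx N) z - (dx N z * dy N z + N z * dx (dy N) z)) (m z) : ℝ) +
        inner ℝ (dx N z - N z * dy N z) (dx m z)) := by
    have := pd_const_smul (e := 1) (z := z) (u := fun w =>
      (inner ℝ (dx N w - N w * dy N w) (m w) : ℝ)) (1 / 2)
    simp only [smul_eq_mul] at this
    rw [this, pd_inner d1 dm, pd_sub dX d3, pd_mul dN dY]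
    rfl
  have e2 : pd Complex.I (fun w => (1 / 2) * (inner ℝ (dy N w + N w * dx N w) (m w) : ℝ)) z =
      (1 / 2) * ((inner ℝ (dy (dy N) z + (dy N z * dx N z + N z * dx (dy N) z)) (m z) : ℝ) +
        inner ℝ (dy N z + N z * dx N z) (dy m z)) := by
    have := pd_const_smul (e := Complex.I) (z := z) (u := fun w =>
      (inner ℝ (dy N w + N w * dx N w) (m w) : ℝ)) (1 / 2)
    simp only [smul_eq_mul] at this
    rw [this, pd_inner d2 dm, pd_add dY d4, pd_mul dN dX, dx_dy_comm hN]
    rfl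
  have h3 : (inner ℝ (dx (dx N) z) (m z) : ℝ) + inner ℝ (dy (dy N) z) (m z) = 0 := by
    have := congrArg (fun q => (inner ℝ q (m z) : ℝ)) hh
    simp only [inner_add_left, inner_zero_left, real_inner_smul_left] at this
    rw [real_inner_comm (m z) (N z), hmN] at this
    linarith
  rw [e1, e2, energyDensity]
  simp only [inner_add_left, inner_sub_left]
  rw [inner_mul_left_of_sq hNz (dy N z) (dx m z)]
  linear_combination (-1 / 2 : ℝ) * h3 + (1 / 2 : ℝ) * t1 - (1 / 2 : ℝ) * t2

/-! ### Stokes' theorem for the first variation of the energy -/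

section Stokes

variable {M : Type*} [TopologicalSpace M] [ChartedSpace ℂ M]

/-- Conformal invariance: the energy and the degree term both scale by |w'(z)|² under a holomorphic
change of coordinate w, the Jacobian, so the expression is a density on the surface. -/
lemma energyDensity_coordChange [IsManifold 𝓘(ℂ, ℂ) 1 M] {N m : M → ℍ} {U : Set M} (hU : IsOpen U)
    (hN : SmoothOn N U) (h2 : ∀ p ∈ U, N p * N p = -1) (hm : SmoothOn m U) {c c' : M} {z : ℂ}
    (hz : z ∈ chartDom (chartAt ℂ c').source c) (hzU : (chartAt ℂ c).symm z ∈ U) :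
    energyDensity (inChart N c) (inChart m c) z =
      ((deriv (coordChange c c') z).re ^ 2 + (deriv (coordChange c c') z).im ^ 2) *
        energyDensity (inChart N c') (inChart m c') (coordChange c c' z) := by
  have hz' := coordChange_mem hz hzU
  have dN := ContDiffAt.diff (hN.inChart hU hz')
  have dm := ContDiffAt.diff (hm.inChart hU hz')
  have e : inChart N c z = inChart N c' (coordChange c c' z) :=
    (inChart_eq_comp_coordChange N hz).self_of_nhds
  have hsq : inChart N c' (coordChange c c' z) * inChart N c' (coordChange c c' z) = -1 :=
    h2 _ hz'.2
  simp only [energyDensity]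
  rw [dx_coordChange hz dN, dy_coordChange hz dN, dx_coordChange hz dm, dy_coordChange hz dm, e]
  simp only [inner_mul_left_of_sq hsq, mul_add, mul_neg, mul_smul_comm, inner_add_left,
    inner_add_right, inner_neg_left, inner_neg_right, real_inner_smul_left, real_inner_smul_right]
  ring

lemma continuousOn_energyDensity [IsManifold 𝓘(ℂ, ℂ) 1 M] {N m : M → ℍ} {U : Set M}
    (hU : IsOpen U) (hN : SmoothOn N U) (hm : SmoothOn m U) (c : M) :
    ContinuousOn (energyDensity (inChart N c) (inChart m c)) (chartDom U c) := by
  intro z hz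
  have sN := hN.inChart hU hz
  have sm := hm.inChart hU hz
  have cN := sN.continuousAt
  have c1 := (ContDiffAt.dx sN).continuousAt
  have c2 := (ContDiffAt.dy sN).continuousAt
  have c3 := (ContDiffAt.dx sm).continuousAt
  have c4 := (ContDiffAt.dy sm).continuousAt
  exact (continuousAt_const.mul ((((c1.inner c3).add (c2.inner c4)).add
    (c2.inner (cN.mul c3))).add ((cN.mul c1).inner c4))).continuousWithinAt

lemma inChart_eventually_zero {F : Type*} [Zero F] {m : M → F} {T : Set M} (hT : IsClosed T)
    (h0 : ∀ p ∉ T, m p = 0) {c : M} {z : ℂ} (hz : z ∈ (chartAt ℂ c).target) (hzT : (chartAt ℂ c).symm z ∉ T) :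
    inChart m c =ᶠ[𝓝 z] fun _ => 0 := by
  filter_upwards [(isOpen_chartDom hT.isOpen_compl c).mem_nhds ⟨hz, hzT⟩] with w hw
  exact h0 _ hw.2

/-- The divergence theorem in a coordinate. -/
lemma integral_energyDensity_eq_zero [IsManifold 𝓘(ℂ, ℂ) 1 M] {N m : M → ℍ} {U T : Set M}
    (hU : IsOpen U) (hN : IsHarmonicSphereMapOn N U) (hm : SmoothOn m U) (hT : IsCompact T)
    (hTc : IsClosed T) (hTU : T ⊆ U) {c : M} (hc : T ⊆ (chartAt ℂ c).source)
    (h0 : ∀ p ∉ T, m p = 0) (hre : ∀ p ∈ U, (m p).re = 0)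
    (hmN : ∀ p ∈ U, (inner ℝ (m p) (N p) : ℝ) = 0) :
    ∫ z in chartDom U c, energyDensity (inChart N c) (inChart m c) z = 0 := by
  set W := chartDom U c with hW
  have hWo : IsOpen W := isOpen_chartDom hU c
  have hS := isCompact_chartDom hT hc
  have hSW : chartDom T c ⊆ W := chartDom_mono hTU c
  set A : ℂ → ℝ := fun w => (1 / 2) *
    (inner ℝ (dx (inChart N c) w - inChart N c w * dy (inChart N c) w) (inChart m c w) : ℝ) with hA
  set B : ℂ → ℝ := fun w => (1 / 2) *
    (inner ℝ (dy (inChart N c) w + inChart N c w * dx (inChart N c) w) (inChart m c w) : ℝ) with hB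
  have sA : ∀ z ∈ W, ContDiffAt ℝ ∞ A z := fun z hz => by
    have sN := hN.1.inChart hU hz
    exact contDiffAt_const.mul (((ContDiffAt.dx sN).sub (sN.mul (ContDiffAt.dy sN))).inner ℝ
      (hm.inChart hU hz))
  have sB : ∀ z ∈ W, ContDiffAt ℝ ∞ B z := fun z hz => by
    have sN := hN.1.inChart hU hz
    exact contDiffAt_const.mul (((ContDiffAt.dy sN).add (sN.mul (ContDiffAt.dx sN))).inner ℝ
      (hm.inChart hU hz))
  have z0 : ∀ z ∈ W, z ∉ chartDom T c → inChart m c =ᶠ[𝓝 z] fun _ => 0 := fun z hz hzS =>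
    inChart_eventually_zero hTc h0 hz.1 fun h => hzS ⟨hz.1, h⟩
  have eA : ∀ z ∈ W, z ∉ chartDom T c → A =ᶠ[𝓝 z] fun _ => 0 := fun z hz hzS =>
    (z0 z hz hzS).mono fun w hw => by simp only [hA, hw, inner_zero_right, mul_zero]
  have eB : ∀ z ∈ W, z ∉ chartDom T c → B =ᶠ[𝓝 z] fun _ => 0 := fun z hz hzS =>
    (z0 z hz hzS).mono fun w hw => by simp only [hB, hw, inner_zero_right, mul_zero]
  have iA : IntegrableOn (pd 1 A) W := integrableOn_of_zero_off_compact hWo.measurableSet hS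
    (fun z hz => (ContDiffAt.pd (sA z (hSW hz))).continuousAt.continuousWithinAt)
    fun z hz hzS => by rw [pd_congr (eA z hz hzS), pd_const]
  have iB : IntegrableOn (pd Complex.I B) W := integrableOn_of_zero_off_compact hWo.measurableSet hS
    (fun z hz => (ContDiffAt.pd (sB z (hSW hz))).continuousAt.continuousWithinAt)
    fun z hz hzS => by rw [pd_congr (eB z hz hzS), pd_const]
  have e : ∫ z in W, energyDensity (inChart N c) (inChart m c) z =
      ∫ z in W, (pd 1 A z + pd Complex.I B z) := by
    refine setIntegral_congr_fun hWo.measurableSet fun z hz => ?_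
    exact energyDensity_eq_div (hN.1.inChart hU hz)
      ((hWo.eventually_mem hz).mono fun w hw => hN.2.1 _ hw.2) (hN.2.2 c z hz) (hm.inChart hU hz)
      (hre _ hz.2) (hmN _ hz.2)
  rw [e, integral_add iA iB,
    integral_pd_eq_zero hWo hS hSW sA (fun z hz hzS => (eA z hz hzS).self_of_nhds),
    integral_pd_eq_zero hWo hS hSW sB (fun z hz hzS => (eB z hz hzS).self_of_nhds), add_zero]

/-- The first variation of the energy of a harmonic map in a compactly supported direction
vanishes. -/
lemma surfaceIntegral_energyDensity_eq_zero [T2Space M] [IsManifold 𝓘(ℂ, ℂ) 1 M] {N m : M → ℍ}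
    {U K : Set M} (hU : IsOpen U) (hN : IsHarmonicSphereMapOn N U) (hm : SmoothOn m U)
    (hK : IsCompact K) (hKU : K ⊆ U) (h0 : ∀ p ∉ K, m p = 0)
    (hre : ∀ p ∈ U, (m p).re = 0) (hmN : ∀ p ∈ U, (inner ℝ (m p) (N p) : ℝ) = 0)
    {ρ : ChartPartition M} (hρ : IsSubordinateToCharts ρ) :
    surfaceIntegral ρ K (fun c => energyDensity (inChart N c) (inChart m c)) = 0 := by
  obtain ⟨I, hI⟩ := exists_finset_partition ρ hK
  have hKc := hK.isClosed
  -- The direction m is cut into pieces supported in single charts, the density being linear in m.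
  -- The pieces remain tangent to S².
  set n : M → M → ℍ := fun c p => ρ c p • m p with hn
  have hns : ∀ c, SmoothOn (n c) U := fun c => by
    have h1 : ContMDiffOn 𝓘(ℝ, ℂ) 𝓘(ℝ, ℝ) ∞ (ρ c) U := (ρ c).contMDiff.contMDiffOn
    exact h1.smul hm
  have hn0 : ∀ c, ∀ p ∉ K ∩ tsupport (ρ c), n c p = 0 := fun c p hp => by
    by_cases hpK : p ∈ K
    · simp only [hn, partition_eq_zero fun h => hp ⟨hpK, h⟩, zero_smul]
    · simp only [hn, h0 p hpK, smul_zero]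
  have hTc : ∀ c, IsClosed (K ∩ tsupport (ρ c)) := fun c => hKc.inter (isClosed_tsupport _)
  have hT : ∀ c, IsCompact (K ∩ tsupport (ρ c)) := fun c => hK.inter_right (isClosed_tsupport _)
  have hTs : ∀ c, K ∩ tsupport (ρ c) ⊆ (chartAt ℂ c).source := fun c =>
    Set.inter_subset_right.trans (hρ c)
  have hmeas : ∀ c, MeasurableSet (chartDom K c) := measurableSet_chartDom_of_isClosed hKc
  have hsum : m = fun p => ∑ c ∈ I, n c p := by
    funext p
    by_cases hp : p ∈ K
    · simp only [hn, ← Finset.sum_smul, sum_partition_eq_one hI hp, one_smul]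
    · simp only [hn, h0 p hp, smul_zero, Finset.sum_const_zero]
  have hdens : ∀ c, ∀ z ∈ chartDom K c, energyDensity (inChart N c) (inChart m c) z =
      ∑ c' ∈ I, energyDensity (inChart N c) (inChart (n c') c) z := fun c z hz => by
    have : inChart m c = fun w => ∑ c' ∈ I, inChart (n c') c w := by
      funext w
      exact congrFun hsum _
    rw [this]
    exact energyDensity_sum I fun c' _ => (hns c').inChart hU (chartDom_mono hKU c hz)
  have hcont : ∀ c c', ContinuousOn (fun z => ρ c' ((chartAt ℂ c).symm z)) (chartDom K c) :=
    fun c c' => (continuousOn_partition ρ c' c).mono fun z hz => hz.1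
  have hcd : ∀ c c', ContinuousOn (energyDensity (inChart N c) (inChart (n c') c)) (chartDom K c) :=
    fun c c' => (continuousOn_energyDensity hU hN.1 (hns c') c).mono (chartDom_mono hKU c)
  have hvan : ∀ c c' z, z ∈ (chartAt ℂ c).target → (chartAt ℂ c).symm z ∉ K ∩ tsupport (ρ c') →
      energyDensity (inChart N c) (inChart (n c') c) z = 0 := fun c c' z hz hzT =>
    energyDensity_eq_zero (inChart_eventually_zero (hTc c') (hn0 c') hz hzT)
  have hint1 : ∀ c c', IntegrableOn (fun z => ρ c ((chartAt ℂ c).symm z) *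
      energyDensity (inChart N c) (inChart (n c') c) z) (chartDom K c) := fun c c' => by
    refine integrableOn_of_zero_off_compact (hmeas c) (isCompact_chartDom (hT c) (hTs c))
      (((hcont c c).mul (hcd c c')).mono (chartDom_mono Set.inter_subset_left c)) fun z hz hzS => ?_
    rw [partition_eq_zero fun h => hzS ⟨hz.1, hz.2, h⟩, zero_mul]
  have hint2 : ∀ c c', IntegrableOn (fun z => ρ c' ((chartAt ℂ c).symm z) *
      energyDensity (inChart N c) (inChart (n c) c) z) (chartDom K c) := fun c c' => by
    refine integrableOn_of_zero_off_compact (hmeas c) (isCompact_chartDom (hT c) (hTs c))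
      (((hcont c c').mul (hcd c c)).mono (chartDom_mono Set.inter_subset_left c)) fun z hz hzS => ?_
    rw [hvan c c z hz.1 fun h => hzS ⟨hz.1, h⟩, mul_zero]
  -- The piece of index c' is moved from chart c to its own chart c'. Summation over c then removes
  -- the weights ρ_c, leaving one divergence integral per piece.
  have hchange : ∀ c c', ∫ z in chartDom K c, ρ c ((chartAt ℂ c).symm z) *
        energyDensity (inChart N c) (inChart (n c') c) z =
      ∫ z in chartDom K c', ρ c ((chartAt ℂ c').symm z) *
        energyDensity (inChart N c') (inChart (n c') c') z := fun c c' => by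
    set X := K ∩ ((chartAt ℂ c).source ∩ (chartAt ℂ c').source) with hX
    have hXm : ∀ d, MeasurableSet (chartDom X d) := fun d => by
      rw [hX, chartDom_inter]
      exact (hmeas d).inter (isOpen_chartDom
        ((chartAt ℂ c).open_source.inter (chartAt ℂ c').open_source) d).measurableSet
    have e1 := setIntegral_eq_of_subset_of_forall_sdiff_eq_zero (μ := (volume : Measure ℂ))
      (f := fun z => ρ c ((chartAt ℂ c).symm z) *
        energyDensity (inChart N c) (inChart (n c') c) z) (hmeas c)
      (chartDom_mono (Set.inter_subset_left : X ⊆ K) c) fun z hz => by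
        rw [hvan c c' z hz.1.1 fun h => hz.2 ⟨hz.1.1, hz.1.2, (chartAt ℂ c).map_target hz.1.1,
          hTs c' h⟩, mul_zero]
    have e2 := setIntegral_eq_of_subset_of_forall_sdiff_eq_zero (μ := (volume : Measure ℂ))
      (f := fun z => ρ c ((chartAt ℂ c').symm z) *
        energyDensity (inChart N c') (inChart (n c') c') z) (hmeas c')
      (chartDom_mono (Set.inter_subset_left : X ⊆ K) c') fun z hz => by
        rw [partition_eq_zero fun h => hz.2 ⟨hz.1.1, hz.1.2, hρ c h,
          (chartAt ℂ c').map_target hz.1.1⟩, zero_mul]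
    rw [e1, e2]
    refine (integral_chartDom_eq (c := c) (c' := c') (fun p hp => hp.2.1) (fun p hp => hp.2.2)
      (hXm c) fun z hz => ?_).symm
    have hz' : z ∈ chartDom (chartAt ℂ c').source c := ⟨hz.1, hz.2.2.2⟩
    rw [energyDensity_coordChange hU hN.1 hN.2.1 (hns c') hz' (hKU hz.2.1)]
    simp only [coordChange]
    rw [(chartAt ℂ c').left_inv hz.2.2.2]
    ring
  rw [surfaceIntegral_eq_sum hI]
  calc ∑ c ∈ I, ∫ z in chartDom K c, ρ c ((chartAt ℂ c).symm z) *
        energyDensity (inChart N c) (inChart m c) z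
      = ∑ c ∈ I, ∑ c' ∈ I, ∫ z in chartDom K c, ρ c ((chartAt ℂ c).symm z) *
        energyDensity (inChart N c) (inChart (n c') c) z := by
        refine Finset.sum_congr rfl fun c _ => ?_
        rw [← integral_finsetSum I fun c' _ => hint1 c c']
        refine setIntegral_congr_fun (hmeas c) fun z hz => ?_
        simp only [hdens c z hz, Finset.mul_sum]
    _ = ∑ c' ∈ I, ∑ c ∈ I, ∫ z in chartDom K c', ρ c ((chartAt ℂ c').symm z) *
        energyDensity (inChart N c') (inChart (n c') c') z := by
        rw [Finset.sum_comm]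
        exact Finset.sum_congr rfl fun c' _ => Finset.sum_congr rfl fun c _ => hchange c c'
    _ = ∑ c' ∈ I, ∫ z in chartDom U c', energyDensity (inChart N c') (inChart (n c') c') z := by
        refine Finset.sum_congr rfl fun c' _ => ?_
        rw [← integral_finsetSum I fun c _ => hint2 c' c,
          setIntegral_eq_of_subset_of_forall_sdiff_eq_zero
            (isOpen_chartDom hU c').measurableSet (chartDom_mono hKU c')
            fun z hz => hvan c' c' z hz.1.1 fun h => hz.2 ⟨hz.1.1, h.1⟩]
        refine setIntegral_congr_fun (hmeas c') fun z hz => ?_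
        simp only [← Finset.sum_mul, sum_partition_eq_one hI hz.2, one_mul]
    _ = 0 := by
        refine Finset.sum_eq_zero fun c _ => ?_
        refine integral_energyDensity_eq_zero hU hN (hns c) (hT c) (hTc c)
          (Set.inter_subset_left.trans hKU) (hTs c) (hn0 c) (fun p hp => ?_) fun p hp => ?_
        · simp only [hn, Quaternion.re_smul, hre p hp, smul_zero]
        · simp only [hn, real_inner_smul_left, hmN p hp, mul_zero]

end Stokes

end

end MuDarboux

namespace MuDarboux

noncomputable section

open MeasureTheory

/-! ### Infinitesimal conformal variations -/

/-- The infinitesimal variation of the left normal `N` of `g` under the infinitesimal conformal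
variation `Y`. -/
def normalVariation (g N Y : ℂ → ℍ) (z : ℂ) : ℍ := (dy Y z - N z * dx Y z) * (dx g z)⁻¹

lemma inner_mul_one {N : ℍ} (a b : ℍ) (h : N.re = 0) :
    (inner ℝ (N * a) b : ℝ) = -inner ℝ a (N * b) := by
  simp only [inner_eq_components, Quaternion.re_mul, Quaternion.imI_mul, Quaternion.imJ_mul,
    Quaternion.imK_mul, h]
  ring

/-- n solves the linearisation Y_y = n g_x + N Y_x of g_y = N g_x. Pairing n g_x with g_x and with
g_y = N g_x gives |g_x|² times Re n and ⟨n, N⟩; the linearised conformality conditions make both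
vanish. -/
lemma normalVariation_orthogonal {N gx gy yx yy : ℍ} (hN : N * N = -1) (hg : gx ≠ 0)
    (hgy : gy = N * gx) (h1 : (inner ℝ gx yx : ℝ) = inner ℝ gy yy)
    (h2 : (inner ℝ gx yy : ℝ) + inner ℝ gy yx = 0) :
    ((yy - N * yx) * gx⁻¹).re = 0 ∧ (inner ℝ ((yy - N * yx) * gx⁻¹) N : ℝ) = 0 := by
  set n := (yy - N * yx) * gx⁻¹ with hn
  have hng : n * gx = yy - N * yx := by rw [hn, mul_assoc, inv_mul_cancel₀ hg, mul_one]
  have hpos : ‖gx‖ ^ 2 ≠ 0 := by positivity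
  have e1 : (inner ℝ n 1 : ℝ) = n.re := by simp [inner_eq_components]
  constructor
  · have h3 := inner_mul_right_self gx n 1
    rw [hng, one_mul, inner_sub_left, inner_mul_left_of_sq hN, ← hgy, real_inner_comm gx yy,
      real_inner_comm gy yx] at h3
    rw [← e1]
    refine mul_left_cancel₀ hpos ?_
    linarith
  · have h3 := inner_mul_right_self gx n N
    rw [hng, ← hgy, inner_sub_left, hgy, inner_mul_left_of_sq hN, ← mul_assoc, hN, ← hgy,
      neg_one_mul, inner_neg_right, neg_neg, real_inner_comm gx yx, real_inner_comm gy yy] at h3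
    refine mul_left_cancel₀ hpos ?_
    linarith

section Algebra

variable {N x y n nx ny : ℍ}

/-- For Q = N_y + N N_x and its variation R = n_y + nN_x + Nn_x: Q is tangent to S² at N, and R
satisfies the linearised form of this condition. -/
lemma variation_components (hN : N * N = -1) (rx : x.re = 0) (ry : y.re = 0) (rn : n.re = 0)
    (rnx : nx.re = 0) (rny : ny.re = 0) (ox : (inner ℝ x N : ℝ) = 0)
    (oy : (inner ℝ y N : ℝ) = 0)
    (onx : (inner ℝ nx N : ℝ) + inner ℝ n x = 0) (ony : (inner ℝ ny N : ℝ) + inner ℝ n y = 0) :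
    (y + N * x).re = 0 ∧ (inner ℝ (y + N * x) N : ℝ) = 0 ∧ (ny + n * x + N * nx).re = 0 ∧
      (inner ℝ (ny + n * x + N * nx) N : ℝ) + inner ℝ (y + N * x) n = 0 := by
  obtain ⟨h0, -⟩ := sq_eq_neg_one_components hN
  simp only [inner_eq_components, Quaternion.re_mul, Quaternion.imI_mul, Quaternion.imJ_mul,
    Quaternion.imK_mul, Quaternion.re_add, Quaternion.imI_add, Quaternion.imJ_add,
    Quaternion.imK_add, h0, rx, ry, rn, rnx, rny, mul_zero, zero_mul, zero_add, add_zero, zero_sub]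
    at ox oy onx ony ⊢
  refine ⟨?_, ?_, ?_, ?_⟩
  · linear_combination -ox
  · linear_combination oy
  · linear_combination -onx
  · linear_combination ony

/-- Of the terms in ⟨Q, R⟩, those with nN_x drop out: one is a triple product of tangent vectors,
the other a multiple of ⟨N, n⟩. The rest is the variation of energy plus degree. -/
lemma variation_energy (hN : N * N = -1) (rx : x.re = 0) (ry : y.re = 0) (rn : n.re = 0)
    (ox : (inner ℝ x N : ℝ) = 0) (oy : (inner ℝ y N : ℝ) = 0) (on : (inner ℝ n N : ℝ) = 0) :
    (inner ℝ (y + N * x) (ny + n * x + N * nx) : ℝ) =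
      inner ℝ x nx + inner ℝ y ny + inner ℝ y (N * nx) + inner ℝ (N * x) ny := by
  have t : (inner ℝ y (n * x) : ℝ) = 0 := by
    rw [real_inner_comm]
    exact inner_mul_eq_zero hN rn rx ry on ox oy
  have e1 : (inner ℝ (N * x) (N * nx) : ℝ) = inner ℝ x nx := by
    rw [inner_mul_left_self, norm_of_sq_eq_neg_one hN]
    ring
  have e2 : (inner ℝ (N * x) (n * x) : ℝ) = 0 := by
    rw [inner_mul_right_self, real_inner_comm, on, mul_zero]
  simp only [inner_add_left, inner_add_right, t, e1, e2]
  ring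

end Algebra

/-- A conformal immersion `g` with left normal `N` and an infinitesimal conformal variation `Y`, in
a coordinate. -/
structure LocalVariation (g N Y : ℂ → ℍ) (W : Set ℂ) : Prop where
  isOpen : IsOpen W
  smoothg : ∀ z ∈ W, ContDiffAt ℝ ∞ g z
  smoothN : ∀ z ∈ W, ContDiffAt ℝ ∞ N z
  smoothY : ∀ z ∈ W, ContDiffAt ℝ ∞ Y z
  sq : ∀ z ∈ W, N z * N z = -1
  conformal : ∀ z ∈ W, dy g z = N z * dx g z
  immersed : ∀ z ∈ W, dx g z ≠ 0
  var₁ : ∀ z ∈ W, (inner ℝ (dx g z) (dx Y z) : ℝ) = inner ℝ (dy g z) (dy Y z)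
  var₂ : ∀ z ∈ W, (inner ℝ (dx g z) (dy Y z) : ℝ) + inner ℝ (dy g z) (dx Y z) = 0

namespace LocalVariation

variable {g N Y : ℂ → ℍ} {W : Set ℂ}

lemma sq_nhds (h : LocalVariation g N Y W) {z : ℂ} (hz : z ∈ W) :
    ∀ᶠ w in 𝓝 z, N w * N w = -1 :=
  (h.isOpen.eventually_mem hz).mono h.sq

lemma smooth_normalVariation (h : LocalVariation g N Y W) {z : ℂ} (hz : z ∈ W) :
    ContDiffAt ℝ ∞ (normalVariation g N Y) z :=
  ((ContDiffAt.dy (h.smoothY z hz)).sub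
    ((h.smoothN z hz).mul (ContDiffAt.dx (h.smoothY z hz)))).mul
    (contDiffAt_quaternion_inv (ContDiffAt.dx (h.smoothg z hz)) (h.immersed z hz))

lemma orthogonal (h : LocalVariation g N Y W) {z : ℂ} (hz : z ∈ W) :
    (normalVariation g N Y z).re = 0 ∧ (inner ℝ (normalVariation g N Y z) (N z) : ℝ) = 0 :=
  normalVariation_orthogonal (h.sq z hz) (h.immersed z hz) (h.conformal z hz) (h.var₁ z hz)
    (h.var₂ z hz)

lemma anticomm (h : LocalVariation g N Y W) {z : ℂ} (hz : z ∈ W) :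
    N z * normalVariation g N Y z = -(normalVariation g N Y z * N z) :=
  eq_neg_of_add_eq_zero_right
    (anticomm_of_inner_eq_zero (h.sq z hz) (h.orthogonal hz).1 (h.orthogonal hz).2)

lemma dy_variation (h : LocalVariation g N Y W) {z : ℂ} (hz : z ∈ W) :
    dy Y z = normalVariation g N Y z * dx g z + N z * dx Y z := by
  rw [normalVariation, mul_assoc, inv_mul_cancel₀ (h.immersed z hz), mul_one]
  abel

/-- Differentiate g_y = N g_x in both directions and eliminate g_xy; N² = −1 cancels g_xx. -/
lemma laplace_g (h : LocalVariation g N Y W) {z : ℂ} (hz : z ∈ W) :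
    dx (dx g) z + dy (dy g) z = (dy N z + N z * dx N z) * dx g z := by
  have sg := h.smoothg z hz
  have dN := ContDiffAt.diff (h.smoothN z hz)
  have dX := ContDiffAt.diff (ContDiffAt.dx sg)
  have e : dy g =ᶠ[𝓝 z] fun w => N w * dx g w := (h.isOpen.eventually_mem hz).mono h.conformal
  have hyy : dy (dy g) z = dy N z * dx g z + N z * dx (dy g) z := by
    rw [dx_dy_comm sg, dy_eq_pd, pd_congr e, pd_mul dN dX]
    rfl
  have hxy : dx (dy g) z = dx N z * dx g z + N z * dx (dx g) z := by
    rw [dx_eq_pd, pd_congr e, pd_mul dN dX]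
    rfl
  rw [hyy, hxy, mul_add, ← mul_assoc (N z) (N z), h.sq z hz]
  noncomm_ring

/-- The linearisation of Δg = (N_y + N N_x)g_x. The second derivatives of g carry the factor nN +
Nn, which is 0. -/
lemma laplace_Y (h : LocalVariation g N Y W) {z : ℂ} (hz : z ∈ W) :
    dx (dx Y) z + dy (dy Y) z =
      (dy (normalVariation g N Y) z + normalVariation g N Y z * dx N z +
        N z * dx (normalVariation g N Y) z) * dx g z + (dy N z + N z * dx N z) * dx Y z := by
  have sg := h.smoothg z hz
  have sY := h.smoothY z hz
  have dN := ContDiffAt.diff (h.smoothN z hz)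
  have dn := ContDiffAt.diff (h.smooth_normalVariation hz)
  have dX := ContDiffAt.diff (ContDiffAt.dx sg)
  have dXY := ContDiffAt.diff (ContDiffAt.dx sY)
  have d1 : DifferentiableAt ℝ (fun w => normalVariation g N Y w * dx g w) z := dn.mul dX
  have d2 : DifferentiableAt ℝ (fun w => N w * dx Y w) z := dN.mul dXY
  have e : dy g =ᶠ[𝓝 z] fun w => N w * dx g w := (h.isOpen.eventually_mem hz).mono h.conformal
  have eY : dy Y =ᶠ[𝓝 z] fun w => normalVariation g N Y w * dx g w + N w * dx Y w :=
    (h.isOpen.eventually_mem hz).mono fun w hw => h.dy_variation hw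
  have hxy : dx (dy g) z = dx N z * dx g z + N z * dx (dx g) z := by
    rw [dx_eq_pd, pd_congr e, pd_mul dN dX]
    rfl
  have hYyy : dy (dy Y) z = dy (normalVariation g N Y) z * dx g z +
      normalVariation g N Y z * dx (dy g) z + (dy N z * dx Y z + N z * dx (dy Y) z) := by
    rw [dx_dy_comm sg, dx_dy_comm sY, dy_eq_pd, pd_congr eY, pd_add d1 d2, pd_mul dn dX,
      pd_mul dN dXY]
    rfl
  have hYxy : dx (dy Y) z = dx (normalVariation g N Y) z * dx g z +
      normalVariation g N Y z * dx (dx g) z + (dx N z * dx Y z + N z * dx (dx Y) z) := by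
    rw [dx_eq_pd, pd_congr eY, pd_add d1 d2, pd_mul dn dX, pd_mul dN dXY]
    rfl
  have ha := h.anticomm hz
  set n := normalVariation g N Y
  have e1 : N z * (n z * dx (dx g) z) = -(n z * N z * dx (dx g) z) := by
    rw [← mul_assoc, ha, neg_mul]
  have e2 : N z * (N z * dx (dx Y) z) = -dx (dx Y) z := by
    rw [← mul_assoc, h.sq z hz, neg_one_mul]
  rw [hYyy, hYxy, hxy]
  simp only [mul_add, e1, e2]
  noncomm_ring

lemma jet_mem (h : LocalVariation g N Y W) {z : ℂ} (hz : z ∈ W) :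
    (dx g z, dy g z, dx (dx g) z, dx (dy g) z, dy (dy g) z) ∈
      {x : ℍ × ℍ × ℍ × ℍ × ℍ | 0 < jetDet x.1 x.2.1} := by
  have hN := h.sq z hz
  have hg := h.immersed z hz
  have hpos : (0 : ℝ) < ‖dx g z‖ ^ 2 := by positivity
  have hG : (inner ℝ (dy g z) (dy g z) : ℝ) = ‖dx g z‖ ^ 2 := by
    rw [h.conformal z hz, real_inner_self_eq_norm_sq, norm_mul, norm_of_sq_eq_neg_one hN, one_mul]
  have hF : (inner ℝ (dx g z) (dy g z) : ℝ) = 0 := by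
    have e := inner_mul_right_self (dx g z) 1 (N z)
    rw [one_mul] at e
    rw [h.conformal z hz, e]
    simp [inner_eq_components, (sq_eq_neg_one_components hN).1]
  simp only [Set.mem_ofPred_eq, jetDet]
  rw [hG, hF, real_inner_self_eq_norm_sq]
  have := mul_pos hpos hpos
  linarith

/-- With Δg = Qg_x and ΔY = Rg_x + QY_x, the term |Q|²⟨g_x, Y_x⟩ from the numerator cancels against
the variation of the conformal factor. What remains is ½⟨Q, R⟩. -/
lemma fderiv_jetWillmore (h : LocalVariation g N Y W) {z : ℂ} (hz : z ∈ W) :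
    fderiv ℝ jetWillmore (dx g z, dy g z, dx (dx g) z, dx (dy g) z, dy (dy g) z)
      (dx Y z, dy Y z, dx (dx Y) z, dx (dy Y) z, dy (dy Y) z) =
    energyDensity N (normalVariation g N Y) z := by
  have hN := h.sq z hz
  have hg := h.immersed z hz
  have hgy := h.conformal z hz
  have hYy := h.dy_variation hz
  have hLg := h.laplace_g hz
  have hLY := h.laplace_Y hz
  obtain ⟨rx, ox⟩ := re_eq_zero_of_anticomm hN (pd_anticomm (e := 1) (h.smoothN z hz) (h.sq_nhds hz))
  obtain ⟨ry, oy⟩ := re_eq_zero_of_anticomm hN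
    (pd_anticomm (e := Complex.I) (h.smoothN z hz) (h.sq_nhds hz))
  rw [← dx_eq_pd] at rx ox
  rw [← dy_eq_pd] at ry oy
  obtain ⟨rn, on⟩ := h.orthogonal hz
  have hre (e : ℂ) : (pd e (normalVariation g N Y) z).re = 0 := by
    have e1 : (fun w => (inner ℝ (normalVariation g N Y w) (1 : ℍ) : ℝ)) =ᶠ[𝓝 z] fun _ => 0 :=
      (h.isOpen.eventually_mem hz).mono fun w hw => by
        simp [inner_eq_components, (h.orthogonal hw).1]
    have e2 := pd_congr (e := e) e1
    rw [pd_const, pd_inner (ContDiffAt.diff (h.smooth_normalVariation hz))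
      (differentiableAt_const _), pd_const, inner_zero_right, add_zero] at e2
    simpa [inner_eq_components] using e2
  have hon (e : ℂ) : (inner ℝ (pd e (normalVariation g N Y) z) (N z) : ℝ) +
      inner ℝ (normalVariation g N Y z) (pd e N z) = 0 := by
    have e1 : (fun w => (inner ℝ (normalVariation g N Y w) (N w) : ℝ)) =ᶠ[𝓝 z] fun _ => 0 :=
      (h.isOpen.eventually_mem hz).mono fun w hw => (h.orthogonal hw).2
    have e2 := pd_congr (e := e) e1
    rwa [pd_const, pd_inner (ContDiffAt.diff (h.smooth_normalVariation hz))
      (ContDiffAt.diff (h.smoothN z hz))] at e2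
  have hrex := hre 1
  have hrey := hre Complex.I
  have honx := hon 1
  have hony := hon Complex.I
  rw [← dx_eq_pd] at hrex honx
  rw [← dy_eq_pd] at hrey hony
  rw [← dx_eq_pd] at honx
  rw [← dy_eq_pd] at hony
  obtain ⟨cQ, cQN, cR, cRN⟩ := variation_components hN rx ry rn hrex hrey ox oy honx hony
  have hE := variation_energy (nx := dx (normalVariation g N Y) z)
    (ny := dy (normalVariation g N Y) z) hN rx ry rn ox oy on
  have v1 := h.var₁ z hz
  have v2 := h.var₂ z hz
  have hQN := anticomm_of_inner_eq_zero hN cQ cQN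
  unfold energyDensity
  rw [← hE]
  set n := normalVariation g N Y
  set Q := dy N z + N z * dx N z
  set R := dy n z + n z * dx N z + N z * dx n z
  set p := dx g z with hp
  set p' := dx Y z with hp'
  have nN := norm_of_sq_eq_neg_one hN
  have re1 (a : ℍ) : (inner ℝ (a * p) p : ℝ) = ‖p‖ ^ 2 * a.re := by
    have := inner_mul_right_self p a 1
    rw [one_mul] at this
    rw [this]
    simp [inner_eq_components]
  have hG : (inner ℝ (dy g z) (dy g z) : ℝ) = inner ℝ p p := by
    rw [hgy, inner_mul_left_self, nN]
    ring
  have hF : (inner ℝ p (dy g z) : ℝ) = 0 := by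
    rw [hgy, real_inner_comm, re1, (sq_eq_neg_one_components hN).1, mul_zero]
  have skew := inner_mul_one (N := Q) p' p cQ
  have hLp : (inner ℝ (dx (dx g) z + dy (dy g) z) p : ℝ) = 0 := by
    rw [hLg, re1, cQ, mul_zero]
  have hLq : (inner ℝ (dx (dx g) z + dy (dy g) z) (dy g z) : ℝ) = 0 := by
    rw [hLg, hgy, inner_mul_right_self, cQN, mul_zero]
  -- The linearised statement that Δg is normal, first against g_x and then against g_y.
  have hLp' : (inner ℝ (dx (dx Y) z + dy (dy Y) z) p : ℝ) +
      inner ℝ (dx (dx g) z + dy (dy g) z) p' = 0 := by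
    rw [hLg, hLY, inner_add_left, re1, cR, skew, real_inner_comm p']
    ring
  have hLq' : (inner ℝ (dx (dx Y) z + dy (dy Y) z) (dy g z) : ℝ) +
      inner ℝ (dx (dx g) z + dy (dy g) z) (dy Y z) = 0 := by
    have e1 : (inner ℝ (Q * p') (N z * p) : ℝ) = inner ℝ p' (N z * (Q * p)) := by
      rw [inner_mul_one _ _ cQ, ← mul_assoc, eq_neg_of_add_eq_zero_left hQN, neg_mul,
        inner_neg_right, neg_neg, mul_assoc]
    have e2 : (inner ℝ (Q * p) (N z * p') : ℝ) = -inner ℝ p' (N z * (Q * p)) := by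
      rw [real_inner_comm, inner_mul_left_of_sq hN]
    rw [hLg, hLY, hgy, hYy, inner_add_left, inner_add_right, inner_mul_right_self,
      inner_mul_right_self, e1, e2]
    linear_combination ‖p‖ ^ 2 * cRN
  have hd := hasDerivAt_jetWillmore (s := dx (dy g) z) (s' := dx (dy Y) z) hg hG hF v1.symm v2 hLp
    hLq hLp' hLq'
  have hpos : (0 : ℝ) < ‖p‖ ^ 2 := by positivity
  have hO := h.jet_mem hz
  rw [fderiv_eq_of_line ((contDiffOn_jetWillmore.contDiffAt
    (isOpen_jetWillmore.mem_nhds hO)).differentiableAt (by simp)) hd, hLg, hLY, inner_add_right,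
    inner_mul_right_self, inner_mul_left_self, norm_mul, real_inner_self_eq_norm_sq, mul_pow]
  field_simp
  ring

end LocalVariation

/-! ### Harmonic left normal implies constrained Willmore -/

section Willmore

variable {M : Type*} [TopologicalSpace M] [ChartedSpace ℂ M]

/-- The infinitesimal variation of the left normal on the surface. -/
def normalVariationOn (g N Y : M → ℍ) (p : M) : ℍ :=
  normalVariation (inChart g p) (inChart N p) (inChart Y p) (chartAt ℂ p p)

variable {g N Y : M → ℍ} {U : Set M}

lemma localVariation [IsManifold 𝓘(ℂ, ℂ) 1 M] (hU : IsOpen U) (hg : IsConformalImmersionOn g U)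
    (hN : IsLeftNormalOn g N U) (hY : IsConformalVariationOn g Y U) (c : M) :
    LocalVariation (inChart g c) (inChart N c) (inChart Y c) (chartDom U c) where
  isOpen := isOpen_chartDom hU c
  smoothg _ hz := hg.1.1.inChart hU hz
  smoothN _ hz := hN.1.inChart hU hz
  smoothY _ hz := hY.1.inChart isOpen_univ ⟨hz.1, trivial⟩
  sq _ hz := hN.2.1 _ hz.2
  conformal z hz := hN.2.2 c z hz
  immersed _ hz := dx_ne_zero hU hg.1 hz (hg.2 hz.2)
  var₁ z hz := (hY.2.2.2 c z hz).1
  var₂ z hz := (hY.2.2.2 c z hz).2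

/-- The variation of the left normal does not depend on the coordinate. -/
lemma inChart_normalVariationOn [IsManifold 𝓘(ℂ, ℂ) 1 M] (hU : IsOpen U)
    (hg : IsConformalImmersionOn g U) (hN : IsLeftNormalOn g N U)
    (hY : IsConformalVariationOn g Y U) {c : M} {z : ℂ} (hz : z ∈ chartDom U c) :
    inChart (normalVariationOn g N Y) c z =
      normalVariation (inChart g c) (inChart N c) (inChart Y c) z := by
  set p := (chartAt ℂ c).symm z with hp
  have hps : p ∈ (chartAt ℂ p).source := mem_chart_source ℂ p
  have hzp : z ∈ chartDom (chartAt ℂ p).source c := ⟨hz.1, hps⟩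
  have hz' : coordChange c p z ∈ chartDom U p := coordChange_mem hzp hz.2
  have hp' := localVariation hU hg hN hY p
  have hc' := localVariation hU hg hN hY c
  have dg := ContDiffAt.diff (hp'.smoothg _ hz')
  have dY := ContDiffAt.diff (hp'.smoothY _ hz')
  have e : inChart N c z = inChart N p (coordChange c p z) :=
    (inChart_eq_comp_coordChange N hzp).self_of_nhds
  have hv := hp'.dy_variation hz'
  have ha := hp'.anticomm hz'
  have hsq := hp'.sq _ hz'
  have hconf := hp'.conformal _ hz'
  have h0 := hc'.immersed z hz
  change normalVariation (inChart g p) (inChart N p) (inChart Y p) (coordChange c p z) = _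
  rw [normalVariation.eq_1 (inChart g c), eq_mul_inv_iff_mul_eq₀ h0, dx_coordChange hzp dg,
    dx_coordChange hzp dY, dy_coordChange hzp dY, e, hconf, hv]
  set n := normalVariation (inChart g p) (inChart N p) (inChart Y p) (coordChange c p z)
  set ν := inChart N p (coordChange c p z)
  have i1 (X : ℍ) : ν * (n * X) = -(n * (ν * X)) := by
    rw [← mul_assoc, ha, neg_mul, mul_assoc]
  have i2 (X : ℍ) : ν * (ν * X) = -X := by rw [← mul_assoc, hsq, neg_one_mul]
  simp only [mul_add, mul_smul_comm, i1, i2]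
  module

/-- Conformal immersions with harmonic left normal are constrained Willmore. -/
lemma constrainedWillmore_of_harmonic [T2Space M] [IsManifold 𝓘(ℂ, ℂ) 1 M] (hU : IsOpen U)
    (hg : IsConformalImmersionOn g U) (hN : IsLeftNormalOn g N U)
    (hh : IsHarmonicSphereMapOn N U) : IsConstrainedWillmoreOn g U := by
  refine ⟨hg, fun Y hY ρ hρ => ?_⟩
  have hK : IsCompact (tsupport Y) := hY.2.1
  have hKU : tsupport Y ⊆ U := hY.2.2.1
  have hKc : IsClosed (tsupport Y) := isClosed_tsupport Y
  have hlv := localVariation hU hg hN hY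
  set j : M → ℂ → ℍ × ℍ × ℍ × ℍ × ℍ := fun c z =>
    (dx (inChart g c) z, dy (inChart g c) z, dx (dx (inChart g c)) z, dx (dy (inChart g c)) z,
      dy (dy (inChart g c)) z) with hj
  set k : M → ℂ → ℍ × ℍ × ℍ × ℍ × ℍ := fun c z =>
    (dx (inChart Y c) z, dy (inChart Y c) z, dx (dx (inChart Y c)) z, dx (dy (inChart Y c)) z,
      dy (dy (inChart Y c)) z) with hk
  have hcont {u : ℂ → ℍ} {z : ℂ} (h : ContDiffAt ℝ ∞ u z) : ContinuousAt (fun z =>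
      (dx u z, dy u z, dx (dx u) z, dx (dy u) z, dy (dy u) z)) z :=
    (ContDiffAt.dx h).continuousAt.prodMk ((ContDiffAt.dy h).continuousAt.prodMk
      ((ContDiffAt.dx (ContDiffAt.dx h)).continuousAt.prodMk
      ((ContDiffAt.dx (ContDiffAt.dy h)).continuousAt.prodMk
      (ContDiffAt.dy (ContDiffAt.dy h)).continuousAt)))
  have hline : ∀ (t : ℝ) (c : M), ∀ z ∈ chartDom (tsupport Y) c,
      willmoreDensity (inChart (fun p => g p + t • Y p) c) z =
        jetWillmore (j c z + t • k c z) := by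
    intro t c z hz
    have hz' := chartDom_mono hKU c hz
    have hW := (isOpen_chartDom hU c).eventually_mem hz'
    have h1 (e : ℂ) (w : ℂ) (hw : w ∈ chartDom U c) :
        pd e (inChart (fun p => g p + t • Y p) c) w =
          pd e (inChart g c) w + t • pd e (inChart Y c) w := by
      have := pd_add (e := e) (ContDiffAt.diff ((hlv c).smoothg w hw))
        (ContDiffAt.diff (((hlv c).smoothY w hw).const_smul t))
      rw [pd_const_smul] at this
      exact this
    have h2 (e e' : ℂ) : pd e (pd e' (inChart (fun p => g p + t • Y p) c)) z =
          pd e (pd e' (inChart g c)) z + t • pd e (pd e' (inChart Y c)) z := by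
      have e1 : pd e' (inChart (fun p => g p + t • Y p) c) =ᶠ[𝓝 z] fun w =>
          pd e' (inChart g c) w + t • pd e' (inChart Y c) w := hW.mono fun w hw => h1 e' w hw
      rw [pd_congr e1, pd_add (ContDiffAt.diff (ContDiffAt.pd ((hlv c).smoothg z hz')))
        (ContDiffAt.diff ((ContDiffAt.pd ((hlv c).smoothY z hz')).const_smul t)), pd_const_smul]
    rw [willmoreDensity_eq_jet]
    simp only [hj, hk, dx_eq_pd, dy_eq_pd, h1 _ z hz', h2]
    rfl
  have main := hasDerivAt_surfaceIntegral isOpen_jetWillmore contDiffOn_jetWillmore hρ hK hKc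
    (w := fun t c => willmoreDensity (inChart (fun p => g p + t • Y p) c)) (j := j) (k := k)
    (fun c z hz => (hcont ((hlv c).smoothg z (chartDom_mono hKU c hz))).continuousWithinAt)
    (fun c z hz => (hcont ((hlv c).smoothY z (chartDom_mono hKU c hz))).continuousWithinAt)
    (fun c z hz => (hlv c).jet_mem (chartDom_mono hKU c hz)) hline
  refine main.congr_deriv ?_
  have hsm : SmoothOn (normalVariationOn g N Y) U := by
    rw [smoothOn_iff hU]
    intro c z hz
    refine ((hlv c).smooth_normalVariation hz).congr_of_eventuallyEq ?_
    exact ((isOpen_chartDom hU c).eventually_mem hz).mono fun w hw =>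
      inChart_normalVariationOn hU hg hN hY hw
  have horth : ∀ p ∈ U, (normalVariationOn g N Y p).re = 0 ∧
      (inner ℝ (normalVariationOn g N Y p) (N p) : ℝ) = 0 := by
    intro p hp
    have := (hlv p).orthogonal (chart_mem_chartDom hp (mem_chart_source ℂ p))
    rwa [inChart_chart N (mem_chart_source ℂ p)] at this
  rw [← surfaceIntegral_energyDensity_eq_zero hU hh hsm hK hKU (fun p hp => ?_)
    (fun p hp => (horth p hp).1) (fun p hp => (horth p hp).2) hρ]
  · refine surfaceIntegral_congr ρ hKc fun c z hz => ?_
    have hz' := chartDom_mono hKU c hz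
    rw [(hlv c).fderiv_jetWillmore hz']
    have e : inChart (normalVariationOn g N Y) c =ᶠ[𝓝 z]
        normalVariation (inChart g c) (inChart N c) (inChart Y c) :=
      ((isOpen_chartDom hU c).eventually_mem hz').mono fun w hw =>
        inChart_normalVariationOn hU hg hN hY hw
    simp only [energyDensity, dx_eq_pd, dy_eq_pd, pd_congr e]
  · have hz := (mem_chart_target ℂ p)
    have h0 : inChart Y p =ᶠ[𝓝 (chartAt ℂ p p)] fun _ => 0 := by
      refine inChart_eventually_zero hKc (fun q hq => image_eq_zero_of_notMem_tsupport hq) hz ?_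
      rwa [(chartAt ℂ p).left_inv (mem_chart_source ℂ p)]
    simp only [normalVariationOn, normalVariation, dx_eq_pd, dy_eq_pd, pd_congr h0, pd_const,
      mul_zero, sub_zero, zero_mul]

end Willmore

end

end MuDarboux

namespace MuDarboux

noncomputable section

open MeasureTheory

/-! ### Hamiltonian stationary immersions -/

/-- A conformal Lagrangian immersion `f` with left normal `N`, in a coordinate. -/
structure LocalLagrangian (f N : ℂ → ℍ) (W : Set ℂ) : Prop where
  isOpen : IsOpen W
  smoothf : ∀ z ∈ W, ContDiffAt ℝ ∞ f z
  smoothN : ∀ z ∈ W, ContDiffAt ℝ ∞ N z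
  sq : ∀ z ∈ W, N z * N z = -1
  conformal : ∀ z ∈ W, dy f z = N z * dx f z
  immersed : ∀ z ∈ W, dx f z ≠ 0
  lagrangian : ∀ z ∈ W, symplectic (dx f z) (dy f z) = 0

/-- The Hamiltonian vector field along `f` of the function `h`. -/
def hamiltonianField (f : ℂ → ℍ) (h : ℂ → ℝ) (z : ℂ) : ℍ :=
  -(qj * ((inner ℝ (dx f z) (dx f z) : ℝ)⁻¹ • (dx h z • dx f z + dy h z • dy f z)))

/-- The component of `ΔN` in the direction of `jN`. -/
def angleLaplacian (N : ℂ → ℍ) (z : ℂ) : ℝ :=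
  inner ℝ (dx (dx N) z + dy (dy N) z) (qj * N z)

@[simp] lemma qj_re : qj.re = 0 := rfl

@[simp] lemma qj_imI : qj.imI = 0 := rfl

@[simp] lemma qj_imJ : qj.imJ = 1 := rfl

@[simp] lemma qj_imK : qj.imK = 0 := rfl

lemma qj_mul_self : qj * qj = -1 := by
  ext <;> simp

lemma pd_inner_eq_zero {W : Set ℂ} (hW : IsOpen W) {u v : ℂ → ℍ} (e : ℂ)
    (h : ∀ z ∈ W, (inner ℝ (u z) (v z) : ℝ) = 0) {z : ℂ} (hz : z ∈ W)
    (hu : ContDiffAt ℝ ∞ u z) (hv : ContDiffAt ℝ ∞ v z) :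
    (inner ℝ (pd e u z) (v z) : ℝ) + inner ℝ (u z) (pd e v z) = 0 := by
  have h1 : (fun w => (inner ℝ (u w) (v w) : ℝ)) =ᶠ[𝓝 z] fun _ => 0 :=
    (hW.eventually_mem hz).mono h
  rw [← pd_inner (ContDiffAt.diff hu) (ContDiffAt.diff hv), pd_congr h1, pd_const]

namespace LocalLagrangian

variable {f N : ℂ → ℍ} {W : Set ℂ}

lemma inner_dy_dy (h : LocalLagrangian f N W) {z : ℂ} (hz : z ∈ W) :
    (inner ℝ (dy f z) (dy f z) : ℝ) = inner ℝ (dx f z) (dx f z) := by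
  rw [h.conformal z hz, inner_mul_left_self, norm_of_sq_eq_neg_one (h.sq z hz)]
  ring

lemma inner_dx_dy (h : LocalLagrangian f N W) {z : ℂ} (hz : z ∈ W) :
    (inner ℝ (dx f z) (dy f z) : ℝ) = 0 := by
  have e := inner_mul_right_self (dx f z) 1 (N z)
  rw [one_mul] at e
  rw [h.conformal z hz, e]
  simp [inner_eq_components, (sq_eq_neg_one_components (h.sq z hz)).1]

lemma inner_dx_pos (h : LocalLagrangian f N W) {z : ℂ} (hz : z ∈ W) :
    (0 : ℝ) < inner ℝ (dx f z) (dx f z) := by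
  have := h.immersed z hz
  rw [real_inner_self_eq_norm_sq]
  positivity

/-- The left normal of a Lagrangian immersion takes values in a great circle. -/
lemma inner_qj (h : LocalLagrangian f N W) {z : ℂ} (hz : z ∈ W) :
    (inner ℝ (N z) qj : ℝ) = 0 := by
  have h1 := h.lagrangian z hz
  rw [symplectic, h.conformal z hz, inner_mul_right_self, ← real_inner_self_eq_norm_sq] at h1
  rw [real_inner_comm]
  exact (mul_eq_zero.mp h1).resolve_left (h.inner_dx_pos hz).ne'

lemma inner_one (h : LocalLagrangian f N W) {z : ℂ} (hz : z ∈ W) :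
    (inner ℝ (N z) (1 : ℍ) : ℝ) = 0 := by
  simp [inner_eq_components, (sq_eq_neg_one_components (h.sq z hz)).1]

lemma pd_inner_const (h : LocalLagrangian f N W) {v : ℍ}
    (hv : ∀ z ∈ W, (inner ℝ (N z) v : ℝ) = 0) (e : ℂ) {z : ℂ} (hz : z ∈ W) :
    (inner ℝ (pd e N z) v : ℝ) = 0 := by
  simpa [pd_const] using pd_inner_eq_zero h.isOpen e hv hz (h.smoothN z hz) contDiffAt_const

lemma pd_pd_inner_const (h : LocalLagrangian f N W) {v : ℍ}
    (hv : ∀ z ∈ W, (inner ℝ (N z) v : ℝ) = 0) (e : ℂ) {z : ℂ} (hz : z ∈ W) :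
    (inner ℝ (pd e (pd e N) z) v : ℝ) = 0 := by
  simpa [pd_const] using pd_inner_eq_zero h.isOpen e (fun w hw => h.pd_inner_const hv e hw) hz
    (ContDiffAt.pd (h.smoothN z hz)) contDiffAt_const

lemma inner_pd_self (h : LocalLagrangian f N W) (e : ℂ) {z : ℂ} (hz : z ∈ W) :
    (inner ℝ (pd e N z) (N z) : ℝ) = 0 :=
  (re_eq_zero_of_anticomm (h.sq z hz)
    (pd_anticomm (h.smoothN z hz) ((h.isOpen.eventually_mem hz).mono h.sq))).2

/-- The harmonic map equation for a map to a great circle. -/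
lemma harmonic (h : LocalLagrangian f N W) {z : ℂ} (hz : z ∈ W) (h0 : angleLaplacian N z = 0) :
    dx (dx N) z + dy (dy N) z + (‖dx N z‖ ^ 2 + ‖dy N z‖ ^ 2) • N z = 0 := by
  obtain ⟨r0, r1⟩ := sq_eq_neg_one_components (h.sq z hz)
  have rj := h.inner_qj hz
  -- The derivative of ⟨N_e, N⟩ = 0, which gives the N-component of the harmonic map equation. The
  -- components along 1 and j vanish because N is orthogonal to both, and the remaining one along jN
  -- is the hypothesis `h0`.
  have q (e : ℂ) : (inner ℝ (pd e (pd e N) z) (N z) : ℝ) + ‖pd e N z‖ ^ 2 = 0 := by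
    rw [← real_inner_self_eq_norm_sq]
    exact pd_inner_eq_zero h.isOpen e (fun w hw => h.inner_pd_self e hw) hz
      (ContDiffAt.pd (h.smoothN z hz)) (h.smoothN z hz)
  have qx := q 1
  have qy := q Complex.I
  have ox := h.pd_pd_inner_const (fun w hw => h.inner_one hw) 1 hz
  have oy := h.pd_pd_inner_const (fun w hw => h.inner_one hw) Complex.I hz
  have jx := h.pd_pd_inner_const (fun w hw => h.inner_qj hw) 1 hz
  have jy := h.pd_pd_inner_const (fun w hw => h.inner_qj hw) Complex.I hz
  simp only [angleLaplacian, dx_eq_pd, dy_eq_pd] at *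
  generalize pd 1 (pd 1 N) z = X at *
  generalize pd Complex.I (pd Complex.I N) z = Y at *
  generalize ‖pd 1 N z‖ ^ 2 = s at *
  generalize ‖pd Complex.I N z‖ ^ 2 = t at *
  generalize N z = n at *
  simp only [inner_eq_components, qj_re, qj_imI, qj_imJ, qj_imK, Quaternion.re_mul, Quaternion.imI_mul, Quaternion.imJ_mul,
    Quaternion.imK_mul, Quaternion.re_one, Quaternion.imI_one, Quaternion.imJ_one,
    Quaternion.imK_one, Quaternion.re_add, Quaternion.imI_add, Quaternion.imJ_add,
    Quaternion.imK_add, mul_zero, zero_mul, mul_one, one_mul, add_zero, zero_add, zero_sub,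
    sub_zero, r0] at rj ox oy jx jy h0 qx qy
  simp only [rj, jx, jy] at r1 qx qy h0
  ext
  · simp [ox, oy, r0]
  · simp only [Quaternion.imI_add, Quaternion.imI_smul, Quaternion.imI_zero, smul_eq_mul]
    linear_combination n.imK * h0 + n.imI * qx + n.imI * qy - (X.imI + Y.imI) * r1
  · simp [jx, jy, rj]
  · simp only [Quaternion.imK_add, Quaternion.imK_smul, Quaternion.imK_zero, smul_eq_mul]
    linear_combination -n.imI * h0 + n.imK * qx + n.imK * qy - (X.imK + Y.imK) * r1

lemma smooth_hamiltonianField (hl : LocalLagrangian f N W) {h : ℂ → ℝ} {z : ℂ} (hz : z ∈ W)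
    (hh : ContDiffAt ℝ ∞ h z) : ContDiffAt ℝ ∞ (hamiltonianField f h) z := by
  have sx := ContDiffAt.dx (hl.smoothf z hz)
  have sy := ContDiffAt.dy (hl.smoothf z hz)
  have si : ContDiffAt ℝ ∞ (fun w => (inner ℝ (dx f w) (dx f w) : ℝ)⁻¹) z :=
    (sx.inner ℝ sx).inv (hl.inner_dx_pos hz).ne'
  exact (contDiffAt_const.mul
    (si.smul (((ContDiffAt.dx hh).smul sx).add ((ContDiffAt.dy hh).smul sy)))).neg

/-- jZ is df applied to the gradient of h in the induced metric, so pairing jZ with df returns dh.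
-/
lemma qj_mul_hamiltonianField (f : ℂ → ℍ) (h : ℂ → ℝ) (z : ℂ) :
    qj * hamiltonianField f h z =
      (inner ℝ (dx f z) (dx f z) : ℝ)⁻¹ • (dx h z • dx f z + dy h z • dy f z) := by
  rw [hamiltonianField, mul_neg, ← mul_assoc, qj_mul_self, neg_one_mul, neg_neg]

lemma symplectic_dx (hl : LocalLagrangian f N W) (h : ℂ → ℝ) {z : ℂ} (hz : z ∈ W) :
    symplectic (hamiltonianField f h z) (dx f z) = dx h z := by
  have h0 := (hl.inner_dx_pos hz).ne'
  rw [symplectic, qj_mul_hamiltonianField, real_inner_smul_left, inner_add_left,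
    real_inner_smul_left, real_inner_smul_left, real_inner_comm (dx f z) (dy f z),
    hl.inner_dx_dy hz]
  field_simp
  ring

lemma symplectic_dy (hl : LocalLagrangian f N W) (h : ℂ → ℝ) {z : ℂ} (hz : z ∈ W) :
    symplectic (hamiltonianField f h z) (dy f z) = dy h z := by
  have h0 := (hl.inner_dx_pos hz).ne'
  rw [symplectic, qj_mul_hamiltonianField, real_inner_smul_left, inner_add_left,
    real_inner_smul_left, real_inner_smul_left, hl.inner_dy_dy hz, hl.inner_dx_dy hz]
  field_simp
  ring

lemma laplace (hl : LocalLagrangian f N W) {z : ℂ} (hz : z ∈ W) :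
    dx (dx f) z + dy (dy f) z = (dy N z + N z * dx N z) * dx f z := by
  have sf := hl.smoothf z hz
  have dN := ContDiffAt.diff (hl.smoothN z hz)
  have dX := ContDiffAt.diff (ContDiffAt.dx sf)
  have e : dy f =ᶠ[𝓝 z] fun w => N w * dx f w := (hl.isOpen.eventually_mem hz).mono hl.conformal
  have hyy : dy (dy f) z = dy N z * dx f z + N z * dx (dy f) z := by
    rw [dx_dy_comm sf, dy_eq_pd, pd_congr e, pd_mul dN dX]
    rfl
  have hxy : dx (dy f) z = dx N z * dx f z + N z * dx (dx f) z := by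
    rw [dx_eq_pd, pd_congr e, pd_mul dN dX]
    rfl
  rw [hyy, hxy, mul_add, ← mul_assoc (N z) (N z), hl.sq z hz]
  noncomm_ring

/-- Δf = (N_y + N N_x)f_x is paired with jf_x and jN f_x, the normal vectors that make up Z. -/
lemma inner_laplace_hamiltonianField (hl : LocalLagrangian f N W) (h : ℂ → ℝ) {z : ℂ}
    (hz : z ∈ W) :
    (inner ℝ (dx (dx f) z + dy (dy f) z) (hamiltonianField f h z) : ℝ) =
      -(dx h z * inner ℝ (dx N z) (qj * N z) + dy h z * inner ℝ (dy N z) (qj * N z)) := by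
  have h0 := (hl.inner_dx_pos hz).ne'
  have e : hamiltonianField f h z = -((inner ℝ (dx f z) (dx f z) : ℝ)⁻¹ •
      (dx h z • (qj * dx f z) + dy h z • (qj * N z * dx f z))) := by
    rw [hamiltonianField, hl.conformal z hz, mul_smul_comm, mul_add, mul_smul_comm, mul_smul_comm,
      mul_assoc]
  obtain ⟨r0, -⟩ := sq_eq_neg_one_components (hl.sq z hz)
  have rj := hl.inner_qj hz
  have ox := hl.pd_inner_const (fun w hw => hl.inner_one hw) 1 hz
  have oy := hl.pd_inner_const (fun w hw => hl.inner_one hw) Complex.I hz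
  have jx := hl.pd_inner_const (fun w hw => hl.inner_qj hw) 1 hz
  have jy := hl.pd_inner_const (fun w hw => hl.inner_qj hw) Complex.I hz
  -- N, N_x and N_y lie in span{i, k}, while N N_x lies in span{1, j}. Here only N N_x contributes,
  -- and in the next identity only N_y.
  have ka : (inner ℝ (dy N z + N z * dx N z) qj : ℝ) = inner ℝ (dx N z) (qj * N z) := by
    simp only [dx_eq_pd, dy_eq_pd]
    simp [inner_eq_components, r0] at rj ox oy jx jy ⊢
    simp only [jy, rj]
    ring
  have kb : (inner ℝ (dy N z + N z * dx N z) (qj * N z) : ℝ) = inner ℝ (dy N z) (qj * N z) := by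
    simp only [dx_eq_pd, dy_eq_pd]
    simp [inner_eq_components, r0] at rj ox oy jx jy ⊢
    simp only [jx, rj, ox]
    ring
  rw [e, hl.laplace hz, inner_neg_right, inner_smul_right, inner_add_right, inner_smul_right,
    inner_smul_right, inner_mul_right_self, inner_mul_right_self, ka, kb,
    ← real_inner_self_eq_norm_sq]
  field_simp

/-- The first variation of the area under a Hamiltonian variation, up to a divergence. -/
lemma firstVariation_eq (hl : LocalLagrangian f N W) {h : ℂ → ℝ} {z : ℂ} (hz : z ∈ W)
    (hh : ContDiffAt ℝ ∞ h z) :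
    (inner ℝ (dx f z) (dx (hamiltonianField f h) z) : ℝ) +
        inner ℝ (dy f z) (dy (hamiltonianField f h) z) =
      pd 1 (fun w => (inner ℝ (dx f w) (hamiltonianField f h w) : ℝ) +
        h w * inner ℝ (dx N w) (qj * N w)) z +
      pd Complex.I (fun w => (inner ℝ (dy f w) (hamiltonianField f h w) : ℝ) +
        h w * inner ℝ (dy N w) (qj * N w)) z - h z * angleLaplacian N z := by
  have sx := ContDiffAt.dx (hl.smoothf z hz)
  have sy := ContDiffAt.dy (hl.smoothf z hz)
  have sZ := hl.smooth_hamiltonianField hz hh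
  have sN := hl.smoothN z hz
  have sNx := ContDiffAt.dx sN
  have sNy := ContDiffAt.dy sN
  have sJ : ContDiffAt ℝ ∞ (fun w => qj * N w) z := contDiffAt_const.mul sN
  have sa := sNx.inner ℝ sJ
  have sb := sNy.inner ℝ sJ
  have pJ (e : ℂ) : pd e (fun w => qj * N w) z = qj * pd e N z := by
    rw [pd_mul (differentiableAt_const _) (ContDiffAt.diff sN), pd_const, zero_mul, zero_add]
  have skew (a : ℍ) : (inner ℝ a (qj * a) : ℝ) = 0 := by
    simp [inner_eq_components]
    ring
  have key := hl.inner_laplace_hamiltonianField h hz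
  rw [inner_add_left] at key
  rw [pd_add (ContDiffAt.diff (sx.inner ℝ sZ)) (ContDiffAt.diff (hh.mul sa)),
    pd_add (ContDiffAt.diff (sy.inner ℝ sZ)) (ContDiffAt.diff (hh.mul sb)),
    pd_inner (ContDiffAt.diff sx) (ContDiffAt.diff sZ),
    pd_inner (ContDiffAt.diff sy) (ContDiffAt.diff sZ),
    pd_mul_real (ContDiffAt.diff hh) (ContDiffAt.diff sa),
    pd_mul_real (ContDiffAt.diff hh) (ContDiffAt.diff sb),
    pd_inner (ContDiffAt.diff sNx) (ContDiffAt.diff sJ),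
    pd_inner (ContDiffAt.diff sNy) (ContDiffAt.diff sJ), pJ, pJ]
  simp only [angleLaplacian, inner_add_left, dx_eq_pd, dy_eq_pd, skew] at key ⊢
  linear_combination -key

lemma smooth_angleLaplacian (hl : LocalLagrangian f N W) {z : ℂ} (hz : z ∈ W) :
    ContDiffAt ℝ ∞ (angleLaplacian N) z := by
  have sN := hl.smoothN z hz
  exact ((ContDiffAt.dx (ContDiffAt.dx sN)).add (ContDiffAt.dy (ContDiffAt.dy sN))).inner ℝ
    (contDiffAt_const.mul sN)

lemma hamiltonianField_eq_zero {h : ℂ → ℝ} {z : ℂ} (hz : z ∉ tsupport h) :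
    hamiltonianField f h z = 0 := by
  have h0 : h =ᶠ[𝓝 z] fun _ => 0 := notMem_tsupport_iff_eventuallyEq.mp hz
  simp [hamiltonianField, dx_eq_pd, dy_eq_pd, pd_congr h0, pd_const]

lemma integral_firstVariation (hl : LocalLagrangian f N W) {h : ℂ → ℝ} (hh : ContDiff ℝ ∞ h)
    (hc : HasCompactSupport h) (hW : tsupport h ⊆ W) :
    ∫ z in W, ((inner ℝ (dx f z) (dx (hamiltonianField f h) z) : ℝ) +
        inner ℝ (dy f z) (dy (hamiltonianField f h) z)) =
      -∫ z in W, h z * angleLaplacian N z := by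
  have hm := hl.isOpen.measurableSet
  set A : ℂ → ℝ := fun w => (inner ℝ (dx f w) (hamiltonianField f h w) : ℝ) +
    h w * inner ℝ (dx N w) (qj * N w) with hA
  set B : ℂ → ℝ := fun w => (inner ℝ (dy f w) (hamiltonianField f h w) : ℝ) +
    h w * inner ℝ (dy N w) (qj * N w) with hB
  have sJ : ∀ z ∈ W, ContDiffAt ℝ ∞ (fun w => qj * N w) z := fun z hz =>
    contDiffAt_const.mul (hl.smoothN z hz)
  have sA : ∀ z ∈ W, ContDiffAt ℝ ∞ A z := fun z hz =>
    ((ContDiffAt.dx (hl.smoothf z hz)).inner ℝ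
      (hl.smooth_hamiltonianField hz hh.contDiffAt)).add
      (hh.contDiffAt.mul ((ContDiffAt.dx (hl.smoothN z hz)).inner ℝ (sJ z hz)))
  have sB : ∀ z ∈ W, ContDiffAt ℝ ∞ B z := fun z hz =>
    ((ContDiffAt.dy (hl.smoothf z hz)).inner ℝ
      (hl.smooth_hamiltonianField hz hh.contDiffAt)).add
      (hh.contDiffAt.mul ((ContDiffAt.dy (hl.smoothN z hz)).inner ℝ (sJ z hz)))
  have zA : ∀ z ∉ tsupport h, A z = 0 := fun z hz => by
    simp only [hA, hamiltonianField_eq_zero hz, image_eq_zero_of_notMem_tsupport hz,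
      inner_zero_right, zero_mul, add_zero]
  have zB : ∀ z ∉ tsupport h, B z = 0 := fun z hz => by
    simp only [hB, hamiltonianField_eq_zero hz, image_eq_zero_of_notMem_tsupport hz,
      inner_zero_right, zero_mul, add_zero]
  have zpd {C : ℂ → ℝ} (hC : ∀ z ∉ tsupport h, C z = 0) (e : ℂ) :
      ∀ z ∈ W, z ∉ tsupport h → pd e C z = 0 := fun z _ hz => by
    have : C =ᶠ[𝓝 z] fun _ => 0 := by
      filter_upwards [(isClosed_tsupport h).isOpen_compl.mem_nhds hz] with w hw using hC w hw
    rw [pd_congr this, pd_const]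
  have iA : IntegrableOn (pd 1 A) W := integrableOn_of_zero_off_compact hm hc
    (fun z hz => (ContDiffAt.pd (sA z (hW hz))).continuousAt.continuousWithinAt) (zpd zA 1)
  have iB : IntegrableOn (pd Complex.I B) W := integrableOn_of_zero_off_compact hm hc
    (fun z hz => (ContDiffAt.pd (sB z (hW hz))).continuousAt.continuousWithinAt)
    (zpd zB Complex.I)
  have iC : IntegrableOn (fun z => h z * angleLaplacian N z) W :=
    integrableOn_of_zero_off_compact hm hc
      (fun z hz => (hh.contDiffAt.mul (hl.smooth_angleLaplacian
        (hW hz))).continuousAt.continuousWithinAt)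
      (fun z _ hz => by rw [image_eq_zero_of_notMem_tsupport hz, zero_mul])
  have iAB : IntegrableOn (fun z => pd 1 A z + pd Complex.I B z) W := iA.add iB
  rw [setIntegral_congr_fun hm fun z hz => hl.firstVariation_eq hz hh.contDiffAt,
    integral_sub iAB iC, integral_add iA iB,
    integral_pd_eq_zero hl.isOpen hc hW sA (fun z _ hz => zA z hz),
    integral_pd_eq_zero hl.isOpen hc hW sB (fun z _ hz => zB z hz)]
  ring

end LocalLagrangian

end

end MuDarboux

namespace MuDarboux

noncomputable section

open MeasureTheory

variable {M : Type*} [TopologicalSpace M] [ChartedSpace ℂ M]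

/-! ### From one chart to the surface: Hamiltonian variations and harmonicity -/

section Extension

variable {F : Type*} [NormedAddCommGroup F]

/-- The extension by zero of a function given in the chart `chartAt ℂ c`. -/
def chartExtension (c : M) (u : ℂ → F) : M → F :=
  (chartAt ℂ c).source.indicator (u ∘ chartAt ℂ c)

lemma inChart_chartExtension {c : M} (u : ℂ → F) {z : ℂ} (hz : z ∈ (chartAt ℂ c).target) :
    inChart (chartExtension c u) c z = u z := by
  simp only [inChart, chartExtension, Function.comp_apply]
  rw [Set.indicator_of_mem ((chartAt ℂ c).map_target hz), Function.comp_apply,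
    (chartAt ℂ c).right_inv hz]

lemma inChart_chartExtension_eventuallyEq {c : M} (u : ℂ → F) {z : ℂ}
    (hz : z ∈ (chartAt ℂ c).target) : inChart (chartExtension c u) c =ᶠ[𝓝 z] u := by
  filter_upwards [(chartAt ℂ c).open_target.mem_nhds hz] with w hw
  exact inChart_chartExtension u hw

lemma isCompact_image_symm {c : M} {S : Set ℂ} (hS : IsCompact S)
    (hSW : S ⊆ (chartAt ℂ c).target) : IsCompact ((chartAt ℂ c).symm '' S) :=
  hS.image_of_continuousOn ((chartAt ℂ c).continuousOn_symm.mono hSW)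

lemma image_symm_subset {c : M} {S : Set ℂ} (hSW : S ⊆ (chartAt ℂ c).target) :
    (chartAt ℂ c).symm '' S ⊆ (chartAt ℂ c).source := by
  rintro _ ⟨z, hz, rfl⟩
  exact (chartAt ℂ c).map_target (hSW hz)

lemma chartExtension_eq_zero {c : M} {u : ℂ → F} {S : Set ℂ} (h0 : ∀ z ∉ S, u z = 0) {p : M}
    (hp : p ∉ (chartAt ℂ c).symm '' S) : chartExtension c u p = 0 := by
  by_cases hc : p ∈ (chartAt ℂ c).source
  · rw [chartExtension, Set.indicator_of_mem hc, Function.comp_apply]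
    exact h0 _ fun h => hp ⟨_, h, (chartAt ℂ c).left_inv hc⟩
  · exact Set.indicator_of_notMem hc _

lemma tsupport_chartExtension_subset [T2Space M] {c : M} {u : ℂ → F} {S : Set ℂ}
    (hS : IsCompact S) (hSW : S ⊆ (chartAt ℂ c).target) (h0 : ∀ z ∉ S, u z = 0) :
    tsupport (chartExtension c u) ⊆ (chartAt ℂ c).symm '' S :=
  closure_minimal (fun p hp => by
    by_contra h
    exact hp (chartExtension_eq_zero h0 h)) (isCompact_image_symm hS hSW).isClosed

lemma hasCompactSupport_chartExtension [T2Space M] {c : M} {u : ℂ → F} {S : Set ℂ}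
    (hS : IsCompact S) (hSW : S ⊆ (chartAt ℂ c).target) (h0 : ∀ z ∉ S, u z = 0) :
    HasCompactSupport (chartExtension c u) :=
  HasCompactSupport.intro (isCompact_image_symm hS hSW) fun _ hp => chartExtension_eq_zero h0 hp

lemma contDiffAt_coordChange [IsManifold 𝓘(ℂ, ℂ) 1 M] {c c' : M} {z : ℂ}
    (hz : z ∈ chartDom (chartAt ℂ c').source c) : ContDiffAt ℝ ∞ (coordChange c c') z := by
  have h := coordChange_differentiableOn (chart_mem_atlas ℂ c) (chart_mem_atlas ℂ c')
  have hz' : z ∈ ((chartAt ℂ c).symm.trans (chartAt ℂ c')).source := by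
    rw [OpenPartialHomeomorph.trans_source]
    exact hz
  exact ((h.contDiffAt (((chartAt ℂ c).symm.trans (chartAt ℂ c')).open_source.mem_nhds
    hz')).restrict_scalars ℝ).of_le (by simp)

lemma smoothOn_chartExtension [NormedSpace ℝ F] [T2Space M] [IsManifold 𝓘(ℂ, ℂ) 1 M] {c : M} {u : ℂ → F}
    {S : Set ℂ} (hS : IsCompact S) (hSW : S ⊆ (chartAt ℂ c).target) (h0 : ∀ z ∉ S, u z = 0)
    (hu : ∀ z ∈ (chartAt ℂ c).target, ContDiffAt ℝ ∞ u z) :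
    SmoothOn (chartExtension c u) Set.univ := by
  rw [smoothOn_iff isOpen_univ]
  intro c' z hz
  by_cases hc : (chartAt ℂ c').symm z ∈ (chartAt ℂ c).source
  · have hzc : z ∈ chartDom (chartAt ℂ c).source c' := ⟨hz.1, hc⟩
    have hw : coordChange c' c z ∈ (chartAt ℂ c).target := (chartAt ℂ c).map_source hc
    have h1 : ContDiffAt ℝ ∞ (inChart (chartExtension c u) c) (coordChange c' c z) :=
      (hu _ hw).congr_of_eventuallyEq (inChart_chartExtension_eventuallyEq u hw)
    exact (ContDiffAt.comp z h1 (contDiffAt_coordChange hzc)).congr_of_eventuallyEq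
      (inChart_eq_comp_coordChange _ hzc)
  · exact contDiffAt_const.congr_of_eventuallyEq (inChart_eventually_zero
      (isCompact_image_symm hS hSW).isClosed (fun p hp => chartExtension_eq_zero h0 hp) hz.1
      fun h => hc (image_symm_subset hSW h))

end Extension

lemma localLagrangian [IsManifold 𝓘(ℂ, ℂ) 1 M] {f N : M → ℍ}
    (hf : IsConformalImmersionOn f Set.univ) (hL : IsLagrangian f)
    (hN : IsLeftNormalOn f N Set.univ) (c : M) :
    LocalLagrangian (inChart f c) (inChart N c) (chartAt ℂ c).target where
  isOpen := (chartAt ℂ c).open_target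
  smoothf _ hz := hf.1.1.inChart isOpen_univ ⟨hz, trivial⟩
  smoothN _ hz := hN.1.inChart isOpen_univ ⟨hz, trivial⟩
  sq _ _ := hN.2.1 _ trivial
  conformal z hz := hN.2.2 c z ⟨hz, trivial⟩
  immersed _ hz := dx_ne_zero isOpen_univ hf.1 ⟨hz, trivial⟩ (hf.2 trivial)
  lagrangian := hL c

/-- A function with compact support in a chart generates a Hamiltonian variation. -/
lemma isHamiltonianVariation_chartExtension [T2Space M] [IsManifold 𝓘(ℂ, ℂ) 1 M] {f N : M → ℍ}
    (hf : IsConformalImmersionOn f Set.univ) (hL : IsLagrangian f)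
    (hN : IsLeftNormalOn f N Set.univ) {c : M} {h : ℂ → ℝ} (hh : ContDiff ℝ ∞ h)
    (hc : HasCompactSupport h) (hW : tsupport h ⊆ (chartAt ℂ c).target) :
    IsHamiltonianVariation f (chartExtension c (hamiltonianField (inChart f c) h)) := by
  have hl := localLagrangian hf hL hN c
  have z1 : ∀ z ∉ tsupport h, h z = 0 := fun z hz => image_eq_zero_of_notMem_tsupport hz
  have z2 : ∀ z ∉ tsupport h, hamiltonianField (inChart f c) h z = 0 := fun z hz =>
    LocalLagrangian.hamiltonianField_eq_zero hz
  refine ⟨smoothOn_chartExtension hc hW z2 fun z hz =>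
      hl.smooth_hamiltonianField hz hh.contDiffAt, hasCompactSupport_chartExtension hc hW z2,
    chartExtension c h, smoothOn_chartExtension hc hW z1 fun z _ => hh.contDiffAt,
    hasCompactSupport_chartExtension hc hW z1, fun c' z hz => ?_⟩
  set Z := chartExtension c (hamiltonianField (inChart f c) h)
  by_cases hzc : (chartAt ℂ c').symm z ∈ (chartAt ℂ c).source
  · have hzc' : z ∈ chartDom (chartAt ℂ c).source c' := ⟨hz, hzc⟩
    have hw : coordChange c' c z ∈ (chartAt ℂ c).target := (chartAt ℂ c).map_source hzc
    have e := inChart_chartExtension_eventuallyEq h hw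
    have eZ : inChart Z c' z =
        hamiltonianField (inChart f c) h (coordChange c' c z) :=
      (inChart_eq_comp_coordChange Z hzc').self_of_nhds.trans (inChart_chartExtension _ hw)
    have df := ContDiffAt.diff (hl.smoothf _ hw)
    have dh : DifferentiableAt ℝ (inChart (chartExtension c h) c) (coordChange c' c z) :=
      (ContDiffAt.diff hh.contDiffAt).congr_of_eventuallyEq e
    have hx := hl.symplectic_dx h hw
    have hy := hl.symplectic_dy h hw
    have ex : dx (inChart (chartExtension c h) c) (coordChange c' c z) =
      dx h (coordChange c' c z) := pd_congr e
    have ey : dy (inChart (chartExtension c h) c) (coordChange c' c z) =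
      dy h (coordChange c' c z) := pd_congr e
    rw [dx_coordChange hzc' df, dy_coordChange hzc' df, dx_coordChange hzc' dh,
      dy_coordChange hzc' dh, eZ, ex, ey, ← hx, ← hy]
    simp only [symplectic, inner_add_right, inner_neg_right, inner_smul_right, smul_eq_mul,
      and_self]
  · have hp {S : Set ℂ} (hS : S ⊆ (chartAt ℂ c).target) :
        (chartAt ℂ c').symm z ∉ (chartAt ℂ c).symm '' S := fun h => hzc (image_symm_subset hS h)
    have hT := (isCompact_image_symm hc hW).isClosed
    have eZ : inChart Z c' =ᶠ[𝓝 z] fun _ => 0 := inChart_eventually_zero hT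
      (fun p hp => chartExtension_eq_zero z2 hp) hz (hp hW)
    have eh : inChart (chartExtension c h) c' =ᶠ[𝓝 z] fun _ => 0 := inChart_eventually_zero hT
      (fun p hp => chartExtension_eq_zero z1 hp) hz (hp hW)
    rw [eZ.self_of_nhds, dx_eq_pd, dy_eq_pd, dx_eq_pd, dy_eq_pd, pd_congr eh, pd_congr eh]
    simp [symplectic, pd_const]

/-- A compact set in the domain of a chart meets only one member of a suitable partition of
unity. -/
lemma exists_partition_eq_one [T2Space M] [SecondCountableTopology M] [IsManifold 𝓘(ℂ, ℂ) 1 M]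
    {c : M} {K : Set M} (hK : IsClosed K) (hc : K ⊆ (chartAt ℂ c).source) :
    ∃ ρ : ChartPartition M, IsSubordinateToCharts ρ ∧ ∀ p ∈ K, ρ c p = 1 ∧
      ∀ c' ≠ c, ρ c' p = 0 := by
  classical
  have : IsManifold 𝓘(ℝ, ℂ) ∞ M := isManifold_real
  have : LocallyCompactSpace M := ChartedSpace.locallyCompactSpace ℂ M
  -- Removing K from every chart domain except that of c leaves ρ_c as the only function of the
  -- partition that is nonzero on K.
  set V : M → Set M := fun c' => if c' = c then (chartAt ℂ c').source
    else (chartAt ℂ c').source \ K with hV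
  have hVo : ∀ c', IsOpen (V c') := fun c' => by
    simp only [hV]
    split_ifs
    · exact (chartAt ℂ c').open_source
    · exact (chartAt ℂ c').open_source.sdiff hK
  have hVs : ∀ c', V c' ⊆ (chartAt ℂ c').source := fun c' => by
    simp only [hV]
    split_ifs
    · exact subset_rfl
    · exact Set.sdiff_subset
  have hcov : (Set.univ : Set M) ⊆ ⋃ c', V c' := fun p _ => by
    by_cases hp : p ∈ K
    · exact Set.mem_iUnion_of_mem c (by simpa [hV] using hc hp)
    · refine Set.mem_iUnion_of_mem p ?_
      simp only [hV]
      split_ifs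
      · exact mem_chart_source ℂ p
      · exact ⟨mem_chart_source ℂ p, hp⟩
  obtain ⟨ρ, hρ⟩ := SmoothPartitionOfUnity.exists_isSubordinate 𝓘(ℝ, ℂ) isClosed_univ V hVo hcov
  refine ⟨ρ, fun c' => (hρ c').trans (hVs c'), fun p hp => ?_⟩
  have h0 : ∀ c' ≠ c, ρ c' p = 0 := fun c' hc' => by
    refine partition_eq_zero fun h => ?_
    have := hρ c' h
    simp only [hV, if_neg hc'] at this
    exact this.2 hp
  refine ⟨?_, h0⟩
  rw [← ρ.sum_eq_one (Set.mem_univ p), finsum_eq_single _ c h0]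

lemma surfaceIntegral_eq_integral {ρ : ChartPartition M} {c : M} {K : Set M} (hK : IsClosed K)
    (hρ : ∀ p ∈ K, ρ c p = 1 ∧ ∀ c' ≠ c, ρ c' p = 0) (w : M → ℂ → ℝ) :
    surfaceIntegral ρ K w = ∫ z in chartDom K c, w c z := by
  rw [surfaceIntegral, finsum_eq_single _ c]
  · refine setIntegral_congr_fun (measurableSet_chartDom_of_isClosed hK c) fun z hz => ?_
    simp only [(hρ _ hz.2).1, one_mul]
  · intro c' hc'
    refine setIntegral_eq_zero_of_forall_eq_zero fun z hz => ?_
    rw [(hρ _ hz.2).2 c' hc', zero_mul]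

/-- The first variation of the area of a Lagrangian immersion. -/
lemma hasDerivAt_area [T2Space M] [IsManifold 𝓘(ℂ, ℂ) 1 M] {f N Z : M → ℍ}
    (hf : IsConformalImmersionOn f Set.univ) (hL : IsLagrangian f)
    (hN : IsLeftNormalOn f N Set.univ) (hZ : SmoothOn Z Set.univ) (hc : HasCompactSupport Z)
    {ρ : ChartPartition M} (hρ : IsSubordinateToCharts ρ) :
    HasDerivAt (fun t : ℝ => area ρ (tsupport Z) (fun p => f p + t • Z p))
      (surfaceIntegral ρ (tsupport Z) fun c z =>
        (inner ℝ (dx (inChart f c) z) (dx (inChart Z c) z) : ℝ) +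
          inner ℝ (dy (inChart f c) z) (dy (inChart Z c) z)) 0 := by
  have hl := localLagrangian hf hL hN
  have sZ (c : M) : ∀ z ∈ (chartAt ℂ c).target, ContDiffAt ℝ ∞ (inChart Z c) z := fun z hz =>
    hZ.inChart isOpen_univ ⟨hz, trivial⟩
  have hcont {u : ℂ → ℍ} {z : ℂ} (h : ContDiffAt ℝ ∞ u z) :
      ContinuousAt (fun z => (dx u z, dy u z)) z :=
    (ContDiffAt.dx h).continuousAt.prodMk (ContDiffAt.dy h).continuousAt
  have hmem (c : M) : ∀ z ∈ (chartAt ℂ c).target, (dx (inChart f c) z, dy (inChart f c) z) ∈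
      {x : ℍ × ℍ | 0 < jetDet x.1 x.2} := fun z hz => by
    simp only [Set.mem_ofPred_eq, jetDet]
    rw [(hl c).inner_dy_dy hz, (hl c).inner_dx_dy hz]
    have := mul_pos ((hl c).inner_dx_pos hz) ((hl c).inner_dx_pos hz)
    linarith
  have main := hasDerivAt_surfaceIntegral isOpen_jetArea contDiffOn_jetArea hρ hc
    (isClosed_tsupport Z) (w := fun t c => areaDensity (inChart (fun p => f p + t • Z p) c))
    (j := fun c z => (dx (inChart f c) z, dy (inChart f c) z))
    (k := fun c z => (dx (inChart Z c) z, dy (inChart Z c) z))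
    (fun c z hz => (hcont ((hl c).smoothf z hz.1)).continuousWithinAt)
    (fun c z hz => (hcont (sZ c z hz.1)).continuousWithinAt)
    (fun c z hz => hmem c z hz.1) (fun t c z hz => ?_)
  · refine main.congr_deriv (surfaceIntegral_congr ρ (isClosed_tsupport Z) fun c z hz => ?_)
    exact fderiv_eq_of_line ((contDiffOn_jetArea.contDiffAt
      (isOpen_jetArea.mem_nhds (hmem c z hz.1))).differentiableAt (by simp))
      (hasDerivAt_jetArea ((hl c).immersed z hz.1) ((hl c).inner_dy_dy hz.1)
        ((hl c).inner_dx_dy hz.1))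
  · have h1 (e : ℂ) : pd e (inChart (fun p => f p + t • Z p) c) z =
        pd e (inChart f c) z + t • pd e (inChart Z c) z := by
      have := pd_add (e := e) (ContDiffAt.diff ((hl c).smoothf z hz.1))
        (ContDiffAt.diff ((sZ c z hz.1).const_smul t))
      rw [pd_const_smul] at this
      exact this
    rw [areaDensity_eq_jet]
    simp only [dx_eq_pd, dy_eq_pd, h1]
    rfl

/-- The area derivative along the Hamiltonian field of h is 0 by stationarity and −∫ h⟨ΔN, jN⟩ by
the first variation formula. A partition equal to 1 on the support makes the surface integral an
integral in one chart. -/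
lemma integral_mul_angleLaplacian [T2Space M] [SecondCountableTopology M]
    [IsManifold 𝓘(ℂ, ℂ) 1 M] {f N : M → ℍ} (hf : IsHamiltonianStationary f)
    (hN : IsLeftNormalOn f N Set.univ) {c : M} {h : ℂ → ℝ} (hh : ContDiff ℝ ∞ h)
    (hc : HasCompactSupport h) (hW : tsupport h ⊆ (chartAt ℂ c).target) :
    ∫ z in (chartAt ℂ c).target, h z * angleLaplacian (inChart N c) z = 0 := by
  obtain ⟨hf, hL, hstat⟩ := hf
  have hl := localLagrangian hf hL hN c
  have hvar := isHamiltonianVariation_chartExtension hf hL hN hh hc hW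
  set Z := chartExtension c (hamiltonianField (inChart f c) h) with hZ
  have z2 : ∀ z ∉ tsupport h, hamiltonianField (inChart f c) h z = 0 := fun z hz =>
    LocalLagrangian.hamiltonianField_eq_zero hz
  have hKs : tsupport Z ⊆ (chartAt ℂ c).source :=
    (tsupport_chartExtension_subset hc hW z2).trans (image_symm_subset hW)
  obtain ⟨ρ, hρ, hρ1⟩ := exists_partition_eq_one (isClosed_tsupport Z) hKs
  have h1 := (hasDerivAt_area hf hL hN hvar.1 hvar.2.1 hρ).unique (hstat Z hvar ρ hρ)
  rw [surfaceIntegral_eq_integral (isClosed_tsupport Z) hρ1,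
    ← setIntegral_eq_of_subset_of_forall_sdiff_eq_zero (chartAt ℂ c).open_target.measurableSet
      (fun z hz => hz.1 : chartDom (tsupport Z) c ⊆ (chartAt ℂ c).target) fun z hz => ?_] at h1
  · have h2 := hl.integral_firstVariation hh hc hW
    rw [← setIntegral_congr_fun (chartAt ℂ c).open_target.measurableSet fun z hz => ?_, h1] at h2
    · linarith
    · have e := inChart_chartExtension_eventuallyEq (hamiltonianField (inChart f c) h) hz
      simp only [dx_eq_pd, dy_eq_pd, hZ, pd_congr e]
  · have e : inChart Z c =ᶠ[𝓝 z] fun _ => 0 := inChart_eventually_zero (isClosed_tsupport Z)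
      (fun p hp => image_eq_zero_of_notMem_tsupport hp) hz.1 fun h => hz.2 ⟨hz.1, h⟩
    simp only [dx_eq_pd, dy_eq_pd, pd_congr e, pd_const, inner_zero_right, add_zero]

/-- The left normal of a Hamiltonian stationary immersion is harmonic. -/
lemma IsHamiltonianStationary.harmonic [T2Space M] [SecondCountableTopology M]
    [IsManifold 𝓘(ℂ, ℂ) 1 M] {f N : M → ℍ} (hf : IsHamiltonianStationary f)
    (hN : IsLeftNormalOn f N Set.univ) : IsHarmonicSphereMapOn N Set.univ := by
  refine ⟨hN.1, hN.2.1, fun c z hz => ?_⟩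
  have hl := localLagrangian hf.1 hf.2.1 hN c
  have hcont : ContinuousOn (angleLaplacian (inChart N c)) (chartAt ℂ c).target := fun w hw =>
    (hl.smooth_angleLaplacian hw).continuousAt.continuousWithinAt
  -- The fundamental lemma of the calculus of variations; continuity of ⟨ΔN, jN⟩ later removes the
  -- exceptional null set.
  have hae := hl.isOpen.ae_eq_zero_of_integral_contDiff_smul_eq_zero (μ := (volume : Measure ℂ))
    (hcont.locallyIntegrableOn hl.isOpen.measurableSet) fun h hh hc hW => by
      rw [← integral_mul_angleLaplacian hf hN hh hc hW]
      refine (setIntegral_eq_integral_of_forall_compl_eq_zero fun w hw => ?_).symm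
      rw [image_eq_zero_of_notMem_tsupport fun h => hw (hW h), zero_smul]
  have hae' : angleLaplacian (inChart N c) =ᵐ[volume.restrict (chartAt ℂ c).target] 0 := by
    rw [Filter.EventuallyEq, ae_restrict_iff' hl.isOpen.measurableSet]
    exact hae
  exact hl.harmonic hz.1
    (Measure.eqOn_open_of_ae_eq hae' hl.isOpen hcont continuousOn_const hz.1)

lemma IsHarmonicSphereMapOn.mono {N : M → ℍ} {U V : Set M} (h : IsHarmonicSphereMapOn N U)
    (hV : V ⊆ U) : IsHarmonicSphereMapOn N V :=
  ⟨h.1.mono' hV, fun p hp => h.2.1 p (hV hp), fun c z hz => h.2.2 c z (chartDom_mono hV c hz)⟩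

lemma IsWeaklyConformalOn.mono {f : M → ℍ} {U V : Set M} (h : IsWeaklyConformalOn f U)
    (hV : V ⊆ U) : IsWeaklyConformalOn f V :=
  ⟨h.1.mono' hV, fun c z hz => h.2 c z (chartDom_mono hV c hz)⟩

end

end MuDarboux

theorem mainTheorem3 {M : Type*} [TopologicalSpace M] [T2Space M] [SecondCountableTopology M]
    [ChartedSpace ℂ M] [IsManifold 𝓘(ℂ, ℂ) 1 M] :
    (∀ f : M → ℍ, MuDarboux.IsHamiltonianStationary f →
      ∀ μ : ℂ, μ ≠ 0 → ∀ U : Set M, IsOpen U → ∀ fh : M → ℍ,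
        MuDarboux.IsMuDarbouxTransformOn f μ fh U →
          (∃ Nh : M → ℍ, MuDarboux.IsLeftNormalOn fh Nh U) ∧
          (∀ Nh : M → ℍ, MuDarboux.IsLeftNormalOn fh Nh U →
            MuDarboux.IsHarmonicSphereMapOn Nh U) ∧
          MuDarboux.IsConstrainedWillmoreOn fh (U ∩ MuDarboux.regularSet fh)) ∧
    (∀ U : Set M, IsOpen U → ∀ g N : M → ℍ,
      MuDarboux.IsConformalImmersionOn g U → MuDarboux.IsLeftNormalOn g N U →
        MuDarboux.IsHarmonicSphereMapOn N U → MuDarboux.IsConstrainedWillmoreOn g U) := by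
  refine ⟨fun f hf μ hμ U hU fh h => ?_, fun U hU g N hg hN hh =>
    MuDarboux.constrainedWillmore_of_harmonic hU hg hN hh⟩
  obtain ⟨⟨Nh, hNh⟩, harm⟩ :=
    MuDarboux.darboux_leftNormal hμ hU hf.1 (fun _ hN => hf.harmonic hN) h
  -- Away from the branch points f̂ is a conformal immersion of an open set, and the left normal
  -- restricts to it.
  exact ⟨⟨Nh, hNh⟩, harm, MuDarboux.constrainedWillmore_of_harmonic
    (MuDarboux.isOpen_inter_regularSet hU h.1.1.1)
    ⟨h.1.1.mono Set.inter_subset_left, Set.inter_subset_right⟩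
    (hNh.mono Set.inter_subset_left) ((harm Nh hNh).mono Set.inter_subset_left)⟩
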